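/- Let $G$ be a finite simple graph with vertex set $\{0,\dots,n-1\}$ and a nonnegative integer weight $w(v)$ on each vertex $v$. A weighted coloring of $(G,w)$ consists of stable sets $S_1,\dots,S_t$ of $G$ and nonnegative integers $I(S_1),\dots,I(S_t)$ with $\sum_{i:\,v\in S_i} I(S_i)\ge w(v)$ for every vertex $v$; it is minimum if $\sum_{i=1}^t I(S_i)$ is as small as possible. The graph $G$ is $(P_5,\overline{P_5})$-free if no induced subgraph of $G$ is isomorphic to the path $P_5$ on five vertices or to its complement $\overline{P_5}$. Theorem. There is an $O(n^3)$ algorithm that finds a minimum weighted coloring of every weighted $(P_5,\overline{P_5})$-free graph. Precisely: there are a single random access machine program, a constant $d$ and a function $T$ with $T(n)=O(n^3)$ such that, for every $n\ge 0$, every $(P_5,\overline{P_5})$-free graph $G$ on $n$ vertices and every weight function $w$ with maximum $W$ ($W=0$ if $n=0$), the program, started with $n$, the adjacency matrix of $G$ and the weights $w$ in its memory, halts after at most $T(n)$ steps with a minimum weighted coloring of $(G,w)$ in its memory (the number of sets, their characteristic vectors, and their weights). Each memory access, each test, and each addition, truncated subtraction, multiplication, integer division or comparison counts as one step, and all numbers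 used by the program are at most $(n+W+2)^d$, i.e. words have $O(\log(n+W+2))$ bits. The bound $T(n)$ does not depend on the weights. -/

import Mathlib

open scoped Classical in
/-- A weighted coloring of a graph `G` with vertex weights `w : V → ℕ`: stable sets
`S 0, …, S (size - 1)` with nonnegative integers `I 0, …, I (size - 1)` such that the sets
containing `v` have total weight at least `w v`. -/
structure WeightedColoring {V : Type*} (G : SimpleGraph V) (w : V → ℕ) where
  size : ℕ
  S : Fin size → Set V
  I : Fin size → ℕ
  stable : ∀ k, G.IsIndepSet (S k)
  covers : ∀ v, w v ≤ ∑ k with v ∈ S k, I k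

namespace WeightedColoring

variable {V : Type*} {G : SimpleGraph V} {w : V → ℕ}

/-- The total weight of a weighted coloring. -/
def total (c : WeightedColoring G w) : ℕ := ∑ k, c.I k

/-- A minimum weighted coloring: its total weight is the weighted chromatic number. -/
def IsMinimum (c : WeightedColoring G w) : Prop :=
  ∀ c' : WeightedColoring G w, c.total ≤ c'.total

end WeightedColoring

/-- `G` has no induced path on five vertices and no induced complement of that path. -/
def IsP5CoP5Free {V : Type*} (G : SimpleGraph V) : Prop :=
  ¬ (SimpleGraph.pathGraph 5).IsIndContained G ∧ ¬ (SimpleGraph.pathGraph 5)ᶜ.IsIndContained G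

/-! A unit-cost random access machine with words of bounded size, programmed by structured
programs. The memory is divided into arrays; the name of an array is a literal in the program
(so a program uses only finitely many of them), and the position within an array is computed
at run time (indirect addressing). A scalar variable is position `0` of an array. -/

namespace WordRAM

/-- Contents of the memory: `σ a i` is the word at position `i` of the array named `a`. -/
abbrev State : Type := ℕ → ℕ → ℕ

/-- The arithmetic and comparison operations on words. -/
inductive Op : Type
  | add
  | sub
  | mul
  | div
  | lt
  | eq

/-- Subtraction is truncated at `0`, division rounds down (and division by `0` yields `0`),
a comparison yields `1` if it holds and `0` if not. -/
def Op.eval : Op → ℕ → ℕ → ℕ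
  | .add, x, y => x + y
  | .sub, x, y => x - y
  | .mul, x, y => x * y
  | .div, x, y => x / y
  | .lt, x, y => if x < y then 1 else 0
  | .eq, x, y => if x = y then 1 else 0

/-- Expressions: constants, reading position `i` of array `a`, binary operations. -/
inductive Expr : Type
  | const (c : ℕ)
  | read (a : ℕ) (i : Expr)
  | op (o : Op) (x y : Expr)

namespace Expr

/-- The value of an expression. -/
def eval (σ : State) : Expr → ℕ
  | const c => c
  | read a i => σ a (i.eval σ)
  | op o x y => o.eval (x.eval σ) (y.eval σ)

/-- The number of elementary steps for evaluating an expression: one for each constant, each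
access to the memory and each operation. -/
def cost : Expr → ℕ
  | const _ => 1
  | read _ i => i.cost + 1
  | op _ x y => x.cost + y.cost + 1

/-- No overflow: every constant and every result of an operation met in evaluating the
expression is at most `B`, the largest number that fits into a word. -/
def Fits (B : ℕ) (σ : State) : Expr → Prop
  | const c => c ≤ B
  | read _ i => i.Fits B σ
  | op o x y => x.Fits B σ ∧ y.Fits B σ ∧ (op o x y).eval σ ≤ B

end Expr

/-- Programs: `assign a i e` stores the value of `e` at position `i` of array `a`; `ite` and
`loop` (the while loop) take a nonzero value of `e` for "true". -/
inductive Prog : Type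
  | skip
  | assign (a : ℕ) (i e : Expr)
  | seq (p q : Prog)
  | ite (e : Expr) (p q : Prog)
  | loop (e : Expr) (p : Prog)

/-- The state `σ` after storing `x` at position `i` of array `a`. -/
def State.store (σ : State) (a i x : ℕ) : State :=
  fun a' i' => if a' = a ∧ i' = i then x else σ a' i'

/-- `Exec B p σ t τ`: with words for the numbers `0, …, B`, the program `p` started in the state
`σ` halts after exactly `t` steps in the state `τ`, and no overflow occurs. -/
inductive Exec (B : ℕ) : Prog → State → ℕ → State → Prop
  | skip (σ : State) : Exec B .skip σ 1 σ
  | assign (a : ℕ) (i e : Expr) (σ : State) (hi : i.Fits B σ) (he : e.Fits B σ) :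
      Exec B (.assign a i e) σ (i.cost + e.cost + 1) (σ.store a (i.eval σ) (e.eval σ))
  | seq {p q : Prog} {σ ρ τ : State} {s t : ℕ} (hp : Exec B p σ s ρ) (hq : Exec B q ρ t τ) :
      Exec B (.seq p q) σ (s + t) τ
  | ite_true {e : Expr} {p q : Prog} {σ τ : State} {t : ℕ} (he : e.Fits B σ)
      (hne : e.eval σ ≠ 0) (hp : Exec B p σ t τ) : Exec B (.ite e p q) σ (e.cost + 1 + t) τ
  | ite_false {e : Expr} {p q : Prog} {σ τ : State} {t : ℕ} (he : e.Fits B σ)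
      (hz : e.eval σ = 0) (hq : Exec B q σ t τ) : Exec B (.ite e p q) σ (e.cost + 1 + t) τ
  | loop_stop {e : Expr} {p : Prog} {σ : State} (he : e.Fits B σ)
      (hz : e.eval σ = 0) : Exec B (.loop e p) σ (e.cost + 1) σ
  | loop_step {e : Expr} {p : Prog} {σ ρ τ : State} {s t : ℕ} (he : e.Fits B σ)
      (hne : e.eval σ ≠ 0) (hp : Exec B p σ s ρ) (hl : Exec B (.loop e p) ρ t τ) :
      Exec B (.loop e p) σ (e.cost + 1 + s + t) τ

open scoped Classical in
/-- The initial memory for a weighted graph on the vertices `0, …, n - 1`: array `0` holds `n`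
(at position `0`), array `1` the adjacency matrix, row by row, array `2` the weights; every
other word is `0`. -/
noncomputable def input {n : ℕ} (G : SimpleGraph (Fin n)) (w : Fin n → ℕ) : State
  | 0, 0 => n
  | 1, p => if ∃ i j : Fin n, p = i.val * n + j.val ∧ G.Adj i j then 1 else 0
  | 2, p => if h : p < n then w ⟨p, h⟩ else 0
  | _, _ => 0

open scoped Classical in
/-- The final memory `τ` holds the weighted coloring `c`: array `3` holds the number of stable
sets (at position `0`), array `4` their characteristic vectors, one after the other, array `5`
their weights. -/
def Outputs {n : ℕ} {G : SimpleGraph (Fin n)} {w : Fin n → ℕ} (τ : State)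
    (c : WeightedColoring G w) : Prop :=
  τ 3 0 = c.size ∧
    (∀ (k : Fin c.size) (v : Fin n), τ 4 (k.val * n + v.val) = if v ∈ c.S k then 1 else 0) ∧
    ∀ k : Fin c.size, τ 5 k.val = c.I k

end WordRAM

/-!
A *buoy* of a graph without induced `P₅` and house (the complement of `P₅`) consists of the vertices
of an induced five-cycle and their twins with respect to it. Every other vertex sees all or nothing
of a five-cycle (`IsC5.adj_all_or_none_or_twin`), so a buoy is a homogeneous set, and so is each of
its five parts; between the parts, adjacency is as in the five-cycle (`Twin.adj_iff`). If no
five-cycle is left, then the graph is perfectly ordered by degree: an induced path `a - b - c - d`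
with `deg b ≤ deg a` and `deg c ≤ deg d` always lies in an induced five-cycle
(`exists_isC5_of_degIn_le`). The degrees in the whole graph serve for all of its parts.

The algorithm keeps, for each vertex `r`, a list of weighted stable sets, the *pieces* of `r`; at
the beginning, this is the vertex itself with its weight. All buoys are contracted in the order of
their sizes. When a buoy is contracted, all five-cycles inside its parts belong to smaller buoys and
have at most one vertex left, so that each part is perfectly ordered. The pieces of a part are
merged by the greedy procedure: unite the first pieces of a greedily chosen maximal stable set of
vertices, with the least weight of these pieces, and repeat. The total weight obtained is the
largest weight of a clique (`CliqueBound`). The five parts now form a weighted five-cycle, which has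
a coloring whose total weight is the maximum of the weights of its edges and of half of its weight,
rounded up (`run_cycleWeights`). One vertex takes over the resulting pieces of the whole buoy. In
both cases the total weight is a lower bound for the weight of the stable sets that meet the
homogeneous set in any weighted coloring, and therefore the weighted chromatic number does not grow
(`dominates_of_isModule`, `Stage`). Once all buoys are contracted, greedy merging finishes the job.

For the running time, five-cycles `v`, `a`, `p`, `q`, `b` are searched with a single candidate for
`p`, `a` and `b` for each pair `v`, `q`. This takes linear time for each pair, and still each buoy
is found (`exists_detection`). All but a few rounds of merging use up a piece, and there are never
more than `6 n` pieces: a contraction adds at most five, but leaves fewer vertices. Hence merging `m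
≥ 2` vertices takes time `O(m n²)`, and `m - 1` vertices disappear. The number of the remaining
vertices is thus a potential that pays for all contractions (`run_contractBuoy`).

The correctness of the program is shown by rules for the running time and the final state of each
construct (`Run`), with loop invariants that speak of the time spent as well (`run_loop`).
-/

/-! ### Rules for programs -/

namespace WordRAM

/-- The program `p`, started in `σ`, halts without overflow, and its running time and final state
satisfy `Q`. -/
def Run (B : ℕ) (p : Prog) (σ : State) (Q : ℕ → State → Prop) : Prop :=
  ∃ t τ, Exec B p σ t τ ∧ Q t τ

section Rules

variable {B : ℕ} {p q : Prog} {σ : State} {Q Q' : ℕ → State → Prop}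

theorem Run.mono (h : Run B p σ Q) (hQ : ∀ t τ, Q t τ → Q' t τ) : Run B p σ Q' :=
  let ⟨t, τ, he, hq⟩ := h
  ⟨t, τ, he, hQ t τ hq⟩

@[simp]
theorem run_skip : Run B .skip σ Q ↔ Q 1 σ := by
  constructor
  · rintro ⟨t, τ, h, hQ⟩
    cases h
    exact hQ
  · exact fun h => ⟨_, _, .skip σ, h⟩

@[simp]
theorem run_assign {a : ℕ} {i e : Expr} :
    Run B (.assign a i e) σ Q ↔
      i.Fits B σ ∧ e.Fits B σ ∧ Q (i.cost + e.cost + 1) (σ.store a (i.eval σ) (e.eval σ)) := by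
  constructor
  · rintro ⟨t, τ, h, hQ⟩
    cases h
    exact ⟨by assumption, by assumption, hQ⟩
  · exact fun ⟨hi, he, h⟩ => ⟨_, _, .assign a i e σ hi he, h⟩

@[simp]
theorem run_seq :
    Run B (.seq p q) σ Q ↔ Run B p σ fun s ρ => Run B q ρ fun t τ => Q (s + t) τ := by
  constructor
  · rintro ⟨t, τ, h, hQ⟩
    cases h with
    | seq hp hq => exact ⟨_, _, hp, _, _, hq, hQ⟩
  · rintro ⟨s, ρ, hp, t, τ, hq, h⟩
    exact ⟨_, _, .seq hp hq, h⟩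

@[simp]
theorem run_ite {e : Expr} :
    Run B (.ite e p q) σ Q ↔
      e.Fits B σ ∧ (e.eval σ ≠ 0 → Run B p σ fun t τ => Q (e.cost + 1 + t) τ) ∧
        (e.eval σ = 0 → Run B q σ fun t τ => Q (e.cost + 1 + t) τ) := by
  constructor
  · rintro ⟨t, τ, h, hQ⟩
    cases h with
    | ite_true he hne hp => exact ⟨he, fun _ => ⟨_, _, hp, hQ⟩, fun h => absurd h hne⟩
    | ite_false he hz hp => exact ⟨he, fun h => absurd hz h, fun _ => ⟨_, _, hp, hQ⟩⟩
  · rintro ⟨he, h1, h2⟩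
    by_cases hz : e.eval σ = 0
    · obtain ⟨t, τ, hp, h⟩ := h2 hz
      exact ⟨_, _, .ite_false he hz hp, h⟩
    · obtain ⟨t, τ, hp, h⟩ := h1 hz
      exact ⟨_, _, .ite_true he hz hp, h⟩

/-- The rule for while loops. The invariant `I s ρ` speaks of the time `s` spent so far as well as
of the state, and a bound on that time also shows that the loop terminates. -/
theorem run_loop {e : Expr} (I : ℕ → State → Prop) (S : ℕ) (h0 : I 0 σ)
    (hS : ∀ s ρ, I s ρ → s ≤ S) (hf : ∀ s ρ, I s ρ → e.Fits B ρ)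
    (step : ∀ s ρ, I s ρ → e.eval ρ ≠ 0 → Run B p ρ fun t τ => I (s + (e.cost + 1 + t)) τ) :
    Run B (.loop e p) σ fun t τ => ∃ s, t = s + (e.cost + 1) ∧ I s τ ∧ e.eval τ = 0 := by
  suffices H : ∀ m s ρ, I s ρ → S - s ≤ m →
      Run B (.loop e p) ρ fun t τ => ∃ s', s + t = s' + (e.cost + 1) ∧ I s' τ ∧ e.eval τ = 0 by
    simpa using H _ 0 σ h0 le_rfl
  intro m
  induction m with
  | zero =>
    intro s ρ h hm
    by_cases hz : e.eval ρ = 0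
    · exact ⟨_, _, Exec.loop_stop (hf s ρ h) hz, s, rfl, h, hz⟩
    · obtain ⟨t, τ, -, h'⟩ := step s ρ h hz
      have := hS _ _ h'
      omega
  | succ m ih =>
    intro s ρ h hm
    by_cases hz : e.eval ρ = 0
    · exact ⟨_, _, Exec.loop_stop (hf s ρ h) hz, s, rfl, h, hz⟩
    · obtain ⟨t, τ, he, h'⟩ := step s ρ h hz
      have := hS _ _ h'
      obtain ⟨t', τ', he', s', hs', hI, hz'⟩ := ih _ τ h' (by omega)
      exact ⟨_, _, .loop_step (hf s ρ h) hz he he', s', by omega, hI, hz'⟩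

/-- The scalar variable `a`. -/
abbrev var (a : ℕ) : Expr := .read a (.const 0)

/-- Storing a value in the scalar variable `a`. -/
abbrev set (a : ℕ) (e : Expr) : Prog := .assign a (.const 0) e

/-- The loop `for x = 0, …, b - 1 do p`, where `x` and `b` are scalar variables. -/
def forTo (x b : ℕ) (p : Prog) : Prog :=
  .seq (set x (.const 0)) (.loop (.op .lt (var x) (var b))
    (.seq p (set x (.op .add (var x) (.const 1)))))

@[simp]
theorem store_ne {a b i x : ℕ} (h : b ≠ a) : (σ.store a i x) b = σ b := by
  funext j
  simp [State.store, h]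

@[simp]
theorem store_eq {a i x : ℕ} : (σ.store a i x) a i = x := by
  simp [State.store]

theorem store_same {a i j x : ℕ} : (σ.store a i x) a j = if j = i then x else σ a j := by
  simp [State.store]

/-- The rule for `forTo`; the invariant `I k s ρ` speaks of the number `k` of completed rounds and
of the time `s` spent so far. -/
theorem run_forTo {x b N : ℕ} (I : ℕ → ℕ → State → Prop) (S : ℕ) (hxb : b ≠ x) (hB : N + 1 ≤ B)
    (hb : σ b 0 = N) (h0 : I 0 0 (σ.store x 0 0)) (hS : ∀ k s ρ, k ≤ N → I k s ρ → s ≤ S)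
    (step : ∀ k s ρ, k < N → ρ x 0 = k → ρ b 0 = N → I k s ρ → Run B p ρ fun t τ =>
      τ x 0 = k ∧ τ b 0 = N ∧ I (k + 1) (s + t + 12) (τ.store x 0 (k + 1))) :
    Run B (forTo x b p) σ fun t τ =>
      ∃ s, t = s + 9 ∧ I N s τ ∧ τ x 0 = N ∧ τ b 0 = N := by
  rw [forTo, run_seq, run_assign]
  refine ⟨Nat.zero_le _, Nat.zero_le _, ?_⟩
  refine (run_loop (fun s ρ => ρ x 0 ≤ N ∧ ρ b 0 = N ∧ I (ρ x 0) s ρ) S ?_ ?_ ?_ ?_).mono ?_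
  · simp [Expr.eval, hxb, hb, h0]
  · exact fun s ρ h => hS _ _ _ h.1 h.2.2
  · rintro s ρ ⟨h1, h2, h3⟩
    have : Op.lt.eval (ρ x 0) (ρ b 0) ≤ 1 := by
      simp only [Op.eval]
      split_ifs <;> omega
    exact ⟨Nat.zero_le _, Nat.zero_le _, this.trans (by omega)⟩
  · rintro s ρ ⟨h1, h2, h3⟩ hlt
    have hlt : ρ x 0 < N := by
      by_contra h
      simp [Expr.eval, Op.eval, h2, h] at hlt
    rw [run_seq]
    refine (step _ s ρ hlt rfl h2 h3).mono ?_
    rintro t τ ⟨hx, hb', hI⟩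
    rw [run_assign]
    refine ⟨Nat.zero_le _, ?_, ?_⟩
    · simp only [Expr.Fits, Expr.eval, Op.eval]
      omega
    · simp only [Expr.eval, Op.eval, Expr.cost, hx, store_eq, store_ne hxb]
      refine ⟨hlt, hb', ?_⟩
      convert hI using 1
      ring
  · rintro t τ ⟨s, rfl, ⟨h1, h2, h3⟩, hz⟩
    have hx : τ x 0 = N := by
      by_contra h
      have : τ x 0 < τ b 0 := by omega
      simp [Expr.eval, Op.eval, this] at hz
    rw [hx] at h3
    exact ⟨s, by simp [Expr.cost]; ring, h3, hx, h2⟩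

/-- The rule for `forTo` with a bound `c` on the time of each round. -/
theorem run_forTo' {x b N : ℕ} (I : ℕ → State → Prop) (c : ℕ) (hxb : b ≠ x) (hB : N + 1 ≤ B)
    (hb : σ b 0 = N) (h0 : I 0 (σ.store x 0 0))
    (step : ∀ k ρ, k < N → ρ x 0 = k → ρ b 0 = N → I k ρ → Run B p ρ fun t τ =>
      t ≤ c ∧ τ x 0 = k ∧ τ b 0 = N ∧ I (k + 1) (τ.store x 0 (k + 1))) :
    Run B (forTo x b p) σ fun t τ =>
      t ≤ N * (c + 12) + 9 ∧ I N τ ∧ τ x 0 = N ∧ τ b 0 = N := by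
  refine (run_forTo (fun k s ρ => s ≤ k * (c + 12) ∧ I k ρ) (N * (c + 12)) hxb hB hb ?_ ?_ ?_).mono ?_
  · exact ⟨by simp, h0⟩
  · exact fun k s ρ hk h => h.1.trans (Nat.mul_le_mul_right _ hk)
  · rintro k s ρ hk hx hb ⟨hs, hI⟩
    refine (step k ρ hk hx hb hI).mono ?_
    rintro t τ ⟨ht, h1, h2, h3⟩
    exact ⟨h1, h2, by rw [Nat.succ_mul]; omega, h3⟩
  · rintro t τ ⟨s, rfl, ⟨h1, h2⟩, h3, h4⟩
    exact ⟨by omega, h2, h3, h4⟩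

end Rules

/-- Only the arrays in the list `l` differ between the states `σ` and `τ`. -/
def Frame (l : List ℕ) (σ τ : State) : Prop := ∀ a, a ∉ l → τ a = σ a

theorem Frame.refl (l : List ℕ) (σ : State) : Frame l σ σ := fun _ _ => rfl

theorem Frame.store {l : List ℕ} {σ τ : State} (h : Frame l σ τ) {a i x : ℕ} (ha : a ∈ l) :
    Frame l σ (τ.store a i x) := by
  intro b hb
  rw [store_ne (by rintro rfl; exact hb ha), h b hb]

theorem Frame.trans {l l' : List ℕ} {σ τ ρ : State} (h : Frame l σ τ) (h' : Frame l' τ ρ)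
    (hl : l' ⊆ l) : Frame l σ ρ := fun a ha => by
  rw [h' a fun h => ha (hl h), h a ha]

theorem Frame.weaken {l l' : List ℕ} {σ τ : State} (h : Frame l σ τ) (hl : l ⊆ l') :
    Frame l' σ τ := fun a ha => h a fun h => ha (hl h)

end WordRAM

/-! ### Graphs without induced `P₅` and house -/

namespace BuoyColoring

section Graph

variable {V : Type*} (g : SimpleGraph V)

/-- No induced path `a - b - c - d - e`. -/
def NoPath : Prop := ∀ a b c d e, g.Adj a b → g.Adj b c → g.Adj c d → g.Adj d e →
  ¬ g.Adj a c → ¬ g.Adj a d → ¬ g.Adj a e → ¬ g.Adj b d → ¬ g.Adj b e → ¬ g.Adj c e → False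

/-- No induced house, the complement of the path on five vertices: a cycle `a - b - c - d - a`
and a fifth vertex `e` on top of the edge `a - b`. -/
def NoHouse : Prop := ∀ a b c d e, g.Adj a b → g.Adj b c → g.Adj c d → g.Adj d a →
  ¬ g.Adj a c → ¬ g.Adj b d → g.Adj e a → g.Adj e b → ¬ g.Adj e c → ¬ g.Adj e d → False

variable {g}

/-- A map that preserves and reflects adjacency is injective if the source has no two vertices with
the same neighbours. -/
theorem isIndContained_of_adj_iff {W : Type*} {h : SimpleGraph W} (f : W → V)
    (hf : ∀ i j, g.Adj (f i) (f j) ↔ h.Adj i j)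
    (ht : ∀ i j, (∀ k, h.Adj i k ↔ h.Adj j k) → i = j) : h.IsIndContained g :=
  ⟨⟨⟨f, fun i j hij => ht i j fun k => by rw [← hf, ← hf, hij]⟩, fun {i j} => hf i j⟩⟩

theorem noPath_of_not_isIndContained (h : ¬ (SimpleGraph.pathGraph 5).IsIndContained g) :
    NoPath g := by
  intro a b c d e h1 h2 h3 h4 h5 h6 h7 h8 h9 h10
  refine h (isIndContained_of_adj_iff ![a, b, c, d, e] ?_ ?_)
  · intro i j
    fin_cases i <;> fin_cases j <;>
      simp [SimpleGraph.pathGraph_adj, *, g.adj_comm b a, g.adj_comm c b, g.adj_comm d c,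
        g.adj_comm e d, g.adj_comm c a, g.adj_comm d a, g.adj_comm e a, g.adj_comm d b,
        g.adj_comm e b, g.adj_comm e c]
  · simp only [SimpleGraph.pathGraph_adj]
    decide

theorem noHouse_of_not_isIndContained (h : ¬ (SimpleGraph.pathGraph 5)ᶜ.IsIndContained g) :
    NoHouse g := by
  intro a b c d e h1 h2 h3 h4 h5 h6 h7 h8 h9 h10
  refine h (isIndContained_of_adj_iff ![a, c, e, d, b] ?_ ?_)
  · intro i j
    fin_cases i <;> fin_cases j <;>
      simp [SimpleGraph.compl_adj, SimpleGraph.pathGraph_adj, *, g.adj_comm b a, g.adj_comm c b,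
        g.adj_comm d c, g.adj_comm a d, g.adj_comm c a, g.adj_comm d b, g.adj_comm a e,
        g.adj_comm b e, g.adj_comm c e, g.adj_comm d e]
  · simp only [SimpleGraph.compl_adj, SimpleGraph.pathGraph_adj]
    decide

/-! ### Induced five-cycles and buoys -/

variable (g) in
/-- The vertices `c 0, c 1, …, c 4` form an induced cycle, in this cyclic order. -/
def IsC5 (c : Fin 5 → V) : Prop := ∀ i, g.Adj (c i) (c (i + 1)) ∧ ¬ g.Adj (c i) (c (i + 2))

variable (g) in
/-- The vertex `u` is adjacent to the neighbours of `c i` on the cycle `c` and to no other vertex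
of the cycle, except possibly `c i` itself. -/
def Twin (c : Fin 5 → V) (i : Fin 5) (u : V) : Prop :=
  g.Adj u (c (i + 1)) ∧ g.Adj u (c (i + 4)) ∧ ¬ g.Adj u (c (i + 2)) ∧ ¬ g.Adj u (c (i + 3))

variable (g) in
/-- The buoy of an induced five-cycle: its vertices and their twins. -/
def Buoy (c : Fin 5 → V) (u : V) : Prop := ∃ i, Twin g c i u

theorem IsC5.adj_iff {c : Fin 5 → V} (hc : IsC5 g c) (i j : Fin 5) :
    g.Adj (c i) (c j) ↔ j = i + 1 ∨ j = i + 4 := by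
  have h : ∀ i, g.Adj (c i) (c (i + 1)) ∧ ¬ g.Adj (c i) (c (i + 2)) := hc
  have h0 := h 0; have h1 := h 1; have h2 := h 2; have h3 := h 3; have h4 := h 4
  simp only [Fin.reduceAdd] at h0 h1 h2 h3 h4
  fin_cases i <;> fin_cases j <;> simp [*, g.adj_comm (c 1) (c 0), g.adj_comm (c 2) (c 1),
    g.adj_comm (c 3) (c 2), g.adj_comm (c 4) (c 3), g.adj_comm (c 0) (c 4), g.adj_comm (c 2) (c 0),
    g.adj_comm (c 3) (c 1), g.adj_comm (c 4) (c 2), g.adj_comm (c 0) (c 3), g.adj_comm (c 1) (c 4)]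

theorem IsC5.twin_self {c : Fin 5 → V} (hc : IsC5 g c) (i : Fin 5) : Twin g c i (c i) := by
  simp only [Twin, hc.adj_iff]
  fin_cases i <;> decide

theorem twin_unique {c : Fin 5 → V} {i j : Fin 5} {u : V} (hi : Twin g c i u) (hj : Twin g c j u) :
    i = j := by
  unfold Twin at hi hj
  fin_cases i <;> fin_cases j <;> simp_all

/-- A vertex sees all or none of an induced five-cycle, unless it is a twin of one of its vertices.
-/
theorem IsC5.adj_all_or_none_or_twin {c : Fin 5 → V} (hc : IsC5 g c) (hP : NoPath g)
    (hH : NoHouse g) (u : V) :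
    (∀ i, g.Adj u (c i)) ∨ (∀ i, ¬ g.Adj u (c i)) ∨ Buoy g c u := by
  have path : ∀ i, ¬ (g.Adj u (c i) ∧ ¬ g.Adj u (c (i + 1)) ∧ ¬ g.Adj u (c (i + 2)) ∧
      ¬ g.Adj u (c (i + 3))) := by
    rintro i ⟨h0, h1, h2, h3⟩
    refine hP u (c i) (c (i + 1)) (c (i + 2)) (c (i + 3)) h0 ?_ ?_ ?_ h1 h2 h3 ?_ ?_ ?_ <;>
      rw [hc.adj_iff] <;> clear * - <;> revert i <;> decide
  have house : ∀ i, ¬ (g.Adj u (c i) ∧ g.Adj u (c (i + 1)) ∧ ¬ g.Adj u (c (i + 2)) ∧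
      g.Adj u (c (i + 3))) := by
    rintro i ⟨h0, h1, h2, h3⟩
    refine hH u (c (i + 1)) (c (i + 2)) (c (i + 3)) (c i) h1 ?_ ?_ h3.symm h2 ?_ h0.symm ?_ ?_ ?_ <;>
      rw [hc.adj_iff] <;> clear * - <;> revert i <;> decide
  have key : ∀ p : Fin 5 → Bool,
      (∀ i, ¬ (p i ∧ ¬ p (i + 1) ∧ ¬ p (i + 2) ∧ ¬ p (i + 3))) →
      (∀ i, ¬ (p i ∧ p (i + 1) ∧ ¬ p (i + 2) ∧ p (i + 3))) →
      (∀ i, p i) ∨ (∀ i, ¬ p i) ∨ ∃ i, p (i + 1) ∧ p (i + 4) ∧ ¬ p (i + 2) ∧ ¬ p (i + 3) := by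
    decide
  classical
  simpa [Buoy, Twin] using key (fun i => decide (g.Adj u (c i))) (by simpa using path)
    (by simpa using house)

/-- A vertex of a five-cycle may be replaced by any of its twins. -/
theorem IsC5.update {c : Fin 5 → V} (hc : IsC5 g c) {i : Fin 5} {x : V} (hx : Twin g c i x) :
    IsC5 g (Function.update c i x) := by
  obtain ⟨h1, h2, h3, h4⟩ := hx
  intro j
  have e : ∀ k : Fin 5, k = i ∨ k = i + 1 ∨ k = i + 2 ∨ k = i + 3 ∨ k = i + 4 := by
    clear * -; revert i; decide
  have e1 : i + 4 + 1 = i := by clear * -; revert i; decide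
  have e2 : i + 3 + 2 = i := by clear * -; revert i; decide
  have e3 : i + 4 + 2 = i + 1 := by clear * -; revert i; decide
  have n1 : i + 1 ≠ i := by clear * -; revert i; decide
  have n2 : i + 2 ≠ i := by clear * -; revert i; decide
  have n3 : i + 3 ≠ i := by clear * -; revert i; decide
  have n4 : i + 4 ≠ i := by clear * -; revert i; decide
  have a12 : i + 1 + 1 = i + 2 := by clear * -; revert i; decide
  have a13 : i + 1 + 2 = i + 3 := by clear * -; revert i; decide
  have a23 : i + 2 + 1 = i + 3 := by clear * -; revert i; decide
  have a24 : i + 2 + 2 = i + 4 := by clear * -; revert i; decide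
  have a34 : i + 3 + 1 = i + 4 := by clear * -; revert i; decide
  rcases e j with rfl | rfl | rfl | rfl | rfl <;>
    simp [e1, e2, e3, n1, n2, n3, n4, a12, a13, a23, a24, a34, h1, h2.symm, h3, hc.adj_iff] <;>
    first
      | (clear * -; revert i; decide)
      | exact fun h => h4 h.symm

/-- Vertices in distinct parts of a buoy are adjacent according to the cycle. -/
theorem Twin.adj_iff {c : Fin 5 → V} (hP : NoPath g) (hH : NoHouse g) (hc : IsC5 g c) {i j : Fin 5}
    {x y : V} (hx : Twin g c i x) (hy : Twin g c j y) (hij : i ≠ j) :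
    g.Adj x y ↔ g.Adj (c i) (c j) := by
  have hup := (hc.update hx).adj_all_or_none_or_twin hP hH y
  -- only the adjacency of `y` to the exchanged vertex is unknown
  have key : ∀ (i j : Fin 5), i ≠ j → ∀ p : Fin 5 → Bool,
      (∀ k, k ≠ i → k ≠ j → p k = decide (k = j + 1 ∨ k = j + 4)) →
      ((∀ k, p k) ∨ (∀ k, ¬ p k) ∨ ∃ k, p (k + 1) ∧ p (k + 4) ∧ ¬ p (k + 2) ∧ ¬ p (k + 3)) →
      (p i ↔ (j = i + 1 ∨ j = i + 4)) := by
    set_option synthInstance.maxSize 1000 in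
    set_option synthInstance.maxHeartbeats 200000 in
    decide
  have hy' : ∀ k, k ≠ j → (g.Adj y (c k) ↔ k = j + 1 ∨ k = j + 4) := by
    have e : ∀ k : Fin 5, k = j ∨ k = j + 1 ∨ k = j + 2 ∨ k = j + 3 ∨ k = j + 4 := by
      clear * -; revert j; decide
    obtain ⟨h1, h2, h3, h4⟩ := hy
    intro k hk
    rcases e k with rfl | rfl | rfl | rfl | rfl
    · exact absurd rfl hk
    · simp [h1]
    · simp [h3]
    · simp [h4]
    · simp [h2]
  classical
  have := key i j hij (fun k => decide (g.Adj y (Function.update c i x k)))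
    (fun k h1 h2 => by simp [h1, hy' k h2]) (by simpa [Buoy, Twin] using hup)
  rw [hc.adj_iff, ← this]
  simp [g.adj_comm]

/-- A buoy is a homogeneous set. -/
theorem adj_iff_of_not_buoy {c : Fin 5 → V} (hP : NoPath g) (hH : NoHouse g) (hc : IsC5 g c)
    {u x y : V} (hu : ¬ Buoy g c u) (hx : Buoy g c x) (hy : Buoy g c y) :
    g.Adj u x ↔ g.Adj u y := by
  suffices H : ∀ {x}, Buoy g c x → (g.Adj u x ↔ g.Adj u (c 0)) by rw [H hx, H hy]
  clear hx hy
  rintro x ⟨i, hx⟩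
  have hup := (hc.update hx).adj_all_or_none_or_twin hP hH u
  have hold := hc.adj_all_or_none_or_twin hP hH u
  have key : ∀ (i : Fin 5), ∀ p q : Fin 5 → Bool, (∀ k, k ≠ i → p k = q k) →
      ((∀ k, p k) ∨ (∀ k, ¬ p k)) →
      ((∀ k, q k) ∨ (∀ k, ¬ q k) ∨ ∃ k, q (k + 1) ∧ q (k + 4) ∧ ¬ q (k + 2) ∧ ¬ q (k + 3)) →
      (q i ↔ p 0) := by
    intro i p q h
    have hq : q = Function.update p i (q i) := by
      funext k
      by_cases hk : k = i
      · simp [hk]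
      · simp [hk, h k hk]
    generalize q i = b at hq ⊢
    subst hq
    clear h
    revert i p b
    decide
  classical
  have := key i (fun k => decide (g.Adj u (c k)))
    (fun k => decide (g.Adj u (Function.update c i x k))) (fun k hk => by simp [hk])
    (by simpa [hu] using hold) (by simpa [Buoy, Twin] using hup)
  simpa using this

/-- A part of a buoy is a homogeneous set. -/
theorem adj_iff_of_not_twin {c : Fin 5 → V} (hP : NoPath g) (hH : NoHouse g) (hc : IsC5 g c)
    {i : Fin 5} {u x y : V} (hu : ¬ Twin g c i u) (hx : Twin g c i x) (hy : Twin g c i y) :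
    g.Adj u x ↔ g.Adj u y := by
  by_cases h : Buoy g c u
  · obtain ⟨j, hj⟩ := h
    have hij : j ≠ i := by
      rintro rfl
      exact hu hj
    rw [hj.adj_iff hP hH hc hx hij, hj.adj_iff hP hH hc hy hij]
  · exact adj_iff_of_not_buoy hP hH hc h ⟨i, hx⟩ ⟨i, hy⟩

theorem IsC5.of_twin {c c' : Fin 5 → V} (hP : NoPath g) (hH : NoHouse g) (hc : IsC5 g c)
    (h : ∀ i, Twin g c i (c' i)) : IsC5 g c' := by
  intro i
  have n1 : i ≠ i + 1 := by clear * -; revert i; decide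
  have n2 : i ≠ i + 2 := by clear * -; revert i; decide
  rw [(h i).adj_iff hP hH hc (h _) n1, (h i).adj_iff hP hH hc (h _) n2]
  exact hc i

/-- A five-cycle with one vertex in each part of a buoy has the same parts. -/
theorem twin_iff_of_twin {c c' : Fin 5 → V} (hP : NoPath g) (hH : NoHouse g) (hc : IsC5 g c)
    (h : ∀ i, Twin g c i (c' i)) (i : Fin 5) (u : V) : Twin g c' i u ↔ Twin g c i u := by
  have hc' := IsC5.of_twin hP hH hc h
  have mpr : ∀ j, Twin g c j u → Twin g c' j u := by
    intro j hu
    have e : ∀ k, j ≠ k → (g.Adj u (c' k) ↔ k = j + 1 ∨ k = j + 4) := by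
      intro k hk
      rw [hu.adj_iff hP hH hc (h k) hk, hc.adj_iff]
    have n1 : j ≠ j + 1 := by clear * -; revert j; decide
    have n2 : j ≠ j + 2 := by clear * -; revert j; decide
    have n3 : j ≠ j + 3 := by clear * -; revert j; decide
    have n4 : j ≠ j + 4 := by clear * -; revert j; decide
    rw [Twin, e _ n1, e _ n2, e _ n3, e _ n4]
    clear * -; revert j; decide
  refine ⟨fun hu => ?_, mpr i⟩
  by_cases hb : Buoy g c u
  · obtain ⟨j, hj⟩ := hb
    rwa [← twin_unique (mpr j hj) hu]
  · have := adj_iff_of_not_buoy hP hH hc hb ⟨_, h (i + 1)⟩ ⟨_, h (i + 2)⟩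
    exact absurd (this.1 hu.1) hu.2.2.1

theorem buoy_iff_of_twin {c c' : Fin 5 → V} (hP : NoPath g) (hH : NoHouse g) (hc : IsC5 g c)
    (h : ∀ i, Twin g c i (c' i)) (u : V) : Buoy g c' u ↔ Buoy g c u := by
  simp only [Buoy, twin_iff_of_twin hP hH hc h]

/-- An induced five-cycle in a part of a buoy has its whole buoy in that part. -/
theorem Buoy.twin_of_subset {c d : Fin 5 → V} (hP : NoPath g) (hH : NoHouse g) (hc : IsC5 g c)
    {i : Fin 5} (h : ∀ k, Twin g c i (d k)) {u : V} (hu : Buoy g d u) : Twin g c i u := by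
  by_contra hn
  obtain ⟨k, hk⟩ := hu
  exact hk.2.2.1 ((adj_iff_of_not_twin hP hH hc hn (h _) (h _)).1 hk.1)

theorem IsC5.neg {c : Fin 5 → V} (hc : IsC5 g c) : IsC5 g fun i => c (-i) := by
  intro i
  rw [hc.adj_iff, hc.adj_iff]
  clear * -; revert i; decide

theorem twin_neg_iff {c : Fin 5 → V} {i : Fin 5} {u : V} :
    Twin g (fun i => c (-i)) i u ↔ Twin g c (-i) u := by
  unfold Twin
  have e1 : -(i + 1) = -i + 4 := by clear * -; revert i; decide
  have e2 : -(i + 2) = -i + 3 := by clear * -; revert i; decide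
  have e3 : -(i + 3) = -i + 2 := by clear * -; revert i; decide
  have e4 : -(i + 4) = -i + 1 := by clear * -; revert i; decide
  simp only [e1, e2, e3, e4]
  tauto

theorem buoy_neg_iff {c : Fin 5 → V} {u : V} : Buoy g (fun i => c (-i)) u ↔ Buoy g c u :=
  ⟨fun ⟨i, h⟩ => ⟨-i, twin_neg_iff.1 h⟩,
    fun ⟨i, h⟩ => ⟨-i, twin_neg_iff.2 (by rwa [neg_neg])⟩⟩

end Graph
end BuoyColoring

/-! ### Finding a five-cycle in each buoy -/

namespace BuoyColoring

section Detection

variable {g : SimpleGraph ℕ}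

theorem isC5_of_adj (hH : NoHouse g) {v a p q b : ℕ} (va : g.Adj v a) (vb : g.Adj v b)
    (pa : g.Adj p a) (qb : g.Adj q b) (pq : g.Adj p q) (vp : ¬ g.Adj v p) (vq : ¬ g.Adj v q)
    (qa : ¬ g.Adj q a) (pb : ¬ g.Adj p b) : IsC5 g ![v, a, p, q, b] := by
  have ab : ¬ g.Adj a b := fun ab => hH a b q p v ab qb.symm pq.symm pa (fun h => qa h.symm)
    (fun h => pb h.symm) va vb vq vp
  have aq : ¬ g.Adj a q := fun h => qa h.symm
  have pv : ¬ g.Adj p v := fun h => vp h.symm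
  have qv : ¬ g.Adj q v := fun h => vq h.symm
  have ba : ¬ g.Adj b a := fun h => ab h.symm
  intro i
  fin_cases i <;> simp [*, pa.symm, vb.symm]

/-- If `q` is the least vertex of the part of `c 3`, then each candidate `p < q` lies in the part of
`c 2`, and therefore all candidates for `a` and `b` lie in the parts of `c 1` and `c 4`. -/
theorem exists_detection_of_lt (hP : NoPath g) (hH : NoHouse g) {c : Fin 5 → ℕ} (hc : IsC5 g c)
    {q r : ℕ} (hq : Twin g c 3 q) (hr : Twin g c 2 r)
    (hmin : ∀ u, Twin g c 3 u → q ≤ u) :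
    ¬ g.Adj (c 0) q ∧ q ≠ c 0 ∧ (g.Adj r q ∧ ¬ g.Adj (c 0) r ∧ r ≠ c 0) ∧
    ∀ p < q, g.Adj p q → ¬ g.Adj (c 0) p → p ≠ c 0 →
      (∃ a, g.Adj (c 0) a ∧ g.Adj p a ∧ ¬ g.Adj q a) ∧
      (∃ b, g.Adj (c 0) b ∧ g.Adj q b ∧ ¬ g.Adj p b) ∧
      ∀ a b, g.Adj (c 0) a → g.Adj p a → ¬ g.Adj q a → g.Adj (c 0) b → g.Adj q b → ¬ g.Adj p b →
        ∀ u, Buoy g ![c 0, a, p, q, b] u ↔ Buoy g c u := by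
  have self := hc.twin_self
  have adj : ∀ {i j x y}, Twin g c i x → Twin g c j y → i ≠ j →
      (g.Adj x y ↔ j = i + 1 ∨ j = i + 4) := fun hx hy hij => by
    rw [hx.adj_iff hP hH hc hy hij, hc.adj_iff]
  have ne : ∀ {i j x y}, Twin g c i x → Twin g c j y → i ≠ j → x ≠ y := by
    rintro i j x y hx hy hij rfl
    exact hij (twin_unique hx hy)
  refine ⟨?_, ne hq (self 0) (by decide), ⟨?_, ?_, ne hr (self 0) (by decide)⟩, ?_⟩
  · rw [adj (self 0) hq (by decide)]; decide
  · rw [adj hr hq (by decide)]; decide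
  · rw [adj (self 0) hr (by decide)]; decide
  intro p hpq hpadj h0p hp0
  have hp : Twin g c 2 p := by
    by_cases hb : Buoy g c p
    · obtain ⟨i, hi⟩ := hb
      have h3 : i ≠ 3 := by
        rintro rfl
        exact absurd (hmin p hi) (by omega)
      have h1 := (adj hi hq h3).1 hpadj
      have h2 : i ≠ 0 → ¬ _ := fun h => mt (adj (self 0) hi h.symm).2 h0p
      revert hi
      revert h1 h2 h3
      clear * -
      revert i
      intro i
      fin_cases i <;> simp
    · exact absurd ((adj_iff_of_not_buoy hP hH hc hb ⟨_, hq⟩ ⟨_, self 0⟩).1 hpadj).symm h0p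
  refine ⟨⟨c 1, ?_, ?_, ?_⟩, ⟨c 4, ?_, ?_, ?_⟩, ?_⟩
  · rw [adj (self 0) (self 1) (by decide)]; decide
  · rw [adj hp (self 1) (by decide)]; decide
  · rw [adj hq (self 1) (by decide)]; decide
  · rw [adj (self 0) (self 4) (by decide)]; decide
  · rw [adj hq (self 4) (by decide)]; decide
  · rw [adj hp (self 4) (by decide)]; decide
  intro a b h0a hpa hqa h0b hqb hpb
  have ha : Twin g c 1 a := by
    by_cases hb : Buoy g c a
    · obtain ⟨i, hi⟩ := hb
      have h1 : i ≠ 2 → _ := fun h => (adj hp hi h.symm).1 hpa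
      have h2 : i ≠ 3 → ¬ _ := fun h => mt (adj hq hi h.symm).2 hqa
      have h3 : i ≠ 0 → _ := fun h => (adj (self 0) hi h.symm).1 h0a
      revert hi
      revert h1 h2 h3
      clear * -
      revert i
      intro i
      fin_cases i <;> simp
    · exact absurd ((adj_iff_of_not_buoy hP hH hc hb ⟨_, self 0⟩ ⟨_, hq⟩).1 h0a.symm).symm hqa
  have hb' : Twin g c 4 b := by
    by_cases hb : Buoy g c b
    · obtain ⟨i, hi⟩ := hb
      have h1 : i ≠ 2 → ¬ _ := fun h => mt (adj hp hi h.symm).2 hpb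
      have h2 : i ≠ 3 → _ := fun h => (adj hq hi h.symm).1 hqb
      have h3 : i ≠ 0 → _ := fun h => (adj (self 0) hi h.symm).1 h0b
      revert hi
      revert h1 h2 h3
      clear * -
      revert i
      intro i
      fin_cases i <;> simp
    · exact absurd ((adj_iff_of_not_buoy hP hH hc hb ⟨_, self 0⟩ ⟨_, hp⟩).1 h0b.symm).symm hpb
  refine buoy_iff_of_twin hP hH hc fun i => ?_
  fin_cases i
  exacts [self 0, ha, hp, hq, hb']

/-- Every buoy is found from a suitable nonadjacent pair `c 0`, `q`, whichever candidates `p`, `a`,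
`b` are used. -/
theorem exists_detection (hP : NoPath g) (hH : NoHouse g) {c : Fin 5 → ℕ} (hc : IsC5 g c) :
    ∃ q, Buoy g c q ∧ ¬ g.Adj (c 0) q ∧ q ≠ c 0 ∧
      (∃ p < q, g.Adj p q ∧ ¬ g.Adj (c 0) p ∧ p ≠ c 0) ∧
      ∀ p < q, g.Adj p q → ¬ g.Adj (c 0) p → p ≠ c 0 →
        (∃ a, g.Adj (c 0) a ∧ g.Adj p a ∧ ¬ g.Adj q a) ∧
        (∃ b, g.Adj (c 0) b ∧ g.Adj q b ∧ ¬ g.Adj p b) ∧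
        ∀ a b, g.Adj (c 0) a → g.Adj p a → ¬ g.Adj q a → g.Adj (c 0) b → g.Adj q b →
          ¬ g.Adj p b → ∀ u, Buoy g ![c 0, a, p, q, b] u ↔ Buoy g c u := by
  classical
  have h2 : ∃ u, Twin g c 2 u := ⟨_, hc.twin_self 2⟩
  have h3 : ∃ u, Twin g c 3 u := ⟨_, hc.twin_self 3⟩
  have s2 := Nat.find_spec h2
  have s3 := Nat.find_spec h3
  have m2 : ∀ u, Twin g c 2 u → Nat.find h2 ≤ u := fun u hu => Nat.find_min' h2 hu
  have m3 : ∀ u, Twin g c 3 u → Nat.find h3 ≤ u := fun u hu => Nat.find_min' h3 hu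
  generalize Nat.find h2 = q2 at s2 m2
  generalize Nat.find h3 = q3 at s3 m3
  rcases lt_trichotomy q2 q3 with h | h | h
  · obtain ⟨e1, e2, e3, e4⟩ := exists_detection_of_lt hP hH hc s3 s2 m3
    exact ⟨q3, ⟨_, s3⟩, e1, e2, ⟨q2, h, e3⟩, e4⟩
  · subst h
    exact absurd (twin_unique s2 s3) (by decide)
  · obtain ⟨e1, e2, e3, e4⟩ := exists_detection_of_lt hP hH hc.neg (q := q2) (r := q3)
      (twin_neg_iff.2 s2) (twin_neg_iff.2 s3) fun u hu => m2 u (twin_neg_iff.1 hu)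
    simp only [buoy_neg_iff, neg_zero] at e1 e2 e3 e4
    exact ⟨q2, ⟨_, s2⟩, e1, e2, ⟨q3, h, e3⟩, e4⟩

end Detection

/-! ### Degree orders are perfect away from five-cycles -/

section Degree

variable {V : Type*} {g : SimpleGraph V}

open scoped Classical in
variable (g) in
/-- The number of neighbours of `v` in the finite set `U`. -/
noncomputable def degIn (U : Finset V) (v : V) : ℕ := (U.filter (g.Adj v)).card

/-- Without a common neighbour of `a` and `d` that completes the path to a five-cycle, every
neighbour of `a` that is not one of `b` is a neighbour of `c` but not of `d`, and `d` shows that the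
converse fails. The same holds from the other end of the path, and the two strict inequalities
contradict the degrees. -/
theorem exists_isC5_of_degIn_le (hP : NoPath g) (hH : NoHouse g) {U : Finset V}
    (hU : ∀ a b, g.Adj a b → b ∈ U) {a b c d : V} (ab : g.Adj a b) (bc : g.Adj b c)
    (cd : g.Adj c d) (ac : ¬ g.Adj a c) (bd : ¬ g.Adj b d) (ad : ¬ g.Adj a d)
    (hab : degIn g U b ≤ degIn g U a) (hdc : degIn g U c ≤ degIn g U d) :
    ∃ x, IsC5 g ![x, a, b, c, d] := by
  classical
  by_contra! hx
  have ca : ¬ g.Adj c a := fun h => ac h.symm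
  have db : ¬ g.Adj d b := fun h => bd h.symm
  have da : ¬ g.Adj d a := fun h => ad h.symm
  have hx' : ∀ x, g.Adj x a → g.Adj x d → ¬ g.Adj x b → ¬ g.Adj x c → False := by
    intro x xa xd xb xc
    refine hx x fun i => ?_
    have cx : ¬ g.Adj c x := fun h => xc h.symm
    fin_cases i <;> simp [*, xd.symm]
  -- private neighbours of one vertex of an edge with respect to the other
  let D : V → V → Finset V := fun u v => U.filter fun x => g.Adj u x ∧ ¬ g.Adj v x
  have hD : ∀ u v, degIn g U u = (U.filter fun x => g.Adj u x ∧ g.Adj v x).card + (D u v).card := by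
    intro u v
    rw [degIn, ← Finset.card_filter_add_card_filter_not (s := U.filter (g.Adj u)) (g.Adj v),
      Finset.filter_filter, Finset.filter_filter]
  have hcomm : ∀ u v, (U.filter fun x => g.Adj u x ∧ g.Adj v x).card =
      (U.filter fun x => g.Adj v x ∧ g.Adj u x).card := fun u v => by simp only [and_comm]
  have h1 : (D b a).card ≤ (D a b).card := by
    have := hD a b; have := hD b a; have := hcomm a b
    omega
  have h2 : (D c d).card ≤ (D d c).card := by
    have := hD c d; have := hD d c; have := hcomm c d
    omega
  have key : ∀ {a b c d : V}, g.Adj a b → g.Adj b c → g.Adj c d → ¬ g.Adj a c → ¬ g.Adj b d →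
      ¬ g.Adj a d → (∀ x, g.Adj x a → g.Adj x d → ¬ g.Adj x b → ¬ g.Adj x c → False) →
      (D a b).card < (D c d).card := by
    intro a b c d ab bc cd ac bd ad hx
    refine Finset.card_lt_card ⟨?_, ?_⟩
    · intro x hxD
      simp only [D, Finset.mem_filter] at hxD ⊢
      obtain ⟨hxU, xa, xb⟩ := hxD
      have xc : g.Adj x c ∨ ¬ g.Adj x c := em _
      have xd : g.Adj x d ∨ ¬ g.Adj x d := em _
      refine ⟨hxU, ?_⟩
      rcases xc with xc | xc <;> rcases xd with xd | xd
      · exact (hH c x a b d xc.symm xa.symm ab bc (fun h => ac h.symm) (fun h => xb h.symm)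
          cd.symm xd.symm (fun h => ad h.symm) (fun h => bd h.symm)).elim
      · exact ⟨xc.symm, fun h => xd h.symm⟩
      · exact (hx x xa.symm xd (fun h => xb h.symm) xc).elim
      · by_cases hxb : x = b
        · subst hxb
          exact absurd bc xc
        · exact (hP x a b c d xa.symm ab bc cd (fun h => xb h.symm) xc xd ac ad bd).elim
    · intro h
      have := h (show d ∈ D c d by simp [D, cd, hU c d cd])
      simp only [D, Finset.mem_filter] at this
      exact ad this.2.1
  have h3 := key ab bc cd ac bd ad hx'
  have h4 := key cd.symm bc.symm ab.symm db ca da fun x xd xa xc xb => hx' x xa xd xb xc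
  omega

/-- If every vertex of a clique `K` has a neighbour of at least its own value `f` in a stable set
`S`, and no induced path `a - b - c - d` has `f b ≤ f a` and `f c ≤ f d`, then some vertex of `S`
is adjacent to all of `K`. -/
theorem exists_complete_to_clique {f : V → ℕ} {Y S : Set V} (hSY : S ⊆ Y) (hS : g.IsIndepSet S)
    (hobs : ∀ a ∈ Y, ∀ b ∈ Y, ∀ c ∈ Y, ∀ d ∈ Y, g.Adj a b → g.Adj b c → g.Adj c d → ¬ g.Adj a c →
      ¬ g.Adj b d → ¬ g.Adj a d → f b ≤ f a → f c ≤ f d → False)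
    (p : V → V) (K : Finset V) (hK : g.IsClique K) (hne : K.Nonempty)
    (hp : ∀ w ∈ K, w ∈ Y ∧ p w ∈ S ∧ g.Adj (p w) w ∧ f w ≤ f (p w)) :
    ∃ w ∈ K, ∀ v ∈ K, g.Adj (p w) v := by
  classical
  induction K using Finset.strongInduction with
  | H K ih =>
    by_contra! hno
    by_cases hone : ∃ w, K = {w}
    · obtain ⟨w, rfl⟩ := hone
      obtain ⟨v, hv, hwv⟩ := hno w (by simp)
      rw [Finset.mem_singleton] at hv
      subst hv
      exact hwv (hp v (by simp)).2.2.1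
    have hstep : ∀ w ∈ K, ∃ w' ∈ K, w' ≠ w ∧ (∀ v ∈ K, v ≠ w → g.Adj (p w') v) ∧
        ¬ g.Adj (p w') w := by
      intro w hw
      have hne' : (K.erase w).Nonempty := by
        rw [Finset.nonempty_iff_ne_empty]
        intro h
        rw [Finset.erase_eq_empty_iff] at h
        rcases h with h | h
        · exact hne.ne_empty h
        · exact hone ⟨w, h⟩
      obtain ⟨w', hw', h⟩ := ih (K.erase w) (Finset.erase_ssubset hw)
        (hK.subset (by simp)) hne' (fun v hv => hp v (Finset.mem_of_mem_erase hv))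
      obtain ⟨h1, h2⟩ := Finset.mem_erase.1 hw'
      refine ⟨w', h2, h1, fun v hv hvw => h v (Finset.mem_erase.2 ⟨hvw, hv⟩), fun hadj => ?_⟩
      obtain ⟨v, hv, hv'⟩ := hno w' h2
      by_cases hvw : v = w
      · exact hv' (hvw ▸ hadj)
      · exact hv' (h v (Finset.mem_erase.2 ⟨hvw, hv⟩))
    -- a vertex of least value is the third vertex of a forbidden path
    obtain ⟨c, hc, hmin⟩ := K.exists_min_image f hne
    obtain ⟨b, hb, hbc, hbK, hbc'⟩ := hstep c hc
    obtain ⟨a, ha, hab, haK, hab'⟩ := hstep b hb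
    have hpb := hp b hb
    have hpa := hp a ha
    refine hobs (p b) (hSY hpb.2.1) b hpb.1 c (hp c hc).1 (p a) (hSY hpa.2.1) hpb.2.2.1
      (hK hb hc hbc) (haK c hc hbc.symm).symm hbc' (fun h => hab' h.symm) ?_ hpb.2.2.2
      ((hmin a ha).trans hpa.2.2.2)
    intro h
    exact hS hpb.2.1 hpa.2.1 h.ne h

end Degree
end BuoyColoring

namespace BuoyColoring

/-! ### Lower bounds for weighted colorings -/

section LowerBound

variable {V : Type*} {g : SimpleGraph V} {W : V → ℕ}

open scoped Classical in
/-- The total weight of the stable sets of a weighted coloring that meet `X`. -/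
noncomputable def hits (c : WeightedColoring g W) (X : Finset V) : ℕ :=
  ∑ k, if ∃ x ∈ X, x ∈ c.S k then c.I k else 0

theorem hits_le_total (c : WeightedColoring g W) (X : Finset V) : hits c X ≤ c.total :=
  Finset.sum_le_sum fun k _ => by split_ifs <;> simp

open scoped Classical in
/-- Weak duality: if a stable set contains at most `m` of the vertices `r i`, then the total weight
of these vertices is at most `m` times the weight of the stable sets that meet them. -/
theorem sum_le_mul_hits (c : WeightedColoring g W) {X : Finset V} {ι : Type*} (s : Finset ι)
    (r : ι → V) (hr : ∀ i ∈ s, r i ∈ X) (m : ℕ)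
    (hm : ∀ S : Set V, g.IsIndepSet S → (s.filter fun i => r i ∈ S).card ≤ m) :
    ∑ i ∈ s, W (r i) ≤ m * hits c X := by
  calc ∑ i ∈ s, W (r i) ≤ ∑ i ∈ s, ∑ k, if r i ∈ c.S k then c.I k else 0 := by
        refine Finset.sum_le_sum fun i _ => ?_
        rw [← Finset.sum_filter]
        exact c.covers (r i)
    _ = ∑ k, ∑ i ∈ s, if r i ∈ c.S k then c.I k else 0 := Finset.sum_comm
    _ ≤ ∑ k, if ∃ x ∈ X, x ∈ c.S k then m * c.I k else 0 := by
        refine Finset.sum_le_sum fun k _ => ?_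
        rw [← Finset.sum_filter, Finset.sum_const, smul_eq_mul]
        split_ifs with h
        · exact Nat.mul_le_mul_right _ (hm _ (c.stable k))
        · rw [Finset.filter_eq_empty_iff.2 fun i hi hik => h ⟨_, hr i hi, hik⟩]
          simp
    _ = m * hits c X := by
        rw [hits, Finset.mul_sum]
        exact Finset.sum_congr rfl fun k _ => by split_ifs <;> simp

theorem clique_sum_le_hits (c : WeightedColoring g W) {X K : Finset V} (hK : g.IsClique K)
    (hKX : K ⊆ X) : ∑ v ∈ K, W v ≤ hits c X := by
  classical
  rw [← one_mul (hits c X)]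
  refine sum_le_mul_hits c K id (fun i hi => hKX hi) 1 fun S hS => ?_
  rw [Finset.card_le_one]
  simp only [Finset.mem_filter, id]
  intro a ha b hb
  by_contra hab
  exact hS ha.2 hb.2 hab (hK ha.1 hb.1 hab)

theorem isC5_sum_le_hits (c : WeightedColoring g W) {X : Finset V} {r : Fin 5 → V} (hr : IsC5 g r)
    (hX : ∀ i, r i ∈ X) : ∑ i, W (r i) ≤ 2 * hits c X := by
  classical
  refine sum_le_mul_hits c Finset.univ r (fun i _ => hX i) 2 fun S hS => ?_
  have key : ∀ s : Finset (Fin 5), (∀ i ∈ s, i + 1 ∉ s) → s.card ≤ 2 := by decide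
  refine key _ fun i hi hi' => ?_
  simp only [Finset.mem_filter, Finset.mem_univ, true_and] at hi hi'
  exact hS hi hi' (hr i).1.ne (hr i).1

theorem isC5_edge_le_hits (c : WeightedColoring g W) {X : Finset V} {r : Fin 5 → V}
    (hr : IsC5 g r) (hX : ∀ i, r i ∈ X) (i : Fin 5) :
    W (r i) + W (r (i + 1)) ≤ hits c X := by
  classical
  have h := clique_sum_le_hits c (X := X) (K := {r i, r (i + 1)}) ?_ ?_
  · rwa [Finset.sum_pair (hr i).1.ne] at h
  · simp only [Finset.coe_insert, Finset.coe_singleton]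
    rw [SimpleGraph.isClique_pair]
    exact fun _ => (hr i).1
  · simp [Finset.insert_subset_iff, hX]

variable (g) in
/-- The weighted chromatic number for the weights `W` is at most that for the weights `w`. -/
def Dominates (w W : V → ℕ) : Prop :=
  ∀ c : WeightedColoring g w, ∃ c' : WeightedColoring g W, c'.total ≤ c.total

theorem Dominates.trans {w W W' : V → ℕ} (h : Dominates g w W) (h' : Dominates g W W') :
    Dominates g w W' := fun c =>
  let ⟨c', h1⟩ := h c
  let ⟨c'', h2⟩ := h' c'
  ⟨c'', h2.trans h1⟩

theorem Dominates.of_le {w W : V → ℕ} (h : ∀ v, W v ≤ w v) : Dominates g w W := fun c =>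
  ⟨⟨c.size, c.S, c.I, c.stable, fun v => (h v).trans (c.covers v)⟩, le_rfl⟩

variable (g) in
/-- A homogeneous set: every vertex outside is adjacent to all or none of its elements. -/
def IsModule (X : Finset V) : Prop :=
  ∀ u ∉ X, ∀ x ∈ X, ∀ y ∈ X, g.Adj u x → g.Adj u y

open scoped Classical in
/-- All of the weight of a homogeneous set may be moved to one of its vertices, if the stable sets
that meet it have enough weight in every weighted coloring. -/
theorem dominates_of_isModule {X : Finset V} (hX : IsModule g X) {r : V} (hr : r ∈ X) (f : ℕ)
    (hf : ∀ c : WeightedColoring g W, f ≤ hits c X) :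
    Dominates g W fun v => if v = r then f else if v ∈ X then 0 else W v := by
  intro c
  let hit : Fin c.size → Prop := fun k => ∃ x ∈ X, x ∈ c.S k
  let S' : Fin c.size → Set V := fun k => {v | (v ∉ X ∧ v ∈ c.S k) ∨ (v = r ∧ hit k)}
  have hS' : ∀ k v, v ∈ S' k ↔ (v ∉ X ∧ v ∈ c.S k) ∨ (v = r ∧ hit k) := fun k v => Iff.rfl
  have houter : ∀ k u, u ∉ X → u ∈ c.S k → hit k → ¬ g.Adj u r := by
    rintro k u hu huS ⟨x, hx, hxS⟩ h
    have hux := hX u hu r hr x hx h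
    exact c.stable k huS hxS hux.ne hux
  refine ⟨⟨c.size, S', c.I, ?_, ?_⟩, le_rfl⟩
  · intro k u hu v hv huv
    rw [hS'] at hu hv
    rcases hu with hu | hu <;> rcases hv with hv | hv
    · exact c.stable k hu.2 hv.2 huv
    · rw [hv.1]
      exact houter k u hu.1 hu.2 hv.2
    · rw [hu.1]
      exact fun h => houter k v hv.1 hv.2 hu.2 h.symm
    · exact absurd (hu.1.trans hv.1.symm) huv
  · intro v
    split_ifs with h1 h2
    · refine (hf c).trans ?_
      rw [hits, ← Finset.sum_filter]
      refine Finset.sum_le_sum_of_subset fun k hk => ?_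
      simp only [Finset.mem_filter, Finset.mem_univ, true_and] at hk ⊢
      exact Or.inr ⟨h1, hk⟩
    · exact Nat.zero_le _
    · refine (c.covers v).trans (le_of_eq (Finset.sum_congr ?_ fun _ _ => rfl))
      ext k
      simp [hS', h1, h2]

end LowerBound
end BuoyColoring

namespace BuoyColoring

/-! ### Partial colorings -/

/-- A stable set together with its weight in a coloring. -/
abbrev Piece : Type := Finset ℕ × ℕ

/-- The total weight of a list of pieces. -/
def wsum (l : List Piece) : ℕ := (l.map Prod.snd).sum

/-- The total weight of the pieces that contain `x`. -/
def cov (x : ℕ) (l : List Piece) : ℕ := (l.map fun P => if x ∈ P.1 then P.2 else 0).sum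

/-- The stable set of the first piece. -/
def headSet : List Piece → Finset ℕ
  | [] => ∅
  | P :: _ => P.1

/-- The weight of the first piece. -/
def headWt : List Piece → ℕ
  | [] => 0
  | P :: _ => P.2

/-- Take weight `δ` away from the first piece, and drop this piece if nothing is left of it. -/
def consume (δ : ℕ) : List Piece → List Piece
  | [] => []
  | P :: l => if P.2 ≤ δ then l else (P.1, P.2 - δ) :: l

/-- Take weight `δ` away from the first piece of each list `L r` with `r ∈ S`. -/
def serve (L : ℕ → List Piece) (S : Finset ℕ) (δ : ℕ) (r : ℕ) : List Piece :=
  if r ∈ S then consume δ (L r) else L r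

/-- The piece of weight `δ` that unites the first pieces of the lists `L r` with `r ∈ S`. -/
def unite (L : ℕ → List Piece) (S : Finset ℕ) (δ : ℕ) : Piece :=
  (S.biUnion fun r => headSet (L r), δ)

@[simp] theorem wsum_nil : wsum [] = 0 := rfl
@[simp] theorem wsum_cons (P : Piece) (l : List Piece) : wsum (P :: l) = P.2 + wsum l := rfl
@[simp] theorem cov_nil (x : ℕ) : cov x [] = 0 := rfl
@[simp] theorem cov_cons (x : ℕ) (P : Piece) (l : List Piece) :
    cov x (P :: l) = (if x ∈ P.1 then P.2 else 0) + cov x l := rfl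
@[simp] theorem wsum_append (l l' : List Piece) : wsum (l ++ l') = wsum l + wsum l' := by
  simp [wsum]
@[simp] theorem cov_append (x : ℕ) (l l' : List Piece) : cov x (l ++ l') = cov x l + cov x l' := by
  simp [cov]

theorem headWt_le_wsum (l : List Piece) : headWt l ≤ wsum l := by
  cases l <;> simp [headWt]

theorem wsum_consume {δ : ℕ} {l : List Piece} (h : δ ≤ headWt l) :
    wsum (consume δ l) + δ = wsum l := by
  cases l with
  | nil => simpa [headWt, consume] using h
  | cons P l =>
    simp only [headWt] at h
    simp only [consume]
    split_ifs <;> simp <;> omega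

theorem cov_consume {δ : ℕ} {l : List Piece} (h : δ ≤ headWt l) (x : ℕ) :
    cov x (consume δ l) + (if x ∈ headSet l then δ else 0) = cov x l := by
  cases l with
  | nil => simp [headSet, consume]
  | cons P l =>
    simp only [headWt] at h
    simp only [consume, headSet]
    split_ifs <;> simp [*] <;> omega

theorem length_consume_le (δ : ℕ) (l : List Piece) : (consume δ l).length ≤ l.length := by
  cases l with
  | nil => simp [consume]
  | cons P l =>
    simp only [consume]
    split_ifs <;> simp

theorem length_consume_lt {δ : ℕ} {l : List Piece} (hl : l ≠ []) (h : headWt l ≤ δ) :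
    (consume δ l).length + 1 = l.length := by
  cases l with
  | nil => exact absurd rfl hl
  | cons P l =>
    simp only [headWt] at h
    simp [consume, h]

theorem mem_consume {δ : ℕ} {l : List Piece} {P : Piece} (h : P ∈ consume δ l) :
    P ∈ l ∨ ∃ P' ∈ l, P = (P'.1, P'.2 - δ) ∧ δ < P'.2 := by
  cases l with
  | nil => simp [consume] at h
  | cons P' l =>
    simp only [consume] at h
    split_ifs at h with hδ
    · exact Or.inl (List.mem_cons_of_mem _ h)
    · rcases List.mem_cons.1 h with rfl | h
      · exact Or.inr ⟨P', by simp, rfl, by omega⟩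
      · exact Or.inl (List.mem_cons_of_mem _ h)

theorem consume_nil_of_nil {δ : ℕ} {l : List Piece} (h : l = []) : consume δ l = [] := by
  subst h; rfl

theorem mem_headSet {x : ℕ} {l : List Piece} (h : x ∈ headSet l) : ∃ P ∈ l, P.1 = headSet l := by
  cases l with
  | nil => simp [headSet] at h
  | cons P l => exact ⟨P, by simp, rfl⟩

/-- The lists of pieces `L r` describe an intermediate stage of the computation: only the vertices
`r` with `L r ≠ []` are left, each of them stands for the homogeneous set of the vertices in its
pieces, and `L r` is a weighted coloring of this set. No generality is lost by using these
colorings, as `dominates` says. -/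
structure Stage (g : SimpleGraph ℕ) (n W : ℕ) (w : ℕ → ℕ) (L : ℕ → List Piece) : Prop where
  supp : ∀ r, n ≤ r → L r = []
  pos : ∀ r, ∀ P ∈ L r, 0 < P.2 ∧ P.2 ≤ W
  indep : ∀ r, ∀ P ∈ L r, g.IsIndepSet (P.1 : Set ℕ)
  cross : ∀ r r', r ≠ r' → ∀ P ∈ L r, ∀ P' ∈ L r', ∀ x ∈ P.1, ∀ y ∈ P'.1,
    x ≠ y ∧ (¬ g.Adj r r' → ¬ g.Adj x y)
  cover : ∀ x, w x ≤ ∑ r ∈ Finset.range n, cov x (L r)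
  dominates : Dominates g w fun r => wsum (L r)

/-- The pieces of the vertices in `X` at the stage `L₀` are being merged into a coloring of their
union: `O` consists of the new pieces, and `L` of what is left of the old ones. -/
structure Merging (g : SimpleGraph ℕ) (W : ℕ) (X : Finset ℕ) (L₀ L : ℕ → List Piece)
    (O : List Piece) : Prop where
  outside : ∀ r ∉ X, L r = L₀ r
  old : ∀ r ∈ X, ∀ P ∈ L r, (0 < P.2 ∧ P.2 ≤ W) ∧ ∃ P₀ ∈ L₀ r, P₀.1 = P.1
  pos : ∀ P ∈ O, 0 < P.2 ∧ P.2 ≤ W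
  indep : ∀ P ∈ O, g.IsIndepSet (P.1 : Set ℕ)
  new : ∀ P ∈ O, ∀ x ∈ P.1, ∃ r ∈ X, ∃ P₀ ∈ L₀ r, x ∈ P₀.1
  cover : ∀ x, ∑ r ∈ X, cov x (L₀ r) ≤ ∑ r ∈ X, cov x (L r) + cov x O

section Merging

variable {g : SimpleGraph ℕ} {n W : ℕ} {w : ℕ → ℕ} {X : Finset ℕ} {L₀ L : ℕ → List Piece}
  {O : List Piece}

theorem Stage.merging (h : Stage g n W w L) (X : Finset ℕ) : Merging g W X L L [] where
  outside _ _ := rfl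
  old r _ P hP := ⟨h.pos r P hP, P, hP, rfl⟩
  pos := by simp
  indep := by simp
  new := by simp
  cover _ := by simp

theorem Merging.ne_nil (hm : Merging g W X L₀ L O) {r : ℕ} (h : L r ≠ []) : L₀ r ≠ [] := by
  by_cases hr : r ∈ X
  · obtain ⟨P, hP⟩ := List.exists_mem_of_ne_nil _ h
    obtain ⟨-, P₀, hP₀, -⟩ := hm.old r hr P hP
    exact List.ne_nil_of_mem hP₀
  · rwa [← hm.outside r hr]

/-- One step of merging: a piece of weight `δ` is cut off from the first pieces of the vertices in a
stable set, and the union of these is a new piece. -/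
theorem Merging.serve (hs : Stage g n W w L₀) (hm : Merging g W X L₀ L O) {S : Finset ℕ}
    (hSX : S ⊆ X) (hS : g.IsIndepSet (S : Set ℕ)) {δ : ℕ} (hδ : 0 < δ ∧ δ ≤ W)
    (hSδ : ∀ r ∈ S, δ ≤ headWt (L r)) :
    Merging g W X L₀ (serve L S δ) (O ++ [unite L S δ]) := by
  have hhead : ∀ r ∈ X, ∀ x ∈ headSet (L r), ∃ P₀ ∈ L₀ r, x ∈ P₀.1 ∧ P₀.1 = headSet (L r) := by
    intro r hr x hx
    obtain ⟨P, hP, hPx⟩ := mem_headSet hx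
    obtain ⟨-, P₀, hP₀, hPP⟩ := hm.old r hr P hP
    exact ⟨P₀, hP₀, by rwa [hPP, hPx], hPP.trans hPx⟩
  constructor
  · intro r hr
    rw [BuoyColoring.serve, if_neg fun h => hr (hSX h), hm.outside r hr]
  · intro r hr P hP
    rw [BuoyColoring.serve] at hP
    split_ifs at hP with hrS
    · rcases mem_consume hP with hP | ⟨P', hP', rfl, hlt⟩
      · exact hm.old r hr P hP
      · obtain ⟨h1, h2⟩ := hm.old r hr P' hP'
        exact ⟨⟨by simpa using hlt, (Nat.sub_le _ _).trans h1.2⟩, h2⟩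
    · exact hm.old r hr P hP
  · intro P hP
    rcases List.mem_append.1 hP with hP | hP
    · exact hm.pos P hP
    · rw [List.mem_singleton.1 hP]
      exact hδ
  · intro P hP
    rcases List.mem_append.1 hP with hP | hP
    · exact hm.indep P hP
    · rw [List.mem_singleton.1 hP]
      intro x hx y hy hxy
      simp only [unite, Finset.coe_biUnion, Set.mem_iUnion, Finset.mem_coe, exists_prop] at hx hy
      obtain ⟨r, hr, hx⟩ := hx
      obtain ⟨r', hr', hy⟩ := hy
      obtain ⟨P₀, hP₀, hx₀, e₀⟩ := hhead r (hSX hr) x hx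
      obtain ⟨P₁, hP₁, hy₁, e₁⟩ := hhead r' (hSX hr') y hy
      by_cases hrr : r = r'
      · subst hrr
        rw [e₁, ← e₀] at hy₁
        exact hs.indep r P₀ hP₀ hx₀ hy₁ hxy
      · exact (hs.cross r r' hrr P₀ hP₀ P₁ hP₁ x hx₀ y hy₁).2 (hS hr hr' hrr)
  · intro P hP x hx
    rcases List.mem_append.1 hP with hP | hP
    · exact hm.new P hP x hx
    · rw [List.mem_singleton.1 hP] at hx
      simp only [unite, Finset.mem_biUnion] at hx
      obtain ⟨r, hr, hx⟩ := hx
      obtain ⟨P₀, hP₀, hx₀, -⟩ := hhead r (hSX hr) x hx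
      exact ⟨r, hSX hr, P₀, hP₀, hx₀⟩
  · intro x
    refine (hm.cover x).trans ?_
    have h1 : ∑ r ∈ X, cov x (L r) = ∑ r ∈ X, cov x (BuoyColoring.serve L S δ r) +
        ∑ r ∈ S, if x ∈ headSet (L r) then δ else 0 := by
      rw [← Finset.inter_eq_right.2 hSX, ← Finset.sum_ite_mem, ← Finset.sum_add_distrib]
      refine Finset.sum_congr rfl fun r _ => ?_
      rw [Finset.inter_eq_right.2 hSX, BuoyColoring.serve]
      split_ifs with h1 h2
      · rw [← cov_consume (hSδ r h1) x, if_pos h2]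
      · rw [← cov_consume (hSδ r h1) x, if_neg h2]
      · simp
    -- the first pieces are disjoint, so at most one of them contains `x`
    have h2 : (∑ r ∈ S, if x ∈ headSet (L r) then δ else 0) ≤
        if x ∈ (unite L S δ).1 then δ else 0 := by
      split_ifs with hx
      · simp only [unite, Finset.mem_biUnion] at hx
        obtain ⟨r, hr, hx⟩ := hx
        rw [Finset.sum_eq_single_of_mem r hr]
        · split_ifs; simp
        · intro r' hr' hne
          rw [if_neg]
          intro hx'
          obtain ⟨P₀, hP₀, hx₀, -⟩ := hhead r (hSX hr) x hx
          obtain ⟨P₁, hP₁, hx₁, -⟩ := hhead r' (hSX hr') x hx'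
          exact (hs.cross r' r hne P₁ hP₁ P₀ hP₀ x hx₁ x hx₀).1 rfl
      · simp only [unite, Finset.mem_biUnion, not_exists, not_and] at hx
        rw [Finset.sum_eq_zero fun r hr => if_neg (hx r hr)]
    rw [h1]
    simp only [cov_append, cov_cons, cov_nil, show (unite L S δ).2 = δ from rfl]
    omega

/-- The stage after the merged pieces `O` have been handed to the vertex `r₀`. -/
def contract (X : Finset ℕ) (r₀ : ℕ) (O : List Piece) (L : ℕ → List Piece) (r : ℕ) : List Piece :=
  if r = r₀ then O else if r ∈ X then [] else L r

/-- Merging the pieces of a homogeneous set completely leads to the next stage, if the total weight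
of the new pieces is a lower bound for every weighted coloring. -/
theorem Merging.stage (hs : Stage g n W w L₀) (hm : Merging g W X L₀ L O)
    (hX : ∀ r ∈ X, r < n) (hmod : IsModule g X) {r₀ : ℕ} (hr₀ : r₀ ∈ X)
    (hL : ∀ r ∈ X, L r = []) (hO : ∀ c : WeightedColoring g fun r => wsum (L₀ r), wsum O ≤ hits c X) :
    Stage g n W w (contract X r₀ O L₀) := by
  have hcross : ∀ r, r ∉ X → ∀ P ∈ L₀ r, ∀ P' ∈ O, ∀ x ∈ P.1, ∀ y ∈ P'.1,
      x ≠ y ∧ (¬ g.Adj r r₀ → ¬ g.Adj x y) := by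
    intro r hr P hP P' hP' x hx y hy
    obtain ⟨r', hr', P₁, hP₁, hy₁⟩ := hm.new P' hP' y hy
    have hne : r ≠ r' := by
      rintro rfl
      exact hr hr'
    obtain ⟨h1, h2⟩ := hs.cross r r' hne P hP P₁ hP₁ x hx y hy₁
    exact ⟨h1, fun h => h2 fun h' => h (hmod r hr r' hr' r₀ hr₀ h')⟩
  constructor
  · intro r hr
    have hrX : r ∉ X := fun h => absurd (hX r h) (by omega)
    rw [contract, if_neg, if_neg hrX, hs.supp r hr]
    rintro rfl
    exact hrX hr₀
  · intro r P hP
    rw [contract] at hP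
    split_ifs at hP
    · exact hm.pos P hP
    · simp at hP
    · exact hs.pos r P hP
  · intro r P hP
    rw [contract] at hP
    split_ifs at hP
    · exact hm.indep P hP
    · simp at hP
    · exact hs.indep r P hP
  · intro r r' hrr P hP P' hP' x hx y hy
    rw [contract] at hP hP'
    split_ifs at hP hP' with h1 h2 h3
    · exact absurd (h1.trans h2.symm) hrr
    · simp at hP'
    · obtain ⟨e1, e2⟩ := hcross r' h3 P' hP' P hP y hy x hx
      refine ⟨e1.symm, fun h h' => e2 (fun h'' => h ?_) h'.symm⟩
      rw [h1]
      exact h''.symm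
    · simp at hP
    · simp at hP
    · simp at hP
    · have e : r' = r₀ := by assumption
      rw [e]
      exact hcross r (by assumption) P hP P' hP' x hx y hy
    · simp at hP'
    · exact hs.cross r r' hrr P hP P' hP' x hx y hy
  · intro x
    have hXn : X ⊆ Finset.range n := fun r hr => Finset.mem_range.2 (hX r hr)
    refine (hs.cover x).trans ?_
    have h1 := hm.cover x
    have h0 : ∑ r ∈ X, cov x (L r) = 0 := Finset.sum_eq_zero fun r hr => by rw [hL r hr, cov_nil]
    rw [h0, zero_add] at h1
    rw [← Finset.sum_sdiff hXn, ← Finset.sum_sdiff hXn]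
    refine Nat.add_le_add (le_of_eq (Finset.sum_congr rfl fun r hr => ?_)) (h1.trans ?_)
    · have hrX := (Finset.mem_sdiff.1 hr).2
      rw [contract, if_neg, if_neg hrX]
      rintro rfl
      exact hrX hr₀
    · refine le_trans ?_ (Finset.single_le_sum (f := fun r => cov x (contract X r₀ O L₀ r))
        (fun _ _ => Nat.zero_le _) hr₀)
      simp [contract]
  · refine hs.dominates.trans ?_
    convert dominates_of_isModule hmod hr₀ (wsum O) hO using 2 with r
    rw [contract]
    split_ifs <;> rfl

end Merging

/-! ### Greedy merging -/

section Greedy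

variable {g : SimpleGraph ℕ} {n W : ℕ} {w : ℕ → ℕ} {X : Finset ℕ} {L₀ L : ℕ → List Piece}
  {O : List Piece} {f : ℕ → ℕ}

/-- A maximal stable set `S` of `Y` as the greedy procedure by decreasing value `f` finds it. -/
def IsGreedy (g : SimpleGraph ℕ) (f : ℕ → ℕ) (Y : Set ℕ) (S : Finset ℕ) : Prop :=
  (∀ r ∈ S, r ∈ Y) ∧ g.IsIndepSet (S : Set ℕ) ∧
    ∀ v ∈ Y, v ∉ S → ∃ u ∈ S, g.Adj u v ∧ f v ≤ f u

/-- The values `f` order the vertices of `Y` perfectly: there is no induced path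
`a - b - c - d` with `f b ≤ f a` and `f c ≤ f d`. -/
def IsPerfectOrder (g : SimpleGraph ℕ) (f : ℕ → ℕ) (Y : Set ℕ) : Prop :=
  ∀ a ∈ Y, ∀ b ∈ Y, ∀ c ∈ Y, ∀ d ∈ Y, g.Adj a b → g.Adj b c → g.Adj c d → ¬ g.Adj a c →
    ¬ g.Adj b d → ¬ g.Adj a d → f b ≤ f a → f c ≤ f d → False

/-- Every clique of the remaining vertices extends to one that accounts for all of the new
pieces. -/
def CliqueBound (g : SimpleGraph ℕ) (X : Finset ℕ) (L₀ L : ℕ → List Piece) (O : List Piece) :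
    Prop :=
  ∀ K ⊆ X, g.IsClique (K : Set ℕ) → (∀ v ∈ K, L v ≠ []) →
    ∃ K' ⊆ X, g.IsClique (K' : Set ℕ) ∧
      ∑ v ∈ K, wsum (L v) + wsum O ≤ ∑ v ∈ K', wsum (L₀ v)

theorem CliqueBound.refl (L : ℕ → List Piece) : CliqueBound g X L L [] :=
  fun K hK hc _ => ⟨K, hK, hc, by simp⟩

/-- If a clique of remaining vertices avoids the selected set, then some selected vertex is adjacent
to all of it, because the order is perfect; so the clique extended by this vertex pays for the new
piece. -/
theorem CliqueBound.serve (h : CliqueBound g X L₀ L O) {Y : Set ℕ} (hY : IsPerfectOrder g f Y)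
    (hLY : ∀ v ∈ X, L v ≠ [] → v ∈ Y) {S : Finset ℕ} (hSX : S ⊆ X)
    (hS : IsGreedy g f {v | v ∈ X ∧ L v ≠ []} S) (hne : S.Nonempty) {δ : ℕ}
    (hδ : ∀ r ∈ S, δ ≤ headWt (L r)) :
    CliqueBound g X L₀ (serve L S δ) (O ++ [unite L S δ]) := by
  classical
  obtain ⟨hSL, hind, hgr⟩ := hS
  intro K hKX hK hKne
  have hKL : ∀ v ∈ K, L v ≠ [] := by
    intro v hv h
    apply hKne v hv
    rw [BuoyColoring.serve]
    split_ifs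
    · exact consume_nil_of_nil h
    · exact h
  have hwserve : ∀ v ∈ S, wsum (BuoyColoring.serve L S δ v) + δ = wsum (L v) := by
    intro v hv
    rw [BuoyColoring.serve, if_pos hv, wsum_consume (hδ v hv)]
  have hwle : ∀ v, wsum (BuoyColoring.serve L S δ v) ≤ wsum (L v) := by
    intro v
    by_cases hv : v ∈ S
    · have := hwserve v hv
      omega
    · rw [BuoyColoring.serve, if_neg hv]
  have hO : wsum (O ++ [unite L S δ]) = wsum O + δ := by simp [unite]
  by_cases hKS : ∃ v ∈ K, v ∈ S
  · obtain ⟨v, hvK, hvS⟩ := hKS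
    obtain ⟨K', h1, h2, h3⟩ := h K hKX hK hKL
    refine ⟨K', h1, h2, le_trans ?_ h3⟩
    rw [hO, ← Finset.add_sum_erase _ _ hvK, ← Finset.add_sum_erase _ _ hvK]
    have := Finset.sum_le_sum (s := K.erase v) fun v _ => hwle v
    have := hwserve v hvS
    omega
  · push Not at hKS
    obtain ⟨u, huS, huK⟩ : ∃ u ∈ S, ∀ v ∈ K, g.Adj u v := by
      rcases K.eq_empty_or_nonempty with rfl | hKn
      · obtain ⟨u, hu⟩ := hne
        exact ⟨u, hu, by simp⟩
      · have hex : ∀ v, ∃ u, v ∈ K → u ∈ S ∧ g.Adj u v ∧ f v ≤ f u := by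
          intro v
          by_cases hv : v ∈ K
          · obtain ⟨u, hu, h'⟩ := hgr v ⟨hKX hv, hKL v hv⟩ (hKS v hv)
            exact ⟨u, fun _ => ⟨hu, h'⟩⟩
          · exact ⟨0, fun h => absurd h hv⟩
        choose p hp using hex
        obtain ⟨w, hw, hwK⟩ := exists_complete_to_clique (f := f)
          (fun r hr => hLY r (hSX hr) (hSL r hr).2 : (S : Set ℕ) ⊆ Y) hind hY p K hK hKn
          fun v hv => ⟨hLY v (hKX hv) (hKL v hv), (hp v hv).1, (hp v hv).2.1, (hp v hv).2.2⟩
        exact ⟨p w, (hp w hw).1, hwK⟩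
    have huK' : u ∉ K := fun h => hKS u h huS
    obtain ⟨K', h1, h2, h3⟩ := h (insert u K)
      (Finset.insert_subset (hSX huS) hKX)
      (by
        rw [Finset.coe_insert]
        exact hK.insert fun v hv _ => huK v hv)
      (by
        intro v hv
        rcases Finset.mem_insert.1 hv with rfl | hv
        · exact (hSL _ huS).2
        · exact hKL v hv)
    refine ⟨K', h1, h2, le_trans ?_ h3⟩
    rw [hO, Finset.sum_insert huK']
    have := Finset.sum_le_sum (s := K) fun v _ => hwle v
    have := hwserve u huS
    omega

theorem CliqueBound.wsum_le_hits (h : CliqueBound g X L₀ L O)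
    (c : WeightedColoring g fun r => wsum (L₀ r)) : wsum O ≤ hits c X := by
  obtain ⟨K', h1, h2, h3⟩ := h ∅ (by simp) (by simp) (by simp)
  have := clique_sum_le_hits c h2 h1
  simp only [Finset.sum_empty, zero_add] at h3
  omega

/-- The number of pieces that belong to vertices of `X`. -/
def pieces (X : Finset ℕ) (L : ℕ → List Piece) : ℕ := ∑ r ∈ X, (L r).length

theorem length_serve_le (L : ℕ → List Piece) (S : Finset ℕ) (δ r : ℕ) :
    (serve L S δ r).length ≤ (L r).length := by
  rw [serve]
  split_ifs
  · exact length_consume_le _ _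
  · exact le_rfl

theorem pieces_serve_le (X : Finset ℕ) (L : ℕ → List Piece) (S : Finset ℕ) (δ : ℕ) :
    pieces X (serve L S δ) ≤ pieces X L :=
  Finset.sum_le_sum fun r _ => length_serve_le L S δ r

theorem pieces_serve_lt {S : Finset ℕ} {δ r : ℕ} (hr : r ∈ S) (hrX : r ∈ X) (hne : L r ≠ [])
    (hδ : headWt (L r) ≤ δ) : pieces X (serve L S δ) + 1 ≤ pieces X L := by
  refine Finset.sum_lt_sum (fun r _ => length_serve_le L S δ r) ⟨r, hrX, ?_⟩
  have := length_consume_lt hne hδ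
  rw [serve, if_pos hr]
  omega

end Greedy
end BuoyColoring

/-! ### Uniting pieces

The program uses the following arrays: `6` degrees, `7` labels of the vertices, `8` and `9` the
positions of the pieces of a vertex (the first one, and the one after the last), `10` what is left
of the weight of its first piece, `11` the weights of all pieces as they were emitted, `12` their
characteristic vectors, row by row, `14` available and `15` selected vertices, `16` the sizes of the
buoys that have been found, `17`, `18` and `19` three vertices of the corresponding five-cycles,
`20` the vertices of the present five-cycle, `21` the representatives of the parts of its buoy, `22`
and `23` the weights in coloring a five-cycle. The variable `13` is the number of rows. All other
names from `30` on are those of scalar variables.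
-/

namespace WordRAM

attribute [simp] Expr.eval Expr.Fits Expr.cost Op.eval

theorem mul_add_eq_iff {n k k' x x' : ℕ} (hx : x < n) (hx' : x' < n) :
    k * n + x = k' * n + x' ↔ k = k' ∧ x = x' := by
  constructor
  · intro h
    have hn : 0 < n := by omega
    have h1 : (k * n + x) / n = k := by
      rw [mul_comm, Nat.mul_add_div hn, Nat.div_eq_of_lt hx, add_zero]
    have h2 : (k' * n + x') / n = k' := by
      rw [mul_comm, Nat.mul_add_div hn, Nat.div_eq_of_lt hx', add_zero]
    have : k = k' := by rw [← h1, ← h2, h]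
    subst this
    exact ⟨rfl, by omega⟩
  · rintro ⟨rfl, rfl⟩
    rfl

theorem mul_add_lt {n k m x : ℕ} (hk : k < m) (hx : x < n) : k * n + x < m * n := by
  have := Nat.mul_le_mul_right n (Nat.succ_le_of_lt hk)
  rw [Nat.succ_mul] at this
  omega

open BuoyColoring

/-- Row `k` of the array of characteristic vectors describes the set `P`. -/
def RowIs (n : ℕ) (σ : State) (k : ℕ) (P : Finset ℕ) : Prop :=
  ∀ x < n, σ 12 (k * n + x) = if x ∈ P then 1 else 0

/-- Unite the first pieces of the selected vertices in a new row. -/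
def emitRow : Prog :=
  forTo 30 0 (.ite (.read 15 (var 30))
    (forTo 31 0 (.ite (.read 12 (.op .add (.op .mul (.read 8 (var 30)) (var 0)) (var 31)))
      (.assign 12 (.op .add (.op .mul (var 13) (var 0)) (var 31)) (.const 1)) .skip)) .skip)

theorem run_emitRow {B n : ℕ} {σ : State} (hn : σ 0 0 = n) {S : Finset ℕ} (hd : ℕ → Finset ℕ)
    (hS : ∀ u < n, σ 15 u = if u ∈ S then 1 else 0) (hSn : ∀ u ∈ S, u < n)
    (hrow : ∀ u ∈ S, RowIs n σ (σ 8 u) (hd u) ∧ σ 8 u < σ 13 0)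
    (hfresh : ∀ x < n, σ 12 (σ 13 0 * n + x) = 0) (hB : σ 13 0 * n + n + 1 ≤ B) :
    Run B emitRow σ fun t τ => t ≤ 100 * (n + 1) + S.card * (100 * (n + 1)) ∧
      Frame [12, 30, 31] σ τ ∧ (∀ k ≠ σ 13 0, ∀ x < n, τ 12 (k * n + x) = σ 12 (k * n + x)) ∧
      RowIs n τ (σ 13 0) (S.biUnion hd) := by
  refine (run_forTo (N := n) (fun k s ρ => s ≤ 30 * k + (S.filter (· < k)).card * (100 * (n + 1)) ∧
    Frame [12, 30, 31] σ ρ ∧ (∀ k ≠ σ 13 0, ∀ x < n, ρ 12 (k * n + x) = σ 12 (k * n + x)) ∧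
      RowIs n ρ (σ 13 0) ((S.filter (· < k)).biUnion hd))
    (30 * n + S.card * (100 * (n + 1))) (by decide) (by omega) hn ?_ ?_ ?_).mono ?_
  · refine ⟨by simp, (Frame.refl _ _).store (by simp), by simp, ?_⟩
    intro x hx
    simpa using hfresh x hx
  · rintro k s ρ hk ⟨h, -⟩
    refine h.trans ?_
    have := Finset.card_le_card (Finset.filter_subset (· < k) S)
    gcongr
  · rintro k s ρ hk hρk hρn ⟨hs, hF, hT, hR⟩
    have e15 : ρ 15 = σ 15 := hF 15 (by decide)
    have e8 : ρ 8 = σ 8 := hF 8 (by decide)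
    have e13 : ρ 13 = σ 13 := hF 13 (by decide)
    simp only [run_ite, run_skip, Expr.eval, Expr.Fits, Expr.cost, hρk, e15, hS k hk]
    refine ⟨Nat.zero_le _, fun h1 => ?_, fun h1 => ?_⟩
    · have hkS : k ∈ S := by
        by_contra h
        simp [h] at h1
      obtain ⟨hrk, hlt⟩ := hrow k hkS
      have hfil : S.filter (· < k + 1) = insert k (S.filter (· < k)) := by
        ext u
        simp only [Finset.mem_filter, Finset.mem_insert]
        constructor
        · rintro ⟨h, h'⟩
          by_cases huk : u = k
          · exact Or.inl huk
          · exact Or.inr ⟨h, by omega⟩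
        · rintro (rfl | ⟨h, h'⟩)
          · exact ⟨hkS, by omega⟩
          · exact ⟨h, by omega⟩
      refine (run_forTo' (N := n) (fun j τ => Frame [12, 31] ρ τ ∧
        (∀ k ≠ σ 13 0, ∀ x < n, τ 12 (k * n + x) = σ 12 (k * n + x)) ∧
        ∀ x < n, τ 12 (σ 13 0 * n + x) =
          if x ∈ (S.filter (· < k)).biUnion hd ∨ (x < j ∧ x ∈ hd k) then 1 else 0) 50
        (by decide) (by omega) hρn ?_ ?_).mono ?_
      · refine ⟨(Frame.refl _ _).store (by simp), by simpa using hT, ?_⟩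
        intro x hx
        rw [store_ne (by decide), hR x hx]
        exact if_congr (by simp) rfl rfl
      · rintro j τ hj hτj hτn ⟨hF', hT', hR'⟩
        have f8 : τ 8 = σ 8 := (hF' 8 (by decide)).trans e8
        have f13 : τ 13 = σ 13 := (hF' 13 (by decide)).trans e13
        have f30 : τ 30 0 = k := by rw [hF' 30 (by decide), hρk]
        have hlt1 := mul_add_lt hlt hj
        have hval : τ 12 (σ 8 k * n + j) = if j ∈ hd k then 1 else 0 := by
          rw [hT' _ hlt.ne _ hj, hrk j hj]
        simp only [run_ite, run_skip, run_assign, Expr.eval, Expr.Fits, Expr.cost, Op.eval, f8, f13,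
          f30, hτj, hτn, hval, Nat.zero_le, true_and]
        have hb : σ 13 0 * n + j + 1 ≤ B := by omega
        have hb' : σ 8 k * n + j + 1 ≤ B := by omega
        refine ⟨⟨by omega, by omega⟩, fun h2 => ⟨⟨by omega, by omega⟩, by omega, by omega, ?_⟩,
          fun h2 => ⟨by omega, ?_⟩⟩
        · have hjk : j ∈ hd k := by
            by_contra h
            simp [h] at h2
          simp only [store_ne (show 31 ≠ 12 by decide), store_ne (show 0 ≠ 12 by decide),
            store_ne (show 12 ≠ 31 by decide)]
          refine ⟨hτj, hτn, (hF'.store (by simp)).store (by simp), ?_, ?_⟩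
          · intro k' hk' x hx
            rw [store_same, if_neg, hT' k' hk' x hx]
            rw [mul_add_eq_iff hx hj]
            exact fun h => hk' h.1
          · intro x hx
            rw [store_same]
            simp only [mul_add_eq_iff hx hj, true_and, hR' x hx]
            by_cases hxj : x = j
            · subst hxj
              rw [if_pos rfl, if_pos (Or.inr ⟨by omega, hjk⟩)]
            · rw [if_neg hxj]
              exact if_congr (by rw [show x < j + 1 ↔ x < j by omega]) rfl rfl
        · have hjk : j ∉ hd k := by
            intro h
            simp [h] at h2
          simp only [store_ne (show 12 ≠ 31 by decide)]
          refine ⟨hF'.store (by simp), hT', ?_⟩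
          intro x hx
          rw [hR' x hx]
          refine if_congr ?_ rfl rfl
          by_cases hxj : x = j
          · subst hxj
            simp [hjk]
          · rw [show x < j + 1 ↔ x < j by omega]
      · rintro t τ ⟨ht, ⟨hF', hT', hR'⟩, -, hτn⟩
        refine ⟨by rw [hF' 30 (by decide), hρk], hτn, ?_, ?_, ?_, ?_⟩
        · rw [hfil, Finset.card_insert_of_notMem (by simp), add_mul, one_mul]
          omega
        · exact (hF.trans hF' (by simp)).store (by simp)
        · rwa [store_ne (by decide)]
        · intro x hx
          rw [store_ne (by decide), hR' x hx, hfil]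
          refine if_congr ?_ rfl rfl
          simp only [Finset.mem_biUnion, Finset.mem_insert, hx, true_and]
          constructor
          · rintro (⟨u, hu, hx⟩ | hx)
            · exact ⟨u, Or.inr hu, hx⟩
            · exact ⟨k, Or.inl rfl, hx⟩
          · rintro ⟨u, rfl | hu, hx⟩
            · exact Or.inr hx
            · exact Or.inl ⟨u, hu, hx⟩
    · have hkS : k ∉ S := by
        intro h
        simp [h] at h1
      have hfil : S.filter (· < k + 1) = S.filter (· < k) := by
        ext u
        simp only [Finset.mem_filter]
        constructor
        · rintro ⟨h, h'⟩
          refine ⟨h, lt_of_le_of_ne (by omega) ?_⟩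
          rintro rfl
          exact hkS h
        · exact fun h => ⟨h.1, by omega⟩
      refine ⟨trivial, hρn, ?_, hF.store (by simp), ?_, ?_⟩
      · rw [hfil]
        omega
      · rwa [store_ne (by decide)]
      · rw [hfil]
        intro x hx
        rw [store_ne (by decide), hR x hx]
  · rintro t τ ⟨s, rfl, ⟨hs, hF, hT, hR⟩, -⟩
    have hfil : S.filter (· < n) = S := Finset.filter_true_of_mem hSn
    rw [hfil] at hs hR
    exact ⟨by omega, hF, hT, hR⟩

end WordRAM

/-! ### Pieces in memory and the emission of a piece -/

namespace WordRAM

open BuoyColoring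

/-- The rows and weights from position `k` on hold the pieces in the list. -/
def Seg (n : ℕ) (σ : State) : ℕ → List Piece → Prop
  | _, [] => True
  | k, P :: l => σ 11 k = P.2 ∧ RowIs n σ k P.1 ∧ Seg n σ (k + 1) l

/-- The pieces of the vertex `r` are those from position `σ 8 r` to position `σ 9 r - 1`, except
that the remaining weight of the first of them is `σ 10 r`. -/
def Holds (n : ℕ) (σ : State) (r : ℕ) : List Piece → Prop
  | [] => σ 9 r = σ 8 r
  | P :: l => σ 10 r = P.2 ∧ RowIs n σ (σ 8 r) P.1 ∧ Seg n σ (σ 8 r + 1) l ∧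
      σ 9 r = σ 8 r + 1 + l.length ∧ σ 9 r ≤ σ 13 0

/-- Rows and weights before position `m` are the same in `σ` and `τ`. -/
def AgreeBelow (n m : ℕ) (σ τ : State) : Prop :=
  (∀ k < m, τ 11 k = σ 11 k) ∧ ∀ k < m, ∀ x < n, τ 12 (k * n + x) = σ 12 (k * n + x)

theorem RowIs.agree {n m k : ℕ} {σ τ : State} {P : Finset ℕ} (h : RowIs n σ k P)
    (ha : AgreeBelow n m σ τ) (hk : k < m) : RowIs n τ k P := fun x hx => by
  rw [ha.2 k hk x hx, h x hx]

theorem Seg.agree {n m : ℕ} {σ τ : State} (ha : AgreeBelow n m σ τ) {k : ℕ} {l : List Piece}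
    (h : Seg n σ k l) (hk : k + l.length ≤ m) : Seg n τ k l := by
  induction l generalizing k with
  | nil => trivial
  | cons P l ih =>
    simp only [List.length_cons] at hk
    obtain ⟨h1, h2, h3⟩ := h
    exact ⟨by rw [ha.1 k (by omega), h1], h2.agree ha (by omega), ih h3 (by omega)⟩

theorem Seg.append {n : ℕ} {σ : State} {k : ℕ} {l l' : List Piece} (h : Seg n σ k l)
    (h' : Seg n σ (k + l.length) l') : Seg n σ k (l ++ l') := by
  induction l generalizing k with
  | nil => exact h'
  | cons P l ih =>
    refine ⟨h.1, h.2.1, ih h.2.2 ?_⟩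
    rw [List.length_cons] at h'
    convert h' using 1
    ring

theorem Holds.agree {n : ℕ} {σ τ : State} {r : ℕ} {l : List Piece} (h : Holds n σ r l)
    (ha : AgreeBelow n (σ 13 0) σ τ) (h8 : τ 8 r = σ 8 r) (h9 : τ 9 r = σ 9 r)
    (h10 : τ 10 r = σ 10 r) (h13 : σ 13 0 ≤ τ 13 0) : Holds n τ r l := by
  cases l with
  | nil => simpa [Holds, h8, h9] using h
  | cons P l =>
    obtain ⟨e1, e2, e3, e4, e5⟩ := h
    simp only [Holds, h8, h9, h10]
    exact ⟨e1, e2.agree ha (by omega), e3.agree ha (by omega), e4, by omega⟩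

theorem Holds.lt_iff {n : ℕ} {σ : State} {r : ℕ} {l : List Piece} (h : Holds n σ r l) :
    σ 8 r < σ 9 r ↔ l ≠ [] := by
  cases l with
  | nil => simp [show σ 9 r = σ 8 r from h]
  | cons P l => simp [h.2.2.2.1]; omega

theorem Holds.headWt {n : ℕ} {σ : State} {r : ℕ} {l : List Piece} (h : Holds n σ r l)
    (hl : l ≠ []) : σ 10 r = headWt l := by
  cases l with
  | nil => exact absurd rfl hl
  | cons P l => exact h.1

theorem Holds.headRow {n : ℕ} {σ : State} {r : ℕ} {l : List Piece} (h : Holds n σ r l)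
    (hl : l ≠ []) : RowIs n σ (σ 8 r) (headSet l) ∧ σ 8 r < σ 13 0 := by
  cases l with
  | nil => exact absurd rfl hl
  | cons P l => exact ⟨h.2.1, by have := h.2.2.2; omega⟩

theorem Holds.consume {n : ℕ} {σ τ : State} {r δ : ℕ} {l : List Piece} (h : Holds n σ r l)
    (hl : l ≠ []) (ha : AgreeBelow n (σ 13 0) σ τ) (h9 : τ 9 r = σ 9 r) (h13 : σ 13 0 ≤ τ 13 0)
    (h8 : τ 8 r = if σ 10 r ≤ δ then σ 8 r + 1 else σ 8 r)
    (h10 : τ 10 r = if σ 10 r ≤ δ then τ 11 (σ 8 r + 1) else σ 10 r - δ) :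
    Holds n τ r (consume δ l) := by
  cases l with
  | nil => exact absurd rfl hl
  | cons P l =>
    obtain ⟨e1, e2, e3, e4, e5⟩ := h
    rw [e1] at h8 h10
    rw [BuoyColoring.consume]
    split_ifs at h8 h10 ⊢ with hδ
    · cases l with
      | nil =>
        simp only [Holds, h8, h9, e4]
        simp
      | cons P' l =>
        simp only [List.length_cons] at e4
        have e3' := e3.agree ha (by simp only [List.length_cons]; omega)
        simp only [Holds, h8, h9, h10]
        exact ⟨e3'.1, e3'.2.1, e3'.2.2, by omega, by omega⟩
    · simp only [Holds, h8, h9, h10]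
      exact ⟨trivial, e2.agree ha (by omega), e3.agree ha (by omega), e4, by omega⟩

open scoped Classical in
/-- The memory holds the graph `g`, its degrees and the pieces `L r` of its vertices. -/
structure Mem (g : SimpleGraph ℕ) (n : ℕ) (L : ℕ → List Piece) (σ : State) : Prop where
  size : σ 0 0 = n
  adj : ∀ i < n, ∀ j < n, σ 1 (i * n + j) = if g.Adj i j then 1 else 0
  deg : ∀ v < n, σ 6 v = degIn g (Finset.range n) v
  holds : ∀ r < n, Holds n σ r (L r)
  fresh : ∀ k, σ 13 0 ≤ k → ∀ x < n, σ 12 (k * n + x) = 0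

theorem Mem.frame {g : SimpleGraph ℕ} {n : ℕ} {L : ℕ → List Piece} {σ τ : State}
    (h : Mem g n L σ) {l : List ℕ} (hF : Frame l σ τ)
    (hl : ∀ a ∈ [0, 1, 6, 8, 9, 10, 11, 12, 13], a ∉ l) : Mem g n L τ := by
  have e0 : τ 0 = σ 0 := hF 0 (hl 0 (by simp))
  have e1 : τ 1 = σ 1 := hF 1 (hl 1 (by simp))
  have e6 : τ 6 = σ 6 := hF 6 (hl 6 (by simp))
  have e8 : τ 8 = σ 8 := hF 8 (hl 8 (by simp))
  have e9 : τ 9 = σ 9 := hF 9 (hl 9 (by simp))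
  have e10 : τ 10 = σ 10 := hF 10 (hl 10 (by simp))
  have e11 : τ 11 = σ 11 := hF 11 (hl 11 (by simp))
  have e12 : τ 12 = σ 12 := hF 12 (hl 12 (by simp))
  have e13 : τ 13 = σ 13 := hF 13 (hl 13 (by simp))
  refine ⟨by rw [e0]; exact h.size, by rw [e1]; exact h.adj, by rw [e6]; exact h.deg, ?_,
    by rw [e12, e13]; exact h.fresh⟩
  exact fun r hr => (h.holds r hr).agree ⟨by simp [e11], by simp [e12]⟩ (by rw [e8]) (by rw [e9])
    (by rw [e10]) (by rw [e13])

theorem Seg.frame {n : ℕ} {σ τ : State} {k : ℕ} {O : List Piece} (h : Seg n σ k O) {l : List ℕ}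
    (hF : Frame l σ τ) (hl : ∀ a ∈ [11, 12], a ∉ l) : Seg n τ k O :=
  h.agree (m := k + O.length) ⟨by simp [hF 11 (hl 11 (by simp))], by simp [hF 12 (hl 12 (by simp))]⟩
    le_rfl

/-- Take the weight in the variable `34` away from the first pieces of the selected vertices. -/
def emitUpdate : Prog :=
  forTo 30 0 (.ite (.read 15 (var 30))
    (.seq (.assign 10 (var 30) (.op .sub (.read 10 (var 30)) (var 34)))
      (.ite (.read 10 (var 30)) .skip
        (.seq (.assign 8 (var 30) (.op .add (.read 8 (var 30)) (.const 1)))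
          (.assign 10 (var 30) (.read 11 (.read 8 (var 30))))))) .skip)

theorem run_emitUpdate {B n : ℕ} {σ : State} (hn : σ 0 0 = n) {S : Finset ℕ}
    (hS : ∀ u < n, σ 15 u = if u ∈ S then 1 else 0) (hnB : n + 1 ≤ B)
    (hB : ∀ u ∈ S, σ 8 u + 1 ≤ B ∧ σ 10 u ≤ B) :
    Run B emitUpdate σ fun t τ => t ≤ 100 * (n + 1) ∧ Frame [8, 10, 30] σ τ ∧
      (∀ u < n, τ 8 u = if u ∈ S ∧ σ 10 u ≤ σ 34 0 then σ 8 u + 1 else σ 8 u) ∧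
      ∀ u < n, τ 10 u = if u ∈ S then
        (if σ 10 u ≤ σ 34 0 then σ 11 (σ 8 u + 1) else σ 10 u - σ 34 0) else σ 10 u := by
  refine (run_forTo' (N := n) (fun k ρ => Frame [8, 10, 30] σ ρ ∧
    (∀ u < n, ρ 8 u = if u < k ∧ u ∈ S ∧ σ 10 u ≤ σ 34 0 then σ 8 u + 1 else σ 8 u) ∧
    ∀ u < n, ρ 10 u = if u < k ∧ u ∈ S then
      (if σ 10 u ≤ σ 34 0 then σ 11 (σ 8 u + 1) else σ 10 u - σ 34 0) else σ 10 u) 60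
    (by decide) (by omega) hn ?_ ?_).mono ?_
  · exact ⟨(Frame.refl _ _).store (by simp), by simp, by simp⟩
  · rintro k ρ hk hρk hρn ⟨hF, h8, h10⟩
    have e15 : ρ 15 = σ 15 := hF 15 (by decide)
    have e34 : ρ 34 = σ 34 := hF 34 (by decide)
    have e11 : ρ 11 = σ 11 := hF 11 (by decide)
    have k8 := h8 k hk
    have k10 := h10 k hk
    simp only [lt_irrefl, false_and, if_false] at k8 k10
    have hlt : ∀ {u}, u ≠ k → (u ≤ k ↔ u < k) := fun h => by omega
    by_cases hkS : k ∈ S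
    · obtain ⟨hB1, hB2⟩ := hB k hkS
      by_cases hle : σ 10 k ≤ σ 34 0
      · have hz : σ 10 k - σ 34 0 = 0 := by omega
        simp [hρk, hρn, e15, e34, e11, hS k hk, hkS, k8, k10, hz]
        refine ⟨⟨by omega, by omega⟩, ((((hF.store ?_).store ?_).store ?_).store ?_), ?_, ?_⟩
        any_goals simp
        · intro u hu
          by_cases huk : u = k
          · subst huk
            simp [hkS, hle]
          · simp [store_same, huk, h8 u hu, hlt huk]
        · intro u hu
          by_cases huk : u = k
          · subst huk
            simp [hkS, hle]
          · simp [store_same, huk, h10 u hu, hlt huk]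
      · have hz : σ 10 k - σ 34 0 ≠ 0 := by omega
        simp [hρk, hρn, e15, e34, hS k hk, hkS, k10, hz]
        refine ⟨by omega, ((hF.store ?_).store ?_), ?_, ?_⟩
        any_goals simp
        · intro u hu
          by_cases huk : u = k
          · subst huk
            simp [k8, hle]
          · simp [h8 u hu, hlt huk]
        · intro u hu
          by_cases huk : u = k
          · subst huk
            simp [hkS, hle]
          · simp [store_same, huk, h10 u hu, hlt huk]
    · simp [hρk, hρn, e15, hS k hk, hkS]
      refine ⟨hF.store (by simp), ?_, ?_⟩
      · intro u hu
        by_cases huk : u = k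
        · subst huk
          simp [k8, hkS]
        · simp [h8 u hu, hlt huk]
      · intro u hu
        by_cases huk : u = k
        · subst huk
          simp [k10, hkS]
        · simp [h10 u hu, hlt huk]
  · rintro t τ ⟨ht, ⟨hF, h8, h10⟩, -⟩
    refine ⟨by omega, hF, fun u hu => ?_, fun u hu => ?_⟩
    · simp [h8 u hu, hu]
    · simp [h10 u hu, hu]

/-- Emit the piece of the weight in the variable `34` that unites the first pieces of the selected
vertices. The variable `35` sums up the weights of the emitted pieces. -/
def emit : Prog :=
  .seq emitRow (.seq (.assign 11 (var 13) (var 34)) (.seq (set 13 (.op .add (var 13) (.const 1)))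
    (.seq emitUpdate (set 35 (.op .add (var 35) (var 34))))))

theorem run_emit {B n : ℕ} {σ : State} {g : SimpleGraph ℕ} {L : ℕ → List Piece} (hm : Mem g n L σ)
    {S : Finset ℕ} (hS : ∀ u < n, σ 15 u = if u ∈ S then 1 else 0)
    (hSn : ∀ u ∈ S, u < n ∧ L u ≠ []) {ns : ℕ} {O : List Piece} (hO : Seg n σ ns O)
    (hns : ns + O.length = σ 13 0) (hw : ∀ u ∈ S, headWt (L u) ≤ B)
    (hB : σ 13 0 * n + σ 13 0 + n + 2 ≤ B) (hB' : σ 35 0 + σ 34 0 ≤ B) :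
    Run B emit σ fun t τ => t ≤ 300 * (n + 1) + S.card * (100 * (n + 1)) ∧
      Frame [8, 10, 11, 12, 13, 30, 31, 35] σ τ ∧ Mem g n (serve L S (σ 34 0)) τ ∧
      Seg n τ ns (O ++ [unite L S (σ 34 0)]) ∧ τ 13 0 = σ 13 0 + 1 ∧
      τ 35 0 = σ 35 0 + σ 34 0 := by
  rw [emit, run_seq]
  refine (run_emitRow hm.size (fun r => headSet (L r)) hS (fun u hu => (hSn u hu).1)
    (fun u hu => (hm.holds u (hSn u hu).1).headRow (hSn u hu).2) (hm.fresh _ le_rfl)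
    (by omega)).mono ?_
  rintro t₁ ρ ⟨ht₁, hF, hT, hR⟩
  have e13 : ρ 13 = σ 13 := hF 13 (by decide)
  have e34 : ρ 34 = σ 34 := hF 34 (by decide)
  simp only [run_seq, run_assign, Expr.Fits, Expr.eval, Op.eval, Expr.cost, Nat.zero_le, true_and,
    e13, e34, store_ne (show 13 ≠ 11 by decide)]
  refine ⟨by omega, ?_⟩
  set ρ' := (ρ.store 11 (σ 13 0) (σ 34 0)).store 13 0 (σ 13 0 + 1) with hρ'
  have hF' : Frame [11, 12, 13, 30, 31] σ ρ' :=
    ((hF.weaken (by simp)).store (by simp)).store (by simp)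
  have f15 : ρ' 15 = σ 15 := hF' 15 (by decide)
  have f8 : ρ' 8 = σ 8 := hF' 8 (by decide)
  have f10 : ρ' 10 = σ 10 := hF' 10 (by decide)
  have f34 : ρ' 34 = σ 34 := hF' 34 (by decide)
  have f35 : ρ' 35 = σ 35 := hF' 35 (by decide)
  have f12 : ρ' 12 = ρ 12 := by simp [hρ']
  refine (run_emitUpdate (n := n) (S := S) (by rw [hF' 0 (by decide)]; exact hm.size)
    (by rw [f15]; exact hS) (by omega) ?_).mono ?_
  · intro u hu
    have := (hm.holds u (hSn u hu).1).headRow (hSn u hu).2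
    have := hw u hu
    rw [f8, f10, (hm.holds u (hSn u hu).1).headWt (hSn u hu).2]
    exact ⟨by omega, this⟩
  rintro t₂ τ ⟨ht₂, hF₂, h8, h10⟩
  rw [f34, f8, f10] at h8 h10
  have g35 : τ 35 = σ 35 := (hF₂ 35 (by decide)).trans f35
  have g34 : τ 34 = σ 34 := (hF₂ 34 (by decide)).trans f34
  simp only [g35, g34]
  refine ⟨hB', by omega, ?_⟩
  set τ' := τ.store 35 0 (σ 35 0 + σ 34 0) with hτ'
  have hFτ : Frame [8, 10, 11, 12, 13, 30, 31, 35] σ τ' :=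
    ((hF'.weaken (by simp)).trans hF₂ (by simp)).store (by simp)
  have k11 : τ' 11 = ρ' 11 := by
    rw [hτ', store_ne (by decide), hF₂ 11 (by decide)]
  have k12 : τ' 12 = ρ 12 := by
    rw [hτ', store_ne (by decide), hF₂ 12 (by decide), f12]
  have k13 : τ' 13 0 = σ 13 0 + 1 := by
    rw [hτ', store_ne (by decide), hF₂ 13 (by decide), hρ', store_eq]
  have k8 : τ' 8 = τ 8 := by
    rw [hτ', store_ne (by decide)]
  have k10 : τ' 10 = τ 10 := by
    rw [hτ', store_ne (by decide)]
  have k9 : τ' 9 = σ 9 := hFτ 9 (by decide)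
  have l11 : ∀ k, ρ' 11 k = if k = σ 13 0 then σ 34 0 else σ 11 k := by
    intro k
    rw [hρ', store_ne (by decide), store_same, hF 11 (by decide)]
  have hag : AgreeBelow n (σ 13 0) σ τ' := by
    refine ⟨fun k hk => ?_, fun k hk x hx => ?_⟩
    · rw [k11, l11, if_neg hk.ne]
    · rw [k12, hT k hk.ne x hx]
  refine ⟨hFτ, ⟨?_, ?_, ?_, ?_, ?_⟩, ?_, k13, by rw [hτ', store_eq]⟩
  · rw [hFτ 0 (by decide)]
    exact hm.size
  · rw [hFτ 1 (by decide)]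
    exact hm.adj
  · rw [hFτ 6 (by decide)]
    exact hm.deg
  · intro r hr
    have hh := hm.holds r hr
    have h8r := h8 r hr
    have h10r := h10 r hr
    rw [serve]
    split_ifs with hrS
    · refine hh.consume (hSn r hrS).2 hag (by rw [k9]) (by omega) ?_ ?_
      · rw [k8, h8r]
        simp [hrS]
      · rw [k10, h10r, k11]
        simp [hrS]
    · refine hh.agree hag ?_ (by rw [k9]) ?_ (by omega)
      · rw [k8, h8r]
        simp [hrS]
      · rw [k10, h10r]
        simp [hrS]
  · intro k hk x hx
    rw [k12, hT k (by omega) x hx]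
    exact hm.fresh k (by omega) x hx
  · refine (hO.agree hag hns.le).append ⟨?_, ?_, trivial⟩
    · rw [hns, k11, l11, if_pos rfl]
      rfl
    · rw [hns]
      intro x hx
      rw [k12, hR x hx]
      rfl

end WordRAM

/-! ### Selecting one vertex -/

namespace WordRAM

open BuoyColoring

/-- The entries of array `a` before position `n` are the characteristic vector of `S`. -/
def IsChar (n : ℕ) (σ : State) (a : ℕ) (S : Finset ℕ) : Prop :=
  ∀ u < n, σ a u = if u ∈ S then 1 else 0

/-- Put an available vertex of largest degree, plus one, in the variable `36`, or `0` if no vertex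
is available. -/
def argmax : Prog :=
  .seq (set 36 (.const 0)) (.seq (set 37 (.const 0)) (forTo 30 0
    (.ite (.read 14 (var 30))
      (.ite (.op .lt (var 37) (.op .add (.read 6 (var 30)) (.const 1)))
        (.seq (set 36 (.op .add (var 30) (.const 1)))
          (set 37 (.op .add (.read 6 (var 30)) (.const 1)))) .skip) .skip)))

theorem run_argmax {B n : ℕ} {σ : State} {A : Finset ℕ} (hn : σ 0 0 = n) (hA : IsChar n σ 14 A)
    (hAn : ∀ u ∈ A, u < n) (hB : n + 1 ≤ B) (hdeg : ∀ u < n, σ 6 u + 1 ≤ B) :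
    Run B argmax σ fun t τ => t ≤ 100 * (n + 1) ∧ Frame [30, 36, 37] σ τ ∧
      ((A = ∅ ∧ τ 36 0 = 0) ∨ ∃ r ∈ A, τ 36 0 = r + 1 ∧ ∀ u ∈ A, σ 6 u ≤ σ 6 r) := by
  simp only [argmax, run_seq, run_assign, Expr.Fits, Expr.eval, Expr.cost, Nat.zero_le, true_and]
  set σ' := (σ.store 36 0 0).store 37 0 0 with hσ'
  have hF₀ : Frame [30, 36, 37] σ σ' := ((Frame.refl _ _).store (by simp)).store (by simp)
  refine (run_forTo' (N := n) (fun k ρ => Frame [30, 36, 37] σ ρ ∧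
    ((ρ 36 0 = 0 ∧ ρ 37 0 = 0 ∧ ∀ u ∈ A, ¬ u < k) ∨ ∃ r ∈ A, ρ 36 0 = r + 1 ∧
      ρ 37 0 = σ 6 r + 1 ∧ ∀ u ∈ A, u < k → σ 6 u ≤ σ 6 r)) 40
    (by decide) (by omega) (by rw [hF₀ 0 (by decide), hn]) ?_ ?_).mono ?_
  · exact ⟨hF₀.store (by simp), Or.inl (by simp [hσ'])⟩
  · rintro k ρ hk hρk hρn ⟨hF, hI⟩
    have e14 : ρ 14 = σ 14 := hF 14 (by decide)
    have e6 : ρ 6 = σ 6 := hF 6 (by decide)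
    have hd := hdeg k hk
    by_cases hkA : k ∈ A
    · by_cases hlt : ρ 37 0 < σ 6 k + 1
      · have hlt' : ρ 37 0 ≤ σ 6 k := by omega
        simp [hρk, hρn, e14, e6, hA k hk, hkA, hlt']
        refine ⟨⟨by omega, by omega⟩, ⟨by omega, by omega⟩, ⟨by omega, by omega⟩, ((hF.store ?_).store ?_).store ?_, ?_⟩
        any_goals simp
        intro u hu huk
        rcases Nat.lt_succ_iff_lt_or_eq.1 (Nat.lt_succ_of_le huk) with h | rfl
        · rcases hI with ⟨-, -, h'⟩ | ⟨r, hr, -, h2, h3⟩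
          · exact absurd h (h' u hu)
          · have := h3 u hu h
            omega
        · exact le_rfl
      · have hlt' : ¬ ρ 37 0 ≤ σ 6 k := by omega
        simp [hρk, hρn, e14, e6, hA k hk, hkA, hlt']
        refine ⟨⟨by omega, by omega⟩, hF.store ?_, ?_⟩
        · simp
        rcases hI with ⟨-, h0, -⟩ | ⟨r, hr, h1, h2, h3⟩
        · omega
        · refine Or.inr ⟨r, hr, h1, h2, fun u hu huk => ?_⟩
          rcases Nat.lt_succ_iff_lt_or_eq.1 (Nat.lt_succ_of_le huk) with h | rfl
          · exact h3 u hu h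
          · omega
    · simp [hρk, hρn, e14, hA k hk, hkA]
      refine ⟨hF.store (by simp), ?_⟩
      have hlt : ∀ u ∈ A, (u ≤ k ↔ u < k) := by
        intro u hu
        have : u ≠ k := by
          rintro rfl
          exact hkA hu
        omega
      rcases hI with ⟨h1, h2, h3⟩ | ⟨r, hr, h1, h2, h3⟩
      · refine Or.inl ⟨h1, h2, fun u hu => ?_⟩
        have := hlt u hu
        have := h3 u hu
        omega
      · exact Or.inr ⟨r, hr, h1, h2, fun u hu h => h3 u hu ((hlt u hu).1 h)⟩
  · rintro t τ ⟨ht, ⟨hF, hI⟩, -⟩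
    refine ⟨by omega, hF, ?_⟩
    rcases hI with ⟨h1, -, h3⟩ | ⟨r, hr, h1, -, h3⟩
    · exact Or.inl ⟨Finset.eq_empty_of_forall_notMem fun u hu => h3 u hu (hAn u hu), h1⟩
    · exact Or.inr ⟨r, hr, h1, fun u hu => h3 u hu (hAn u hu)⟩

/-- Make the vertex in the variable `38` and its neighbours unavailable. -/
def block : Prog :=
  .seq (.assign 14 (var 38) (.const 0))
    (forTo 30 0 (.ite (.read 1 (.op .add (.op .mul (var 38) (var 0)) (var 30)))
      (.assign 14 (var 30) (.const 0)) .skip))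

/-- Select the vertex found by `argmax`, and make it and its neighbours unavailable. The variable
`34` is the least remaining weight of the first pieces of the selected vertices. -/
def pick : Prog :=
  .seq (set 38 (.op .sub (var 36) (.const 1))) (.seq (.assign 15 (var 38) (.const 1))
    (.seq (.ite (var 34)
        (.ite (.op .lt (.read 10 (var 38)) (var 34)) (set 34 (.read 10 (var 38))) .skip)
        (set 34 (.read 10 (var 38)))) block))

/-- The number `d` is the minimum of `f` over `S`, or `0` if `S` is empty. -/
def IsMinOn (f : ℕ → ℕ) (S : Finset ℕ) (d : ℕ) : Prop :=
  (∀ u ∈ S, d ≤ f u) ∧ (S = ∅ ∧ d = 0 ∨ 0 < d ∧ ∃ u ∈ S, d = f u)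

open scoped Classical in
theorem run_pick {B n : ℕ} {σ : State} {g : SimpleGraph ℕ} {A S : Finset ℕ} {r : ℕ}
    (hn : σ 0 0 = n) (hadj : ∀ i < n, ∀ j < n, σ 1 (i * n + j) = if g.Adj i j then 1 else 0)
    (hA : IsChar n σ 14 A) (hS : IsChar n σ 15 S) (hr : r < n) (hσr : σ 36 0 = r + 1)
    (hw : 0 < σ 10 r) (hmin : IsMinOn (σ 10) S (σ 34 0)) (hB : n * n + n + 1 ≤ B) :
    Run B pick σ fun t τ => t ≤ 100 * (n + 1) ∧ Frame [14, 15, 30, 34, 38] σ τ ∧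
      IsChar n τ 14 (A.filter fun u => u ≠ r ∧ ¬ g.Adj r u) ∧ IsChar n τ 15 (insert r S) ∧
      IsMinOn (σ 10) (insert r S) (τ 34 0) := by
  have key : ∀ (σ' : State) (d : ℕ), Frame [14, 15, 30, 34, 38] σ σ' →
      IsChar n σ' 14 A → IsChar n σ' 15 (insert r S) → σ' 38 0 = r →
      IsMinOn (σ 10) (insert r S) (σ' 34 0) → d ≤ 40 →
      Run B block σ' fun t τ => d + t ≤ 100 * (n + 1) ∧
      Frame [14, 15, 30, 34, 38] σ τ ∧
      IsChar n τ 14 (A.filter fun u => u ≠ r ∧ ¬ g.Adj r u) ∧ IsChar n τ 15 (insert r S) ∧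
      IsMinOn (σ 10) (insert r S) (τ 34 0) := by
    intro σ' d hF hA' hS' h38 hmin' hd
    simp only [block, run_seq, run_assign, Expr.Fits, Expr.eval, Expr.cost, Nat.zero_le, true_and, h38]
    refine (run_forTo' (N := n) (fun k ρ => Frame [14, 30] σ' ρ ∧
      ∀ u < n, ρ 14 u = if u ∈ A ∧ u ≠ r ∧ (u < k → ¬ g.Adj r u) then 1 else 0) 40
      (by decide) (by nlinarith) (by simp [hF 0 (by decide), hn]) ?_ ?_).mono ?_
    · refine ⟨((Frame.refl _ _).store (by simp)).store (by simp), fun u hu => ?_⟩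
      rw [store_ne (by decide), store_same, hA' u hu]
      by_cases hur : u = r <;> simp [hur]
    · rintro k ρ hk hρk hρn ⟨hFρ, hρ⟩
      have e1 : ρ 1 = σ 1 := (hFρ 1 (by decide)).trans (hF 1 (by decide))
      have e38 : ρ 38 0 = r := by rw [hFρ 38 (by decide), h38]
      have hlt := mul_add_lt hr hk
      by_cases hrk : g.Adj r k
      · simp [hρk, hρn, e1, e38, hadj r hr k hk, hrk]
        refine ⟨⟨by omega, by omega⟩, (hFρ.store (by simp)).store (by simp), fun u hu => ?_⟩
        rw [store_same]
        by_cases huk : u = k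
        · subst huk
          simp [hrk]
        · rw [if_neg huk, hρ u hu]
          refine if_congr ?_ rfl rfl
          rw [show u ≤ k ↔ u < k by omega]
      · simp [hρk, hρn, e1, e38, hadj r hr k hk, hrk]
        refine ⟨⟨by omega, by omega⟩, hFρ.store (by simp), fun u hu => ?_⟩
        rw [hρ u hu]
        refine if_congr ?_ rfl rfl
        by_cases huk : u = k
        · subst huk
          simp [hrk]
        · rw [show u ≤ k ↔ u < k by omega]
    · rintro t τ ⟨ht, ⟨hFτ, hτ⟩, -⟩
      refine ⟨by omega, hF.trans hFτ (by simp), fun u hu => ?_, fun u hu => ?_, ?_⟩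
      · rw [hτ u hu]
        simp [hu]
      · rw [hFτ 15 (by decide), hS' u hu]
      · rwa [hFτ 34 (by decide)]
  have hS' : ∀ u < n, (if u = r then 1 else σ 15 u) = if u ∈ insert r S then 1 else 0 := by
    intro u hu
    by_cases hur : u = r <;> simp [hur, hS u hu]
  have h1B : 1 ≤ B := by nlinarith
  have hrB : r ≤ B := by nlinarith
  obtain ⟨hmin1, hmin2⟩ := hmin
  -- the three ways to update the minimum
  have fin : ∀ (σ' : State) (d m : ℕ), σ' = ((σ.store 38 0 r).store 15 r 1).store 34 0 m →
      IsMinOn (σ 10) (insert r S) m → d ≤ 40 → Run B block σ' fun t τ => d + t ≤ 100 * (n + 1) ∧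
      Frame [14, 15, 30, 34, 38] σ τ ∧
      IsChar n τ 14 (A.filter fun u => u ≠ r ∧ ¬ g.Adj r u) ∧ IsChar n τ 15 (insert r S) ∧
      IsMinOn (σ 10) (insert r S) (τ 34 0) := by
    rintro σ' d m rfl hm hd
    refine key _ d ((((Frame.refl _ _).store ?_).store ?_).store ?_) ?_ ?_ ?_ ?_ hd
    any_goals simp
    · simpa [IsChar] using hA
    · simpa [IsChar, store_same] using hS'
    · simpa using hm
  have hself : ∀ x, (σ.store 38 0 r).store 15 r 1 =
      ((σ.store 38 0 r).store 15 r 1).store 34 0 x ↔ x = σ 34 0 := by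
    intro x
    constructor
    · intro h
      have := congrFun (congrFun h 34) 0
      simpa using this.symm
    · rintro rfl
      funext a i
      simp only [State.store]
      split_ifs with h1 h2 h3 <;> simp_all
  by_cases h0 : σ 34 0 = 0
  · have hS0 : S = ∅ := by
      rcases hmin2 with h | h
      · exact h.1
      · omega
    simp [pick, hσr, h0, h1B, hrB]
    refine (fin _ 30 (σ 10 r) rfl ⟨by simp [hS0], Or.inr ⟨hw, r, by simp, rfl⟩⟩ (by omega)).mono ?_
    exact fun t τ h => ⟨by omega, h.2⟩
  · have hS0 : 0 < σ 34 0 ∧ ∃ u ∈ S, σ 34 0 = σ 10 u := by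
      rcases hmin2 with h | h
      · exact absurd h.2 h0
      · exact h
    obtain ⟨hpos, u, hu, hmu⟩ := hS0
    by_cases hlt : σ 10 r < σ 34 0
    · simp [pick, hσr, h0, h1B, hrB, hlt]
      refine (fin _ 40 (σ 10 r) rfl ⟨?_, Or.inr ⟨hw, r, by simp, rfl⟩⟩ (by omega)).mono ?_
      · intro v hv
        rcases Finset.mem_insert.1 hv with rfl | hv
        · exact le_rfl
        · exact hlt.le.trans (hmin1 v hv)
      · exact fun t τ h => ⟨by omega, h.2⟩
    · simp [pick, hσr, h0, h1B, hrB, hlt, not_lt.1 hlt]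
      refine (fin _ 40 (σ 34 0) ((hself _).2 rfl) ⟨?_, Or.inr ⟨hpos, u, by simp [hu], hmu⟩⟩
        (by omega)).mono ?_
      · intro v hv
        rcases Finset.mem_insert.1 hv with rfl | hv
        · exact not_lt.1 hlt
        · exact hmin1 v hv
      · exact fun t τ h => ⟨by omega, h.2⟩

end WordRAM

/-! ### Greedy selection of a stable set -/

namespace WordRAM

open BuoyColoring

/-- The vertices with the label in the variable `39` that have pieces left become available. -/
def selectInit : Prog :=
  forTo 30 0 (.seq (.assign 14 (var 30) (.op .mul (.op .eq (.read 7 (var 30)) (var 39))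
    (.op .lt (.read 8 (var 30)) (.read 9 (var 30))))) (.assign 15 (var 30) (.const 0)))

/-- Select greedily, by decreasing degree, a maximal stable set of the vertices with the label in
the variable `39` that have pieces left. -/
def select : Prog :=
  .seq selectInit (.seq (set 34 (.const 0)) (.seq (set 36 (.const 1))
    (.loop (var 36) (.seq argmax (.ite (var 36) pick .skip)))))

variable {B n : ℕ} {σ : State} {g : SimpleGraph ℕ} {L : ℕ → List Piece}

theorem run_selectInit (hm : Mem g n L σ) {Y : Finset ℕ}
    (hY : ∀ u, u ∈ Y ↔ u < n ∧ σ 7 u = σ 39 0 ∧ L u ≠ []) (hB : n + 1 ≤ B) :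
    Run B selectInit σ fun t τ => t ≤ 50 * (n + 1) ∧ Frame [14, 15, 30] σ τ ∧ IsChar n τ 14 Y ∧
      IsChar n τ 15 ∅ := by
  refine (run_forTo' (N := n) (fun k ρ => Frame [14, 15, 30] σ ρ ∧
    (∀ u < k, ρ 14 u = if u ∈ Y then 1 else 0) ∧ ∀ u < k, ρ 15 u = 0) 30
    (by decide) (by omega) hm.size ?_ ?_).mono ?_
  · exact ⟨(Frame.refl _ _).store (by simp), by simp, by simp⟩
  · rintro k ρ hk hρk hρn ⟨hF, h14, h15⟩
    have e7 : ρ 7 = σ 7 := hF 7 (by decide)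
    have e8 : ρ 8 = σ 8 := hF 8 (by decide)
    have e9 : ρ 9 = σ 9 := hF 9 (by decide)
    have e39 : ρ 39 = σ 39 := hF 39 (by decide)
    have hlt := (hm.holds k hk).lt_iff
    simp only [run_seq, run_assign, Expr.Fits, Expr.eval, Op.eval, Expr.cost, hρk, hρn, e7, e8, e9,
      e39, hlt, store_ne (show 30 ≠ 14 by decide), store_ne (show 30 ≠ 15 by decide),
      store_ne (show 0 ≠ 14 by decide), store_ne (show 0 ≠ 15 by decide)]
    have h1 : (if σ 7 k = σ 39 0 then 1 else 0) ≤ 1 := by split_ifs <;> omega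
    have h2 : (if L k ≠ [] then 1 else 0) ≤ 1 := by split_ifs <;> omega
    have h3 : (if σ 7 k = σ 39 0 then 1 else 0) * (if L k ≠ [] then 1 else 0) =
        if k ∈ Y then 1 else 0 := by
      simp only [hY, hk, true_and]
      split_ifs <;> simp_all
    have h4 : (if k ∈ Y then 1 else 0) ≤ 1 := by split_ifs <;> omega
    rw [h3]
    refine ⟨by omega, ⟨⟨by omega, by omega, by omega⟩, ⟨by omega, by omega, by omega⟩, by omega⟩,
      by omega, by omega, by omega, trivial, trivial, ?_, ?_, ?_⟩
    · exact ((hF.store (by simp)).store (by simp)).store (by simp)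
    · intro u hu
      rw [store_ne (by decide), store_ne (by decide), store_same]
      by_cases huk : u = k
      · rw [if_pos huk, huk]
      · rw [if_neg huk]
        exact h14 u (by omega)
    · intro u hu
      rw [store_ne (by decide), store_same, store_ne (by decide)]
      split_ifs with huk
      · rfl
      · exact h15 u (by omega)
  · rintro t τ ⟨ht, ⟨hF, h14, h15⟩, -⟩
    exact ⟨by omega, hF, h14, by simpa [IsChar] using h15⟩

theorem run_select (hm : Mem g n L σ) {X : Finset ℕ}
    (hX : ∀ u, u ∈ X ↔ u < n ∧ σ 7 u = σ 39 0)
    (hpos : ∀ u ∈ X, L u ≠ [] → 0 < headWt (L u)) (hB : n * n + 2 * n + 2 ≤ B) :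
    Run B select σ fun t τ => Frame [14, 15, 30, 34, 36, 37, 38] σ τ ∧ ∃ S : Finset ℕ,
      IsChar n τ 15 S ∧ IsGreedy g (degIn g (Finset.range n)) {v | v ∈ X ∧ L v ≠ []} S ∧
      IsMinOn (fun u => headWt (L u)) S (τ 34 0) ∧
      t ≤ 600 * (n + 1) + S.card * (300 * (n + 1)) := by
  classical
  set Y := X.filter fun u => L u ≠ [] with hYdef
  have hY : ∀ u, u ∈ Y ↔ u < n ∧ σ 7 u = σ 39 0 ∧ L u ≠ [] := by
    intro u
    rw [hYdef, Finset.mem_filter, hX, and_assoc]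
  have hYn : ∀ u ∈ Y, u < n := fun u hu => ((hY u).1 hu).1
  set f := degIn g (Finset.range n) with hf
  have hfn : ∀ u, f u ≤ n := by
    intro u
    refine (Finset.card_filter_le _ _).trans ?_
    simp
  have hnB : n + 1 ≤ B := by nlinarith
  rw [select, run_seq]
  refine (run_selectInit hm hY hnB).mono ?_
  rintro t₀ ρ₀ ⟨ht₀, hF₀, h14, h15⟩
  simp only [run_seq (p := set _ _), run_assign, Expr.Fits, Expr.eval, Expr.cost, Nat.zero_le,
    true_and]
  refine ⟨by omega, ?_⟩
  set σ' := (ρ₀.store 34 0 0).store 36 0 1 with hσ'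
  have hF' : Frame [14, 15, 30, 34, 36, 37, 38] σ σ' :=
    ((hF₀.weaken (by simp)).store (by simp)).store (by simp)
  let I : ℕ → State → Prop := fun s ρ => Frame [14, 15, 30, 34, 36, 37, 38] σ ρ ∧
    ∃ A S : Finset ℕ, IsChar n ρ 14 A ∧ IsChar n ρ 15 S ∧ A ⊆ Y ∧ S ⊆ Y ∧
      g.IsIndepSet (S : Set ℕ) ∧ (∀ v ∈ S, ∀ u ∈ A, u ≠ v ∧ ¬ g.Adj v u) ∧
      (∀ v ∈ Y, v ∉ A → v ∉ S → ∃ u ∈ S, g.Adj u v ∧ f v ≤ f u) ∧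
      IsMinOn (fun u => headWt (L u)) S (ρ 34 0) ∧ (ρ 36 0 = 0 → A = ∅) ∧
      s ≤ S.card * (300 * (n + 1)) + if ρ 36 0 = 0 then 300 * (n + 1) else 0
  refine (run_loop I (n * (300 * (n + 1)) + 300 * (n + 1)) ?_ ?_ ?_ ?_).mono ?_
  · refine ⟨hF', Y, ∅, by simpa [IsChar, hσ'] using h14, by simpa [IsChar, hσ'] using h15, le_rfl,
      by simp, by simp, by simp, fun v hv hv' => absurd hv hv', ⟨by simp, by simp [hσ']⟩,
      by simp [hσ'], Nat.zero_le _⟩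
  · rintro s ρ ⟨-, A, S, -, -, -, hSY, -, -, -, -, -, hs⟩
    have hc : S.card ≤ n := by
      have := Finset.card_le_card (fun u hu => Finset.mem_range.2 (hYn u (hSY hu)) :
        S ⊆ Finset.range n)
      simpa using this
    have := Nat.mul_le_mul_right (300 * (n + 1)) hc
    refine hs.trans (Nat.add_le_add this ?_)
    split_ifs
    · exact le_rfl
    · exact Nat.zero_le _
  · rintro s ρ -
    exact Nat.zero_le _
  · rintro s ρ ⟨hF, A, S, hA, hS, hAY, hSY, hind, hAS, hcov, hmin, h36, hs⟩ hne
    have hne : ρ 36 0 ≠ 0 := hne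
    rw [if_neg hne] at hs
    have e6 : ∀ u < n, ρ 6 u = f u := by
      intro u hu
      rw [hF 6 (by decide), hm.deg u hu]
    rw [run_seq]
    refine (run_argmax (A := A) (n := n) (by rw [hF 0 (by decide), hm.size]) hA
      (fun u hu => hYn u (hAY hu)) hnB ?_).mono ?_
    · intro u hu
      rw [e6 u hu]
      have := hfn u
      omega
    rintro t₁ ρ₁ ⟨ht₁, hF₁, hcase⟩
    have g34 : ρ₁ 34 = ρ 34 := hF₁ 34 (by decide)
    have g14 : ρ₁ 14 = ρ 14 := hF₁ 14 (by decide)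
    have g15 : ρ₁ 15 = ρ 15 := hF₁ 15 (by decide)
    have hFσ : Frame [14, 15, 30, 34, 36, 37, 38] σ ρ₁ := hF.trans hF₁ (by simp)
    rw [run_ite, run_skip]
    refine ⟨Nat.zero_le _, fun hr => ?_, fun hr => ?_⟩
    · have hr : ρ₁ 36 0 ≠ 0 := hr
      obtain ⟨r, hrA, h36, hmax⟩ : ∃ r ∈ A, ρ₁ 36 0 = r + 1 ∧ ∀ u ∈ A, ρ 6 u ≤ ρ 6 r := by
        rcases hcase with h | h
        · exact absurd h.2 hr
        · exact h
      have hrn := hYn r (hAY hrA)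
      have hrL : L r ≠ [] := ((hY r).1 (hAY hrA)).2.2
      have e10 : ∀ u ∈ Y, ρ₁ 10 u = headWt (L u) := by
        intro u hu
        rw [hFσ 10 (by decide)]
        exact (hm.holds u (hYn u hu)).headWt ((hY u).1 hu).2.2
      have hminY : ∀ {S : Finset ℕ} {d}, S ⊆ Y →
          (IsMinOn (ρ₁ 10) S d ↔ IsMinOn (fun u => headWt (L u)) S d) := by
        intro S d hSY
        unfold IsMinOn
        refine and_congr (forall₂_congr fun u hu => by rw [e10 u (hSY hu)])
          (or_congr Iff.rfl (and_congr Iff.rfl (exists_congr fun u => ?_)))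
        exact and_congr_right fun hu => by rw [e10 u (hSY hu)]
      refine (run_pick (A := A) (S := S) (g := g) (r := r) (n := n)
        (by rw [hFσ 0 (by decide), hm.size]) (by rw [hFσ 1 (by decide)]; exact hm.adj)
        (by simpa [IsChar, g14] using hA) (by simpa [IsChar, g15] using hS) hrn h36
        (by rw [e10 r (hAY hrA)]; exact hpos r (Finset.mem_of_mem_filter r (hAY hrA)) hrL)
        (by rw [g34]; exact (hminY hSY).2 hmin) (by omega)).mono ?_
      rintro t₂ τ ⟨ht₂, hF₂, hA₂, hS₂, hmin₂⟩
      have hrS : r ∉ S := fun h => (hAS r h r hrA).1 rfl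
      have hins : insert r S ⊆ Y := Finset.insert_subset (hAY hrA) hSY
      refine ⟨hFσ.trans hF₂ (by simp), _, _, hA₂, hS₂, (Finset.filter_subset _ _).trans hAY, hins,
        ?_, ?_, ?_, (hminY hins).1 hmin₂, ?_, ?_⟩
      · rw [Finset.coe_insert]
        refine Set.Pairwise.insert hind fun v hv _ => ?_
        have := (hAS v hv r hrA).2
        exact ⟨fun h => this h.symm, this⟩
      · intro v hv u hu
        simp only [Finset.mem_filter] at hu
        rcases Finset.mem_insert.1 hv with rfl | hv
        · exact hu.2
        · exact hAS v hv u hu.1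
      · intro v hv hvA hvS
        rw [Finset.mem_insert, not_or] at hvS
        by_cases hv' : v ∈ A
        · have hadj : g.Adj r v := by
            by_contra h
            exact hvA (by simp [hv', hvS.1, h])
          have := hmax v hv'
          rw [e6 v (hYn v hv), e6 r hrn] at this
          exact ⟨r, by simp, hadj, this⟩
        · obtain ⟨u, hu, h⟩ := hcov v hv hv' hvS.2
          exact ⟨u, by simp [hu], h⟩
      · rw [hF₂ 36 (by decide)]
        exact fun h => absurd h hr
      · rw [hF₂ 36 (by decide), if_neg hr, Finset.card_insert_of_notMem hrS, add_mul, one_mul]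
        simp only [Expr.cost]
        omega
    · have hr : ρ₁ 36 0 = 0 := hr
      have hA0 : A = ∅ := by
        rcases hcase with h | ⟨r, -, h, -⟩
        · exact h.1
        · omega
      refine ⟨hFσ, A, S, by simpa [IsChar, g14] using hA, by simpa [IsChar, g15] using hS, hAY, hSY,
        hind, hAS, hcov, by rwa [g34], fun _ => hA0, ?_⟩
      rw [if_pos hr]
      simp only [Expr.cost]
      omega
  · rintro t τ ⟨s, rfl, ⟨hF, A, S, hA, hS, hAY, hSY, hind, hAS, hcov, hmin, h36, hs⟩, hz⟩
    have hz : τ 36 0 = 0 := hz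
    have hA0 := h36 hz
    rw [if_pos hz] at hs
    refine ⟨hF, S, hS, ⟨?_, hind, ?_⟩, hmin, ?_⟩
    · intro r hr
      exact Finset.mem_filter.1 (hSY hr)
    · intro v hv hvS
      exact hcov v (Finset.mem_filter.2 hv) (by simp [hA0]) hvS
    · simp only [Expr.cost]
      omega

end WordRAM

/-! ### Greedy merging in memory -/

namespace WordRAM

open BuoyColoring

/-- Merge the pieces of the vertices with the label in the variable `39` greedily. The variable
`40` is the position of the first new piece. -/
def greedyMerge : Prog :=
  .seq (set 40 (var 13)) (.seq (set 35 (.const 0)) (.seq (set 47 (.const 1))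
    (.loop (var 47) (.seq select (.ite (var 34) emit (set 47 (.const 0)))))))

variable {B n W : ℕ} {σ : State} {g : SimpleGraph ℕ} {w : ℕ → ℕ} {L₀ : ℕ → List Piece}

theorem wsum_le_length_mul {l : List Piece} (h : ∀ P ∈ l, P.2 ≤ W) : wsum l ≤ l.length * W := by
  induction l with
  | nil => simp
  | cons P l ih =>
    have h1 := h P (by simp)
    have h2 := ih fun P hP => h P (by simp [hP])
    simp only [wsum_cons, List.length_cons, add_mul, one_mul]
    omega

theorem headWt_le_of_forall {l : List Piece} (h : ∀ P ∈ l, P.2 ≤ W) : headWt l ≤ W := by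
  cases l with
  | nil => exact Nat.zero_le _
  | cons P l => exact h P (by simp)

theorem headWt_pos_of_forall {l : List Piece} (h : ∀ P ∈ l, 0 < P.2) (hl : l ≠ []) :
    0 < headWt l := by
  cases l with
  | nil => exact absurd rfl hl
  | cons P l => exact h P (by simp)

/-- The arrays and variables used in merging. -/
abbrev mergeFrame : List ℕ := [8, 10, 11, 12, 13, 14, 15, 30, 31, 34, 35, 36, 37, 38, 40, 47]

/-- Each round uses up at least one piece, so there are at most `pieces X L₀ + 1` rounds. A round
takes time `O(n)` for each selected vertex, whence the factor for the number of vertices with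
pieces. -/
theorem run_greedyMerge (hm : Mem g n L₀ σ) (hs : Stage g n W w L₀) {X : Finset ℕ}
    (hX : ∀ u, u ∈ X ↔ u < n ∧ σ 7 u = σ 39 0)
    (hperf : IsPerfectOrder g (degIn g (Finset.range n)) {v | v ∈ X ∧ L₀ v ≠ []})
    (hB : (σ 13 0 + pieces X L₀ + n + 2) * (n + 2) ≤ B) (hBW : (pieces X L₀ + 2) * W ≤ B) :
    Run B greedyMerge σ fun t τ => Frame mergeFrame σ τ ∧
      t ≤ (pieces X L₀ + 2) * (((X.filter fun r => L₀ r ≠ []).card + 1) * (1000 * (n + 1))) ∧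
      ∃ L O, Mem g n L τ ∧ Merging g W X L₀ L O ∧ (∀ r ∈ X, L r = []) ∧
        CliqueBound g X L₀ L O ∧ τ 40 0 = σ 13 0 ∧ Seg n τ (σ 13 0) O ∧
        σ 13 0 + O.length = τ 13 0 ∧ O.length ≤ pieces X L₀ ∧ τ 35 0 = wsum O := by
  set f := degIn g (Finset.range n) with hf
  set C := ((X.filter fun r => L₀ r ≠ []).card + 1) * (1000 * (n + 1)) with hC
  have hexp : ∀ a b : ℕ, a + b = σ 13 0 + pieces X L₀ → a * n + 2 * a + n * n + 2 * n + 4 ≤ B := by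
    intro a b hab
    have : (a + n + 2) * (n + 2) ≤ (σ 13 0 + pieces X L₀ + n + 2) * (n + 2) :=
      Nat.mul_le_mul_right _ (by omega)
    nlinarith
  have hbase := hexp (σ 13 0) _ rfl
  have hwle : ∀ {L O}, Merging g W X L₀ L O → ∀ r ∈ X, headWt (L r) ≤ W := fun h r hr =>
    headWt_le_of_forall fun P hP => (h.old r hr P hP).1.2
  simp only [greedyMerge, run_seq (p := set _ _), run_assign, Expr.Fits, Expr.eval, Expr.cost,
    Nat.zero_le, true_and]
  refine ⟨by nlinarith, ?_⟩
  set σ' := ((σ.store 40 0 (σ 13 0)).store 35 0 0).store 47 0 1 with hσ'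
  have hF' : Frame mergeFrame σ σ' :=
    (((Frame.refl _ _).store (by simp)).store (by simp)).store (by simp)
  have hFm : Frame [40, 35, 47] σ σ' :=
    (((Frame.refl _ _).store (by simp)).store (by simp)).store (by simp)
  let I : ℕ → State → Prop := fun s ρ => Frame mergeFrame σ ρ ∧ ∃ L O, Mem g n L ρ ∧
    Merging g W X L₀ L O ∧ CliqueBound g X L₀ L O ∧ ρ 40 0 = σ 13 0 ∧ Seg n ρ (σ 13 0) O ∧
    σ 13 0 + O.length = ρ 13 0 ∧ O.length + pieces X L ≤ pieces X L₀ ∧ ρ 35 0 = wsum O ∧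
    (ρ 47 0 = 0 → ∀ r ∈ X, L r = []) ∧
    s + pieces X L * C ≤ pieces X L₀ * C + if ρ 47 0 = 0 then C else 0
  refine (run_loop I (pieces X L₀ * C + C) ?_ ?_ ?_ ?_).mono ?_
  · refine ⟨hF', L₀, [], hm.frame hFm (by decide), hs.merging X, .refl L₀, ?_, trivial, ?_, ?_, ?_,
      ?_, ?_⟩ <;> simp [hσ']
  · rintro s ρ ⟨-, L, O, -, -, -, -, -, -, -, -, -, hs⟩
    refine (Nat.le_add_right _ _).trans (hs.trans (Nat.add_le_add_left ?_ _))
    split_ifs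
    · exact le_rfl
    · exact Nat.zero_le _
  · exact fun _ _ _ => Nat.zero_le _
  · rintro s ρ ⟨hF, L, O, hmem, hmer, hcb, h40, hseg, hlen, hpc, h35, h47, hst⟩ hne
    have hne : ρ 47 0 ≠ 0 := hne
    rw [if_neg hne, add_zero] at hst
    rw [run_seq]
    refine (run_select hmem (X := X) ?_ ?_ ?_).mono ?_
    · intro u
      rw [hF 7 (by decide), hF 39 (by decide), hX]
    · exact fun u hu hL => headWt_pos_of_forall (fun P hP => (hmer.old u hu P hP).1.1) hL
    · omega
    rintro t₁ ρ₁ ⟨hF₁, S, hS, hgr, hmin, ht₁⟩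
    have hmem₁ := hmem.frame hF₁ (by decide)
    have hseg₁ := hseg.frame hF₁ (by decide)
    have hFσ : Frame mergeFrame σ ρ₁ := hF.trans hF₁ (by simp)
    have g13 : ρ₁ 13 = ρ 13 := hF₁ 13 (by decide)
    have g35 : ρ₁ 35 = ρ 35 := hF₁ 35 (by decide)
    have g40 : ρ₁ 40 = ρ 40 := hF₁ 40 (by decide)
    have g47 : ρ₁ 47 = ρ 47 := hF₁ 47 (by decide)
    have hSX : S ⊆ X := fun r hr => (hgr.1 r hr).1
    have hScard : S.card ≤ (X.filter fun r => L₀ r ≠ []).card := by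
      refine Finset.card_le_card fun r hr => Finset.mem_filter.2 ⟨hSX hr, ?_⟩
      exact hmer.ne_nil (hgr.1 r hr).2
    have hround :
        1000 * (n + 1) + (S.card * (300 * (n + 1)) + S.card * (100 * (n + 1))) ≤ C := by
      rw [hC]
      nlinarith
    rw [run_ite, run_assign]
    refine ⟨Nat.zero_le _, fun hd => ?_, fun hd => ?_⟩
    · have hd : ρ₁ 34 0 ≠ 0 := hd
      obtain ⟨hmin1, hmin2⟩ := hmin
      obtain ⟨hpos, u, hu, hmu⟩ : 0 < ρ₁ 34 0 ∧ ∃ u ∈ S, ρ₁ 34 0 = headWt (L u) := by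
        rcases hmin2 with h | h
        · exact absurd h.2 hd
        · exact h
      have hdW : ρ₁ 34 0 ≤ W := hmu ▸ hwle hmer u (hSX hu)
      have hpl := pieces_serve_lt hu (hSX hu) (hgr.1 u hu).2 hmu.symm.le
      have hOW := wsum_le_length_mul fun P hP => (hmer.pos P hP).2
      have hOW' : O.length * W + W ≤ B := by
        refine le_trans ?_ hBW
        have : O.length + 1 ≤ pieces X L₀ + 2 := by omega
        calc O.length * W + W = (O.length + 1) * W := by ring
          _ ≤ _ := Nat.mul_le_mul_right _ this
      have hWB : W ≤ B := by omega
      have hnp := hexp (ρ 13 0) (pieces X L₀ - O.length) (by omega)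
      refine (run_emit hmem₁ hS (fun v hv => ⟨((hX v).1 (hSX hv)).1, (hgr.1 v hv).2⟩) hseg₁
        (by rw [g13, hlen]) (fun v hv => (hwle hmer v (hSX hv)).trans hWB) ?_ ?_).mono ?_
      · rw [g13]
        omega
      · rw [g35, h35]
        omega
      rintro t₂ τ ⟨ht₂, hF₂, hmem₂, hseg₂, h13, h35'⟩
      have k47 : τ 47 0 = ρ 47 0 := by rw [hF₂ 47 (by decide), g47]
      refine ⟨hFσ.trans hF₂ (by simp), _, _, hmem₂, hmer.serve hs hSX hgr.2.1 ⟨hpos, hdW⟩ hmin1,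
        hcb.serve hperf (fun v hv hL => ⟨hv, hmer.ne_nil hL⟩) hSX hgr ⟨u, hu⟩ hmin1,
        by rw [hF₂ 40 (by decide), g40, h40], hseg₂, ?_, ?_, ?_, ?_, ?_⟩
      · rw [h13, g13, List.length_append, List.length_singleton]
        omega
      · rw [List.length_append, List.length_singleton]
        omega
      · rw [h35', g35, h35, wsum_append]
        simp [unite]
      · rw [k47]
        exact fun h => absurd h hne
      · rw [k47, if_neg hne, add_zero]
        have := Nat.mul_le_mul_right C hpl
        rw [add_mul, one_mul] at this
        simp only [Expr.cost]
        omega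
    · have hd : ρ₁ 34 0 = 0 := hd
      have hS0 : S = ∅ := by
        rcases hmin.2 with h | h
        · exact h.1
        · omega
      refine ⟨Nat.zero_le _, ?_, ?_⟩
      · simp only [Expr.Fits]
        omega
      simp only [Expr.eval, Expr.cost]
      refine ⟨hFσ.store (by simp), L, O, hmem₁.frame ((Frame.refl [47] _).store (by simp)) (by decide),
        hmer, hcb, by simp [g40, h40], hseg₁.frame ((Frame.refl [47] _).store (by simp)) (by decide),
        by simp [g13, hlen], hpc, by simp [g35, h35], fun _ r hr => ?_, ?_⟩
      · by_contra hL
        obtain ⟨u, hu, -⟩ := hgr.2.2 r ⟨hr, hL⟩ (by simp [hS0])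
        simp [hS0] at hu
      · rw [store_eq, if_pos rfl]
        omega
  · rintro t τ ⟨s, rfl, ⟨hF, L, O, hmem, hmer, hcb, h40, hseg, hlen, hpc, h35, h47, hst⟩, hz⟩
    have hz : τ 47 0 = 0 := hz
    rw [if_pos hz] at hst
    refine ⟨hF, ?_, L, O, hmem, hmer, h47 hz, hcb, h40, hseg, hlen, by omega, h35⟩
    have h1000 : 1000 ≤ C := by
      rw [hC]
      nlinarith
    have h0 : pieces X L = 0 := Finset.sum_eq_zero fun r hr => by rw [h47 hz r hr, List.length_nil]
    rw [h0] at hst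
    simp only [Expr.cost]
    rw [add_mul]
    omega

/-- The vertex `i` takes over the new pieces from position `σ 40 0` on. -/
def handOver (i : Expr) : Prog :=
  .seq (.assign 8 i (var 40)) (.seq (.assign 9 i (var 13)) (.assign 10 i (.read 11 (var 40))))

theorem Mem.handOver {L L₀ : ℕ → List Piece} {O : List Piece} {X : Finset ℕ} {r₀ : ℕ}
    (hm : Mem g n L σ) (hL : ∀ r ∈ X, L r = []) (hL₀ : ∀ r ∉ X, L r = L₀ r)
    {ns : ℕ} (hO : Seg n σ ns O) (hns : ns + O.length = σ 13 0) :
    Mem g n (contract X r₀ O L₀)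
      (((σ.store 8 r₀ ns).store 9 r₀ (σ 13 0)).store 10 r₀ (σ 11 ns)) := by
  refine ⟨by simpa using hm.size, by simpa using hm.adj, by simpa using hm.deg, fun r hr => ?_,
    by simpa using hm.fresh⟩
  set τ := ((σ.store 8 r₀ ns).store 9 r₀ (σ 13 0)).store 10 r₀ (σ 11 ns) with hτ
  have hag : ∀ m, AgreeBelow n m σ τ := fun m => ⟨by simp [hτ], by simp [hτ]⟩
  rw [contract]
  split_ifs with h1 h2
  · subst h1
    cases O with
    | nil =>
      simp only [Holds, hτ]
      simpa using hns.symm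
    | cons P l =>
      simp only [List.length_cons] at hns
      obtain ⟨e1, e2, e3⟩ := hO.agree (hag _) le_rfl
      obtain ⟨e4, -⟩ := hO
      have t8 : τ 8 r = ns := by simp [hτ]
      refine ⟨by simp [hτ, e4], by rwa [t8], by rwa [t8], ?_, ?_⟩
      · rw [t8]
        simp [hτ]
        omega
      · simp [hτ]
  · have := hm.holds r hr
    rw [hL r h2] at this
    exact this.agree (hag _) (by simp [hτ, store_same, h1]) (by simp [hτ, store_same, h1])
      (by simp [hτ, store_same, h1]) (by simp [hτ])
  · have := hm.holds r hr
    rw [hL₀ r h2] at this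
    exact this.agree (hag _) (by simp [hτ, store_same, h1]) (by simp [hτ, store_same, h1])
      (by simp [hτ, store_same, h1]) (by simp [hτ])

end WordRAM

/-! ### Coloring a weighted five-cycle -/

namespace WordRAM

open BuoyColoring

/-- Run `p 0`, …, `p 4` one after the other. -/
def five (p : Fin 5 → Prog) : Prog :=
  .seq (p 0) (.seq (p 1) (.seq (p 2) (.seq (p 3) (p 4))))

theorem run_five {B : ℕ} {σ : State} {p : Fin 5 → Prog} (I : ℕ → ℕ → State → Prop) (h0 : I 0 0 σ)
    (step : ∀ (i : Fin 5) s ρ, I i s ρ → Run B (p i) ρ fun t τ => I (i + 1) (s + t) τ) :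
    Run B (five p) σ fun t τ => I 5 t τ := by
  simp only [five, run_seq]
  refine (step 0 0 σ h0).mono fun t₀ ρ₀ h => (step 1 _ ρ₀ h).mono fun t₁ ρ₁ h =>
    (step 2 _ ρ₁ h).mono fun t₂ ρ₂ h => (step 3 _ ρ₂ h).mono fun t₃ ρ₃ h =>
    (step 4 _ ρ₃ h).mono fun t₄ ρ₄ h => ?_
  rw [show t₀ + (t₁ + (t₂ + (t₃ + t₄))) = 0 + t₀ + t₁ + t₂ + t₃ + t₄ by omega]
  exact h

/-- The entry `i` of array `a`. -/
abbrev entry (a : ℕ) (i : Fin 5) : Expr := .read a (.const i.val)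

/-- Put in the variable `45` the sum of the entries `x i` of array `22`, and in the variable `44`
the maximum of half of this sum, rounded up, and all `x i + x (i + 1)`. -/
def cycleBound : Prog :=
  .seq (set 45 (.const 0)) (.seq (five fun i => set 45 (.op .add (var 45) (entry 22 i)))
    (.seq (set 44 (.op .div (.op .add (var 45) (.const 1)) (.const 2)))
      (five fun i => set 44 (.op .add (var 44)
        (.op .sub (.op .add (entry 22 i) (entry 22 (i + 1))) (var 44))))))

theorem sum_filter_lt_succ (x : Fin 5 → ℕ) (i : Fin 5) :
    ∑ j with j.val < i.val + 1, x j = ∑ j with j.val < i.val, x j + x i := by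
  have : (Finset.univ.filter fun j : Fin 5 => j.val < i.val + 1) =
      insert i (Finset.univ.filter fun j : Fin 5 => j.val < i.val) := by
    ext j
    simp only [Finset.mem_filter, Finset.mem_univ, true_and, Finset.mem_insert, Fin.ext_iff]
    omega
  rw [this, Finset.sum_insert (by simp), add_comm]

theorem pair_le_sum (x : Fin 5 → ℕ) (i : Fin 5) : x i + x (i + 1) ≤ ∑ j, x j := by
  rw [Fin.sum_univ_five]
  fin_cases i <;> simp <;> omega

/-- The variable `44` gets the smallest number that satisfies both of the lower bounds. -/
theorem run_cycleBound {B : ℕ} {σ : State} {x : Fin 5 → ℕ} (hx : ∀ i : Fin 5, σ 22 i = x i)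
    (hB : 2 * ∑ i, x i + 10 ≤ B) :
    Run B cycleBound σ fun t τ => t ≤ 200 ∧ Frame [44, 45] σ τ ∧ τ 45 0 = ∑ i, x i ∧
      (∀ i, x i + x (i + 1) ≤ τ 44 0) ∧ ∑ i, x i ≤ 2 * τ 44 0 ∧ τ 44 0 ≤ ∑ i, x i ∧
      ∀ m, ∑ i, x i ≤ 2 * m → (∀ i, x i + x (i + 1) ≤ m) → τ 44 0 ≤ m := by
  have hlt : ∀ i : Fin 5, i.val < 5 := fun i => i.isLt
  simp only [cycleBound, run_seq, run_assign, Expr.Fits, Expr.eval, Expr.cost, Nat.zero_le, true_and]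
  refine (run_five (fun k s ρ => Frame [45] σ ρ ∧ ρ 45 0 = ∑ j : Fin 5 with j.val < k, x j ∧
    s ≤ 15 * k) ?_ ?_).mono ?_
  · exact ⟨(Frame.refl _ _).store (by simp), by simp, by simp⟩
  · rintro i s ρ ⟨hF, h45, hs⟩
    have e22 : ρ 22 = σ 22 := hF 22 (by decide)
    have hle : ∑ j : Fin 5 with j.val < i.val + 1, x j ≤ ∑ j, x j :=
      Finset.sum_le_sum_of_subset (Finset.filter_subset _ _)
    rw [sum_filter_lt_succ] at hle ⊢
    have := hlt i
    simp only [run_assign, Expr.Fits, Expr.eval, Expr.cost, Op.eval, e22, hx, h45, Nat.zero_le,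
      true_and, store_eq]
    exact ⟨⟨by omega, by omega⟩, hF.store (by simp), by omega⟩
  rintro t₁ ρ₁ ⟨hF₁, h45, ht₁⟩
  rw [Finset.filter_true_of_mem fun j _ => hlt j] at h45
  have e22 : ρ₁ 22 = σ 22 := hF₁ 22 (by decide)
  simp only [h45, Op.eval]
  refine ⟨⟨⟨by omega, by omega⟩, by omega, by omega⟩, ?_⟩
  refine (run_five (fun k s ρ => Frame [44, 45] σ ρ ∧ ρ 45 0 = ∑ j, x j ∧
    (∀ i : Fin 5, i.val < k → x i + x (i + 1) ≤ ρ 44 0) ∧ ∑ i, x i ≤ 2 * ρ 44 0 ∧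
    ρ 44 0 ≤ ∑ i, x i ∧
    (∀ m, ∑ i, x i ≤ 2 * m → (∀ i, x i + x (i + 1) ≤ m) → ρ 44 0 ≤ m) ∧ s ≤ 20 * k) ?_ ?_).mono ?_
  · refine ⟨(hF₁.weaken (by simp)).store (by simp), by simp [h45], by simp, ?_, ?_, ?_, by simp⟩
    · simp
      omega
    · simp
      omega
    · simp
      intro m hm _
      omega
  · rintro i s ρ ⟨hF, h45', hp, h1, h2, h3, hs⟩
    have f22 : ρ 22 = σ 22 := hF 22 (by decide)
    have := hlt i
    have := hlt (i + 1)
    have hle := pair_le_sum x i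
    simp only [run_assign, Expr.Fits, Expr.eval, Expr.cost, Op.eval, f22, hx, Nat.zero_le, true_and]
    refine ⟨by omega, hF.store (by simp), by simp [h45'], ?_, ?_, ?_, ?_, by omega⟩
    · intro j hj
      rw [store_eq]
      rcases Nat.lt_succ_iff_lt_or_eq.1 hj with h | h
      · have := hp j h
        omega
      · rw [Fin.ext h]
        omega
    · rw [store_eq]
      omega
    · rw [store_eq]
      omega
    · intro m hm hm'
      have := h3 m hm hm'
      have := hm' i
      rw [store_eq]
      omega
  rintro t₂ τ ⟨hF, h45', hp, h1, h2, h3, ht₂⟩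
  exact ⟨by omega, hF, h45', fun i => hp i (hlt i), h1, h2, h3⟩

/-- Raise the entry `x i` of array `22` as far as the bounds on `x i + x (i + 1)`,
`x (i - 1) + x i` and the sum of all entries allow. -/
def raise (i : Fin 5) : Prog :=
  .seq (set 46 (.op .sub (.op .sub (var 44) (entry 22 i)) (entry 22 (i + 1))))
    (.seq (set 46 (.op .sub (var 46) (.op .sub (var 46)
        (.op .sub (.op .sub (var 44) (entry 22 i)) (entry 22 (i - 1))))))
      (.seq (set 46 (.op .sub (var 46) (.op .sub (var 46)
          (.op .sub (.op .add (var 44) (var 44)) (var 45)))))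
        (.seq (.assign 22 (.const i.val) (.op .add (entry 22 i) (var 46)))
          (set 45 (.op .add (var 45) (var 46))))))

/-- The weights `x i` of the vertices of a cycle of length five satisfy the necessary conditions
for a coloring of total weight `F`. -/
def Bounded (x : Fin 5 → ℕ) (F : ℕ) : Prop := (∀ i, x i + x (i + 1) ≤ F) ∧ ∑ i, x i ≤ 2 * F

/-- The weight `x i` cannot be raised. -/
def Tight (x : Fin 5 → ℕ) (F : ℕ) (i : Fin 5) : Prop :=
  x i + x (i + 1) = F ∨ x i + x (i - 1) = F ∨ ∑ j, x j = 2 * F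

/-- Raising other weights does not destroy tightness, so one pass over the five vertices suffices.
-/
theorem Tight.mono {x x' : Fin 5 → ℕ} {F : ℕ} {i : Fin 5} (h : Tight x F i)
    (hx : ∀ j, x j ≤ x' j) (h' : Bounded x' F) : Tight x' F i := by
  have h1 := h'.1 i
  have h2 := h'.1 (i - 1)
  rw [sub_add_cancel] at h2
  have h3 := hx i
  rcases h with h | h | h
  · have := hx (i + 1)
    exact Or.inl (by omega)
  · have := hx (i - 1)
    exact Or.inr (Or.inl (by omega))
  · have := Finset.sum_le_sum fun j (_ : j ∈ Finset.univ) => hx j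
    exact Or.inr (Or.inr (le_antisymm h'.2 (by omega)))

theorem run_raise {B F : ℕ} {σ : State} {x : Fin 5 → ℕ} (hx : ∀ i : Fin 5, σ 22 i = x i)
    (hF : σ 44 0 = F) (hs : σ 45 0 = ∑ i, x i) (hxF : Bounded x F) (hB : 2 * F + 10 ≤ B)
    (i : Fin 5) :
    Run B (raise i) σ fun t τ => t ≤ 100 ∧ Frame [22, 45, 46] σ τ ∧ ∃ x' : Fin 5 → ℕ,
      (∀ i : Fin 5, τ 22 i = x' i) ∧ τ 45 0 = ∑ i, x' i ∧ Bounded x' F ∧ (∀ j, x j ≤ x' j) ∧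
      Tight x' F i := by
  have hlt : ∀ i : Fin 5, i.val < 5 := fun i => i.isLt
  have i1 := hlt i
  have i2 := hlt (i + 1)
  have i3 := hlt (i - 1)
  obtain ⟨h1, h2⟩ := hxF
  have e1 := h1 i
  have e2 := h1 (i - 1)
  rw [sub_add_cancel] at e2
  simp only [raise, run_seq, run_assign, Expr.Fits, Expr.eval, Expr.cost, Op.eval, Nat.zero_le,
    true_and, store_eq, store_ne (show 44 ≠ 46 by decide), store_ne (show 45 ≠ 46 by decide),
    store_ne (show 22 ≠ 46 by decide), store_ne (show 46 ≠ 22 by decide),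
    store_ne (show 45 ≠ 22 by decide), hF, hs, hx]
  set m := F - x i - x (i + 1) - (F - x i - x (i + 1) - (F - x i - x (i - 1))) with hm
  set m' := m - (m - (F + F - ∑ i, x i)) with hm'
  refine ⟨by omega, by omega, by omega, by omega, by omega, by omega, by omega,
    (((((Frame.refl _ _).store ?_).store ?_).store ?_).store ?_).store ?_,
    Function.update x i (x i + m'), ?_⟩
  any_goals simp
  have hsum : ∑ j, Function.update x i (x i + m') j = ∑ j, x j + m' := by
    rw [Finset.sum_update_of_mem (Finset.mem_univ _), ← Finset.add_sum_erase _ x (Finset.mem_univ i),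
      Finset.sdiff_singleton_eq_erase]
    ring
  have hne1 : i + 1 ≠ i := by clear * -; revert i; decide
  have hne2 : i - 1 ≠ i := by clear * -; revert i; decide
  refine ⟨?_, ?_, ⟨?_, ?_⟩, ?_, ?_⟩
  · intro j
    by_cases hj : j = i
    · subst hj
      simp
    · simp [store_same, hj, hx, Fin.val_inj]
  · exact hsum.symm
  · intro j
    have e3 := h1 j
    by_cases hj : j = i
    · subst hj
      simp only [Function.update_self, Function.update_of_ne hne1]
      omega
    · by_cases hj' : j + 1 = i
      · have : j = i - 1 := eq_sub_of_add_eq hj'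
        rw [Function.update_of_ne hj, hj', Function.update_self, this]
        omega
      · rw [Function.update_of_ne hj, Function.update_of_ne hj']
        exact e3
  · rw [hsum]
    omega
  · intro j
    by_cases hj : j = i
    · subst hj
      simp
    · rw [Function.update_of_ne hj]
  · simp only [Tight, hsum, Function.update_self, Function.update_of_ne hne1,
      Function.update_of_ne hne2]
    omega

/-- If no weight can be raised, then the total weight is twice the bound. Then the weights
`F - x (j + 3) - x (j + 4)` of the pairs `j`, `j + 2` are a coloring of total weight `F`. -/
theorem sum_eq_of_tight {x : Fin 5 → ℕ} {F : ℕ} (h : Bounded x F) (ht : ∀ i, Tight x F i) :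
    ∑ i, x i = 2 * F := by
  -- three edges of the cycle cover all vertices, one of them twice
  by_contra hne
  obtain ⟨h1, h2⟩ := h
  have a0 := h1 0
  have a1 := h1 1
  have a2 := h1 2
  have a3 := h1 3
  have a4 := h1 4
  have t0 := ht 0
  have t1 := ht 1
  have t2 := ht 2
  have t3 := ht 3
  have t4 := ht 4
  simp only [Tight, hne, or_false] at t0 t1 t2 t3 t4
  rw [Fin.sum_univ_five] at hne h2
  simp only [show (0 : Fin 5) + 1 = 1 by decide, show (1 : Fin 5) + 1 = 2 by decide,
    show (2 : Fin 5) + 1 = 3 by decide, show (3 : Fin 5) + 1 = 4 by decide,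
    show (4 : Fin 5) + 1 = 0 by decide, show (0 : Fin 5) - 1 = 4 by decide,
    show (1 : Fin 5) - 1 = 0 by decide, show (2 : Fin 5) - 1 = 1 by decide,
    show (3 : Fin 5) - 1 = 2 by decide, show (4 : Fin 5) - 1 = 3 by decide] at *
  omega

/-- Put in entry `j` of array `23` the weight `y j` of the stable set of the vertices `j` and
`j + 2` in a coloring of a cycle of length five. -/
def pairWeight (j : Fin 5) : Prog :=
  .assign 23 (.const j.val) (.op .sub (.op .sub (var 44) (entry 22 (j + 3))) (entry 22 (j + 4)))

/-- Find a coloring of a cycle of length five with the weights in array `22`. -/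
def cycleWeights : Prog := .seq cycleBound (.seq (five raise) (five pairWeight))

/-- The weight `y i` is for the stable set of the vertices `i` and `i + 2`, so that the vertex `i`
is covered by `y i` and `y (i + 3)`. The last clause says that the total weight is the maximum of
the two obvious lower bounds. -/
theorem run_cycleWeights {B : ℕ} {σ : State} {x : Fin 5 → ℕ} (hx : ∀ i : Fin 5, σ 22 i = x i)
    (hB : 2 * ∑ i, x i + 10 ≤ B) :
    Run B cycleWeights σ fun t τ => t ≤ 1000 ∧ Frame [22, 23, 44, 45, 46] σ τ ∧
      ∃ y : Fin 5 → ℕ, (∀ i : Fin 5, τ 23 i = y i) ∧ (∀ i, x i ≤ y i + y (i + 3)) ∧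
      ∑ i, y i ≤ ∑ i, x i ∧
      ∀ m, ∑ i, x i ≤ 2 * m → (∀ i, x i + x (i + 1) ≤ m) → ∑ i, y i ≤ m := by
  have hlt : ∀ i : Fin 5, i.val < 5 := fun i => i.isLt
  rw [cycleWeights, run_seq]
  refine (run_cycleBound hx hB).mono ?_
  rintro t₁ ρ₁ ⟨ht₁, hF₁, h45, b1, b2, b3, b4⟩
  set F := ρ₁ 44 0 with hF
  rw [run_seq]
  refine (run_five (fun k s ρ => s ≤ 100 * k ∧ Frame [22, 45, 46] ρ₁ ρ ∧ ∃ x' : Fin 5 → ℕ,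
      (∀ i : Fin 5, ρ 22 i = x' i) ∧ ρ 45 0 = ∑ i, x' i ∧ Bounded x' F ∧ (∀ j, x j ≤ x' j) ∧
      ∀ i : Fin 5, i.val < k → Tight x' F i) ?_ ?_).mono ?_
  · exact ⟨by simp, Frame.refl _ _, x, by simpa [hF₁ 22 (by decide)] using hx, h45, ⟨b1, b2⟩,
      fun _ => le_rfl, by simp⟩
  · rintro i s ρ ⟨hs, hFρ, x', e22, e45, hb, hle, hti⟩
    refine (run_raise e22 (F := F) (by rw [hFρ 44 (by decide)]) e45 hb (by omega) i).mono ?_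
    rintro t τ ⟨ht, hFτ, x'', f22, f45, hb', hle', hti'⟩
    refine ⟨by omega, hFρ.trans hFτ (by simp), x'', f22, f45, hb', fun j => (hle j).trans (hle' j),
      fun j hj => ?_⟩
    rcases Nat.lt_succ_iff_lt_or_eq.1 hj with h | h
    · exact (hti j h).mono hle' hb'
    · rwa [Fin.ext h]
  rintro t₂ ρ₂ ⟨ht₂, hF₂, x', e22, e45, hb, hle, hti⟩
  have hsum := sum_eq_of_tight hb fun i => hti i (hlt i)
  have e44 : ρ₂ 44 0 = F := by rw [hF₂ 44 (by decide)]
  refine (run_five (fun k s ρ => s ≤ 15 * k ∧ Frame [23] ρ₂ ρ ∧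
      ∀ i : Fin 5, i.val < k → ρ 23 i = F - x' (i + 3) - x' (i + 4)) ?_ ?_).mono ?_
  · exact ⟨by simp, Frame.refl _ _, by simp⟩
  · rintro i s ρ ⟨hs, hFρ, h23⟩
    have f22 : ρ 22 = ρ₂ 22 := hFρ 22 (by decide)
    have f44 : ρ 44 = ρ₂ 44 := hFρ 44 (by decide)
    have := hlt i
    have := hlt (i + 3)
    have := hlt (i + 4)
    simp only [pairWeight, run_assign, Expr.Fits, Expr.eval, Expr.cost, Op.eval, f22, f44, e22, e44,
      Nat.zero_le, true_and]
    refine ⟨by omega, by omega, by omega, hFρ.store (by simp), fun j hj => ?_⟩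
    rw [store_same]
    split_ifs with h
    · rw [Fin.ext h]
    · exact h23 j (by omega)
  rintro t₃ τ ⟨ht₃, hF₃, h23⟩
  refine ⟨by omega, ?_, fun i => F - x' (i + 3) - x' (i + 4), fun i => h23 i (hlt i), ?_⟩
  · exact ((hF₁.weaken (l' := [22, 23, 44, 45, 46]) (by simp)).trans hF₂ (by simp)).trans hF₃ (by simp)
  have hyF : ∑ i : Fin 5, (F - x' (i + 3) - x' (i + 4)) = F := by
    obtain ⟨h1, -⟩ := hb
    have a0 := h1 0
    have a1 := h1 1
    have a2 := h1 2
    have a3 := h1 3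
    have a4 := h1 4
    rw [Fin.sum_univ_five] at hsum ⊢
    simp only [show (0 : Fin 5) + 1 = 1 by decide, show (1 : Fin 5) + 1 = 2 by decide,
      show (2 : Fin 5) + 1 = 3 by decide, show (3 : Fin 5) + 1 = 4 by decide,
      show (4 : Fin 5) + 1 = 0 by decide, show (0 : Fin 5) + 3 = 3 by decide,
      show (1 : Fin 5) + 3 = 4 by decide, show (2 : Fin 5) + 3 = 0 by decide,
      show (3 : Fin 5) + 3 = 1 by decide, show (4 : Fin 5) + 3 = 2 by decide,
      show (0 : Fin 5) + 4 = 4 by decide, show (1 : Fin 5) + 4 = 0 by decide,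
      show (2 : Fin 5) + 4 = 1 by decide, show (3 : Fin 5) + 4 = 2 by decide,
      show (4 : Fin 5) + 4 = 3 by decide] at *
    omega
  refine ⟨fun i => (hle i).trans ?_, by rw [hyF]; exact b3, fun m h1 h2 => by rw [hyF]; exact b4 m h1 h2⟩
  have hs : x' i + x' (i + 1) + x' (i + 2) + x' (i + 3) + x' (i + 4) = 2 * F := by
    rw [← hsum, Fin.sum_univ_five]
    clear * -
    fin_cases i <;> simp <;> ring
  have e1 : i + 3 + 3 = i + 1 := by clear * -; revert i; decide
  have e2 : i + 3 + 4 = i + 2 := by clear * -; revert i; decide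
  simp only [e1, e2]
  omega

end WordRAM

/-! ### Merging along a five-cycle -/

namespace WordRAM

open BuoyColoring

/-- Unselect all vertices. -/
def unselect : Prog := forTo 30 0 (.assign 15 (var 30) (.const 0))

/-- The vertex in entry `i` of array `21` has pieces left. -/
abbrev alive (i : Fin 5) : Expr := .op .lt (.read 8 (entry 21 i)) (.read 9 (entry 21 i))

/-- Select the vertex in entry `i` of array `21` if it has pieces left, and lower the variable `34`
to the remaining weight of its first piece. -/
def selectEntry (i : Fin 5) : Prog :=
  .ite (alive i) (.seq (.assign 15 (entry 21 i) (.const 1))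
    (.ite (.op .lt (.read 10 (entry 21 i)) (var 34)) (set 34 (.read 10 (entry 21 i))) .skip)) .skip

/-- Emit a piece for the vertices in the entries `j` and `j + 2` of array `21`. Its weight is at
most the entry `j` of array `23`, and it is subtracted from this entry. -/
def pairRound (j : Fin 5) : Prog :=
  .seq unselect (.seq (set 34 (entry 23 j)) (.seq (selectEntry j) (.seq (selectEntry (j + 2))
    (.seq emit (.assign 23 (.const j.val) (.op .sub (entry 23 j) (var 34)))))))

/-- Emit pieces of total weight `y j`, the entry `j` of array `23`, for the vertices in the entries
`j` and `j + 2` of array `21`, unless both of them run out of pieces. -/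
def pairMerge (j : Fin 5) : Prog :=
  .loop (.op .mul (.op .lt (.const 0) (entry 23 j)) (.op .add (alive j) (alive (j + 2))))
    (pairRound j)

/-- Merge the pieces of the vertices in array `21`, which form a cycle of length five. Array `22`
holds the total weights of their pieces. -/
def cycleMerge : Prog :=
  .seq (set 40 (var 13)) (.seq (set 35 (.const 0)) (.seq cycleWeights (five pairMerge)))

variable {B n W : ℕ} {σ : State} {g : SimpleGraph ℕ} {w : ℕ → ℕ} {L : ℕ → List Piece}

theorem run_unselect (hn : σ 0 0 = n) (hB : n + 1 ≤ B) :
    Run B unselect σ fun t τ => t ≤ 20 * n + 9 ∧ Frame [15, 30] σ τ ∧ IsChar n τ 15 ∅ := by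
  refine (run_forTo' (N := n) (fun k ρ => Frame [15, 30] σ ρ ∧ ∀ u < k, ρ 15 u = 0) 8 (by decide)
    (by omega) hn ?_ ?_).mono ?_
  · exact ⟨(Frame.refl _ _).store (by simp), by simp⟩
  · rintro k ρ hk hρk hρn ⟨hF, h⟩
    simp [hρk, hρn]
    refine ⟨(hF.store (by simp)).store (by simp), fun u hu => ?_⟩
    rw [store_same]
    split_ifs with huk
    · rfl
    · exact h u (by omega)
  · rintro t τ ⟨ht, ⟨hF, h⟩, -⟩
    exact ⟨by omega, hF, by simpa [IsChar] using h⟩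

theorem run_selectEntry {S : Finset ℕ} (hm : Mem g n L σ) (hS : IsChar n σ 15 S) {i : Fin 5} {r : ℕ}
    (hr : σ 21 i = r) (hrn : r < n) (hB : 10 ≤ B) :
    Run B (selectEntry i) σ fun t τ => t ≤ 50 ∧ Frame [15, 34] σ τ ∧
      IsChar n τ 15 (if L r = [] then S else insert r S) ∧
      τ 34 0 = if L r = [] then σ 34 0 else min (σ 34 0) (headWt (L r)) := by
  have hi := i.isLt
  have hlt := (hm.holds r hrn).lt_iff
  have hiB : i.val ≤ B := by omega
  have h1B : 1 ≤ B := by omega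
  have h0 : ∀ p : Prop, [Decidable p] → (if p then 1 else 0) ≤ B := by
    intro p _
    split_ifs <;> omega
  simp only [selectEntry, run_ite, run_seq, run_assign, run_skip, Expr.Fits, Expr.eval, Expr.cost,
    Op.eval, hr, Nat.zero_le, true_and, store_ne (show 10 ≠ 15 by decide),
    store_ne (show 21 ≠ 15 by decide), store_ne (show 34 ≠ 15 by decide), hlt, hiB, h1B]
  by_cases hL : L r = []
  · simp only [hL, ne_eq, not_true, if_false, if_true]
    refine ⟨by omega, fun h => absurd h (by simp), fun _ => ⟨by omega, Frame.refl _ _, hS, trivial⟩⟩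
  · have hw := (hm.holds r hrn).headWt hL
    simp only [hL, ne_eq, not_false_iff, if_true, if_false, one_ne_zero, hw]
    refine ⟨by omega, fun _ => ⟨h0 _, fun h => ?_, fun h => ?_⟩, fun h => absurd h (by simp)⟩
    · have h' : headWt (L r) < σ 34 0 := by
        by_contra h'
        simp [h'] at h
      refine ⟨by omega, ((Frame.refl _ _).store (by simp)).store (by simp), fun u hu => ?_, ?_⟩
      · rw [store_ne (by decide), store_same]
        by_cases hur : u = r <;> simp [hur, hS u hu]
      · rw [store_eq, min_eq_right h'.le]
    · have h' : ¬ headWt (L r) < σ 34 0 := by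
        intro h'
        simp [h'] at h
      refine ⟨by omega, (Frame.refl _ _).store (by simp), fun u hu => ?_, ?_⟩
      · rw [store_same]
        by_cases hur : u = r <;> simp [hur, hS u hu]
      · rw [min_eq_left (not_lt.1 h')]

/-- What is known of the weight of a piece that is emitted for two vertices with the lists `l` and
`l'`. -/
theorem eq_min_iff_of_nil {l l' : List Piece} {y δ : ℕ}
    (h : δ = if l' = [] then (if l = [] then y else min y (headWt l))
      else min (if l = [] then y else min y (headWt l)) (headWt l')) :
    δ ≤ y ∧ (l ≠ [] → δ ≤ headWt l) ∧ (l' ≠ [] → δ ≤ headWt l') ∧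
      (δ = y ∨ (l ≠ [] ∧ headWt l ≤ δ) ∨ l' ≠ [] ∧ headWt l' ≤ δ) := by
  by_cases e1 : l = [] <;> by_cases e2 : l' = [] <;>
    simp only [e1, e2, if_true, if_false] at h <;>
    simp only [e1, e2, ne_eq, not_true, not_false_iff, true_imp_iff, true_and, false_imp_iff,
      false_and, or_false, false_or] <;> omega

/-- The state of the computation while the pieces of the vertices `r 0`, …, `r 4` of a cycle of
length five are being merged: the weight `y i` remains to be emitted for `r i` and `r (i + 2)`, and
this is enough for the pieces that are left. The first new piece is at position `k`, and `F` is the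
total weight of the coloring. -/
structure CycleState (g : SimpleGraph ℕ) (n W : ℕ) (X : Finset ℕ) (r : Fin 5 → ℕ) (k F : ℕ)
    (L₀ L : ℕ → List Piece) (O : List Piece) (y : Fin 5 → ℕ) (σ : State) : Prop where
  mem : Mem g n L σ
  merging : Merging g W X L₀ L O
  rest : ∀ i : Fin 5, σ 23 i = y i
  seg : Seg n σ k O
  length : k + O.length = σ 13 0
  sum : σ 35 0 = wsum O
  total : wsum O + ∑ i, y i = F
  demand : ∀ i, wsum (L (r i)) ≤ y i + y (i + 3)
  count : O.length + (pieces X L + ∑ i, min (y i) 1) ≤ pieces X L₀ + 5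

variable {L₀ : ℕ → List Piece} {X : Finset ℕ} {r : Fin 5 → ℕ} {k F : ℕ} {O : List Piece}
  {y : Fin 5 → ℕ}

abbrev pairFrame : List ℕ := [8, 10, 11, 12, 13, 15, 23, 30, 31, 34, 35]

set_option maxHeartbeats 1000000 in
theorem run_pairRound (hσ : CycleState g n W X r k F L₀ L O y σ) (hs : Stage g n W w L₀)
    (hr : IsC5 g r) (hrX : ∀ i, r i ∈ X) (hX : ∀ u ∈ X, u < n) (h21 : ∀ i : Fin 5, σ 21 i = r i)
    (hB : (k + pieces X L₀ + n + 10) * (n + 2) ≤ B) (hF : F ≤ B) (hW : W ≤ B) {j : Fin 5}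
    (hy : y j ≠ 0) (hL : L (r j) ≠ [] ∨ L (r (j + 2)) ≠ []) :
    Run B (pairRound j) σ fun t τ => t ≤ 900 * (n + 1) ∧ Frame pairFrame σ τ ∧
      ∃ L' O' y', CycleState g n W X r k F L₀ L' O' y' τ ∧
        pieces X L' + ∑ i, min (y' i) 1 + 1 ≤ pieces X L + ∑ i, min (y i) 1 ∧
        (∀ i, y i = 0 → y' i = 0) ∧ ∀ u, L u = [] → L' u = [] := by
  obtain ⟨hm, hmer, h23, hseg, hlen, h35, htot, hdem, hcnt⟩ := hσ
  have hj := j.isLt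
  have hnB : n + 10 ≤ B := by nlinarith
  have h1 : (σ 13 0 + n + 5) * (n + 2) ≤ B := by
    refine le_trans (Nat.mul_le_mul_right _ ?_) hB
    omega
  have hne : r j ≠ r (j + 2) := by
    intro h
    have h2 := (hr (j + 1)).1
    have h3 : j + 1 + 1 = j + 2 := by clear * -; revert j; decide
    rw [h3, ← h] at h2
    have h4 := (hr (j + 2)).2
    have h5 := (hr (j + 3)).1
    have h6 : j + 2 + 2 = j + 3 + 1 := by clear * -; revert j; decide
    rw [h6, ← h] at h4
    have h7 : j + 3 + 1 + 1 = j := by clear * -; revert j; decide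
    have h8 := (hr (j + 3 + 1)).1
    rw [h7] at h8
    exact h4 h8.symm
  set S := ({r j, r (j + 2)} : Finset ℕ).filter fun u => L u ≠ [] with hSdef
  have hSmem : ∀ u, u ∈ S ↔ (u = r j ∨ u = r (j + 2)) ∧ L u ≠ [] := by
    intro u
    simp [hSdef]
  have hSX : S ⊆ X := by
    intro u hu
    rcases ((hSmem u).1 hu).1 with rfl | rfl <;> exact hrX _
  have hScard : S.card ≤ 2 := (Finset.card_filter_le _ _).trans Finset.card_le_two
  have hSind : g.IsIndepSet (S : Set ℕ) := by
    intro u hu v hv huv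
    have hu' := ((hSmem u).1 hu).1
    have hv' := ((hSmem v).1 hv).1
    rcases hu' with rfl | rfl <;> rcases hv' with rfl | rfl
    · exact absurd rfl huv
    · exact (hr j).2
    · exact fun h => (hr j).2 h.symm
    · exact absurd rfl huv
  simp only [pairRound, run_seq (p := unselect)]
  refine (run_unselect hm.size (by omega)).mono ?_
  rintro t₁ ρ₁ ⟨ht₁, hF₁, hS₁⟩
  simp only [run_seq (p := set _ _), run_assign, Expr.Fits, Expr.eval, Expr.cost, Nat.zero_le,
    true_and, hF₁ 23 (by decide), h23]
  refine ⟨by omega, ?_⟩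
  set ρ₂ := ρ₁.store 34 0 (y j) with hρ₂
  have hF₂ : Frame pairFrame σ ρ₂ := (hF₁.weaken (by simp)).store (by simp)
  have hm₂ : Mem g n L ρ₂ := (hm.frame hF₁ (by decide)).frame (l := [34])
    ((Frame.refl _ _).store (by simp)) (by decide)
  rw [run_seq]
  refine (run_selectEntry hm₂ (S := ∅) (by simpa [IsChar, hρ₂] using hS₁)
    (by rw [hF₂ 21 (by decide), h21]) (hX _ (hrX j)) (by omega)).mono ?_
  rintro t₃ ρ₃ ⟨ht₃, hF₃, hS₃, h34₃⟩
  rw [run_seq]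
  refine (run_selectEntry (hm₂.frame hF₃ (by decide)) hS₃
    (by rw [hF₃ 21 (by decide), hF₂ 21 (by decide), h21]) (hX _ (hrX (j + 2))) (by omega)).mono ?_
  rintro t₄ ρ₄ ⟨ht₄, hF₄, hS₄, h34₄⟩
  have hF₄' : Frame [15, 30, 34] σ ρ₄ := (((hF₁.weaken (l' := [15, 30, 34]) (by simp)).store
    (a := 34) (by simp)).trans hF₃ (by simp)).trans hF₄ (by simp)
  have hm₄ : Mem g n L ρ₄ := hm.frame hF₄' (by decide)
  set δ := ρ₄ 34 0 with hδdef
  rw [h34₃, hρ₂, store_eq] at h34₄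
  have hpos : ∀ i, L (r i) ≠ [] → 0 < headWt (L (r i)) := fun i =>
    headWt_pos_of_forall fun P hP => (hmer.old _ (hrX i) P hP).1.1
  have hle : ∀ i, headWt (L (r i)) ≤ W := fun i =>
    headWt_le_of_forall fun P hP => (hmer.old _ (hrX i) P hP).1.2
  have hS₄' : IsChar n ρ₄ 15 S := by
    have : (if L (r (j + 2)) = [] then if L (r j) = [] then ∅ else insert (r j) ∅ else
        insert (r (j + 2)) (if L (r j) = [] then ∅ else insert (r j) ∅)) = S := by
      by_cases e1 : L (r j) = [] <;> by_cases e2 : L (r (j + 2)) = [] <;>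
        simp [hSdef, Finset.filter_insert, Finset.filter_singleton, e1, e2, Finset.pair_comm]
    rw [← this]
    exact hS₄
  obtain ⟨hδy, hδ1, hδ2, hδ3⟩ := eq_min_iff_of_nil h34₄
  have hδS : ∀ u ∈ S, δ ≤ headWt (L u) := by
    intro u hu
    obtain ⟨h, hLu⟩ := (hSmem u).1 hu
    rcases h with rfl | rfl
    · exact hδ1 hLu
    · exact hδ2 hLu
  have hδor : δ = y j ∨ ∃ u ∈ S, headWt (L u) ≤ δ := by
    rcases hδ3 with h | ⟨h, h'⟩ | ⟨h, h'⟩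
    · exact Or.inl h
    · exact Or.inr ⟨_, (hSmem _).2 ⟨Or.inl rfl, h⟩, h'⟩
    · exact Or.inr ⟨_, (hSmem _).2 ⟨Or.inr rfl, h⟩, h'⟩
  have hδ0 : 0 < δ := by
    rcases hδ3 with h | ⟨h, h'⟩ | ⟨h, h'⟩
    · omega
    · exact (hpos _ h).trans_le h'
    · exact (hpos _ h).trans_le h'
  have hδW : δ ≤ W := by
    rcases hL with h | h
    · exact (hδS _ ((hSmem _).2 ⟨Or.inl rfl, h⟩)).trans (hle _)
    · exact (hδS _ ((hSmem _).2 ⟨Or.inr rfl, h⟩)).trans (hle _)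
  have hysum := Finset.add_sum_erase Finset.univ y (Finset.mem_univ j)
  rw [run_seq]
  refine (run_emit hm₄ hS₄' (fun u hu => ⟨hX u (hSX hu), ((hSmem u).1 hu).2⟩)
    (hseg.frame hF₄' (by decide)) (by rw [hF₄' 13 (by decide), hlen]) ?_ ?_ ?_).mono ?_
  · intro u hu
    rcases ((hSmem u).1 hu).1 with rfl | rfl <;> exact (hle _).trans hW
  · rw [hF₄' 13 (by decide)]
    nlinarith
  · rw [hF₄' 35 (by decide), h35]
    omega
  rintro t₅ ρ₅ ⟨ht₅, hF₅, hm₅, hseg₅, h13, h35₅⟩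
  have f23 : ρ₅ 23 = σ 23 := (hF₅ 23 (by decide)).trans (hF₄' 23 (by decide))
  have f34 : ρ₅ 34 0 = δ := by rw [hF₅ 34 (by decide)]
  simp only [run_assign, Expr.Fits, Expr.eval, Expr.cost, Op.eval, Nat.zero_le, true_and, f23, h23,
    f34]
  have hcardmul := Nat.mul_le_mul_right (100 * (n + 1)) hScard
  have hFl : Frame [23] ρ₅ (ρ₅.store 23 j (y j - δ)) := (Frame.refl _ _).store (by simp)
  have hupd : ∀ f : ℕ → ℕ, ∑ i, f (Function.update y j (y j - δ) i) + f (y j) =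
      ∑ i, f (y i) + f (y j - δ) := by
    intro f
    rw [← Finset.add_sum_erase Finset.univ (fun i => f (y i)) (Finset.mem_univ j),
      ← Finset.add_sum_erase Finset.univ (fun i => f (Function.update y j (y j - δ) i))
        (Finset.mem_univ j), Function.update_self]
    rw [Finset.sum_congr rfl fun i hi => by rw [Function.update_of_ne (Finset.ne_of_mem_erase hi)]]
    ring
  have hu1 := hupd id
  have hu2 := hupd fun a => min a 1
  simp only [id] at hu1
  have hple := pieces_serve_le X L S δ
  have hΦ : pieces X (serve L S δ) + ∑ i, min (Function.update y j (y j - δ) i) 1 + 1 ≤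
      pieces X L + ∑ i, min (y i) 1 := by
    rcases hδor with h | ⟨u, hu, h⟩
    · omega
    · have := pieces_serve_lt hu (hSX hu) ((hSmem u).1 hu).2 h
      omega
  refine ⟨by omega, by omega, by omega, ?_, serve L S δ, O ++ [unite L S δ],
    Function.update y j (y j - δ), ?_, hΦ, ?_, ?_⟩
  · exact ((hF₄'.weaken (l' := pairFrame) (by simp)).trans hF₅ (by simp)).trans hFl (by simp)
  · refine ⟨hm₅.frame hFl (by decide), hmer.serve hs hSX hSind ⟨hδ0, hδW⟩ hδS, ?_,
      hseg₅.frame hFl (by decide), ?_, ?_, ?_, ?_, ?_⟩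
    · intro i
      by_cases hij : i = j
      · subst hij
        simp
      · rw [store_same, Function.update_of_ne hij, if_neg fun h => hij (Fin.ext h), f23, h23]
    · rw [hFl 13 (by decide), h13, hF₄' 13 (by decide), List.length_append, List.length_singleton]
      omega
    · rw [hFl 35 (by decide), h35₅, hF₄' 35 (by decide), h35, wsum_append]
      simp [unite, hδdef]
    · rw [wsum_append]
      simp only [unite, wsum_cons, wsum_nil]
      omega
    · intro i
      have hd := hdem i
      have hserve : ∀ u ∈ S, wsum (serve L S δ u) + δ = wsum (L u) := fun u hu => by
        rw [serve, if_pos hu, wsum_consume (hδS u hu)]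
      have hwle : ∀ u, wsum (serve L S δ u) ≤ wsum (L u) := by
        intro u
        by_cases hu : u ∈ S
        · have := hserve u hu
          omega
        · rw [serve, if_neg hu]
      have hw := hwle (r i)
      by_cases hLi : L (r i) = []
      · have : wsum (L (r i)) = 0 := by rw [hLi]; rfl
        omega
      · have hi3 : i + 3 ≠ i := by clear * -; revert i; decide
        by_cases hij : i = j
        · subst hij
          have := hserve (r i) ((hSmem _).2 ⟨Or.inl rfl, hLi⟩)
          rw [Function.update_self, Function.update_of_ne hi3]
          omega
        · by_cases hij' : i + 3 = j
          · have hi : i = j + 2 := by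
              rw [← hij']
              clear * -
              revert i
              decide
            have := hserve (r i) ((hSmem _).2 ⟨Or.inr (by rw [hi]), hLi⟩)
            rw [Function.update_of_ne hij, hij', Function.update_self]
            rw [hij'] at hd
            omega
          · rw [Function.update_of_ne hij, Function.update_of_ne hij']
            omega
    · rw [List.length_append, List.length_singleton]
      omega
  · intro i hi
    by_cases hij : i = j
    · subst hij
      exact absurd hi hy
    · rwa [Function.update_of_ne hij]
  · intro u hu
    rw [serve]
    split_ifs
    · exact consume_nil_of_nil hu
    · exact hu

abbrev cycleFrame : List ℕ := [8, 10, 11, 12, 13, 15, 22, 23, 30, 31, 34, 35, 40, 44, 45, 46]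

theorem run_pairMerge (hσ : CycleState g n W X r k F L₀ L O y σ) (hs : Stage g n W w L₀)
    (hr : IsC5 g r) (hrX : ∀ i, r i ∈ X) (hX : ∀ u ∈ X, u < n) (h21 : ∀ i : Fin 5, σ 21 i = r i)
    (hB : (k + pieces X L₀ + n + 10) * (n + 2) ≤ B) (hF : F ≤ B) (hW : W ≤ B) (j : Fin 5) :
    Run B (pairMerge j) σ fun t τ => Frame pairFrame σ τ ∧
      ∃ L' O' y', CycleState g n W X r k F L₀ L' O' y' τ ∧
        t + (pieces X L' + ∑ i, min (y' i) 1) * (1000 * (n + 1)) ≤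
          (pieces X L + ∑ i, min (y i) 1) * (1000 * (n + 1)) + 30 ∧
        (∀ i, y i = 0 → y' i = 0) ∧ (∀ u, L u = [] → L' u = []) ∧
        (y' j = 0 ∨ L' (r j) = [] ∧ L' (r (j + 2)) = []) := by
  have hj := j.isLt
  have hj2 := (j + 2).isLt
  have hnB : n + 10 ≤ B := by nlinarith
  refine (run_loop (fun s ρ => Frame pairFrame σ ρ ∧ ∃ L' O' y',
    CycleState g n W X r k F L₀ L' O' y' ρ ∧
    s + (pieces X L' + ∑ i, min (y' i) 1) * (1000 * (n + 1)) ≤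
      (pieces X L + ∑ i, min (y i) 1) * (1000 * (n + 1)) ∧
    (∀ i, y i = 0 → y' i = 0) ∧ (∀ u, L u = [] → L' u = []))
    ((pieces X L + ∑ i, min (y i) 1) * (1000 * (n + 1))) ?_ ?_ ?_ ?_).mono ?_
  · exact ⟨Frame.refl _ _, L, O, y, hσ, by omega, fun _ h => h, fun _ h => h⟩
  · rintro s ρ ⟨-, L', O', y', -, h, -⟩
    omega
  · rintro s ρ -
    simp only [Expr.Fits, Expr.eval, Op.eval]
    have h1 : ∀ p : Prop, [Decidable p] → (if p then 1 else 0) ≤ 1 := by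
      intro p _
      split_ifs <;> omega
    have h2 : ∀ a b c : ℕ, a ≤ 1 → b ≤ 1 → c ≤ 1 → b + c ≤ B ∧ a * (b + c) ≤ B := by
      intro a b c ha hb hc
      have := Nat.mul_le_mul ha (Nat.add_le_add hb hc)
      omega
    have hle : ∀ a ≤ 1, a ≤ B := fun a ha => by omega
    have h3 := h2 _ _ _ (h1 (0 < ρ 23 j)) (h1 (ρ 8 (ρ 21 j) < ρ 9 (ρ 21 j)))
      (h1 (ρ 8 (ρ 21 (j + 2 : Fin 5)) < ρ 9 (ρ 21 (j + 2 : Fin 5))))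
    exact ⟨⟨Nat.zero_le _, by omega, hle _ (h1 _)⟩, ⟨⟨by omega, by omega, hle _ (h1 _)⟩,
      ⟨by omega, by omega, hle _ (h1 _)⟩, h3.1⟩, h3.2⟩
  · rintro s ρ ⟨hFρ, L', O', y', hc, hsb, hy', hL'⟩ hne
    have e21 : ∀ i : Fin 5, ρ 21 i = r i := fun i => by rw [hFρ 21 (by decide), h21]
    simp only [Expr.eval, Op.eval, hc.rest, e21, (hc.mem.holds _ (hX _ (hrX _))).lt_iff] at hne
    refine (run_pairRound hc hs hr hrX hX e21 hB hF hW (j := j) ?_ ?_).mono ?_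
    · intro h
      simp [h] at hne
    · by_contra h
      push Not at h
      simp [h.1, h.2] at hne
    · rintro t τ ⟨ht, hFτ, L'', O'', y'', hc', hΦ, hy'', hL''⟩
      refine ⟨hFρ.trans hFτ (by simp), L'', O'', y'', hc', ?_, fun i hi => hy'' i (hy' i hi),
        fun u hu => hL'' u (hL' u hu)⟩
      have := Nat.mul_le_mul_right (1000 * (n + 1)) hΦ
      rw [add_mul _ 1, one_mul] at this
      simp only [Expr.cost]
      omega
  · rintro t τ ⟨s, rfl, ⟨hFρ, L', O', y', hc, hsb, hy', hL'⟩, hz⟩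
    have e21 : ∀ i : Fin 5, τ 21 i = r i := fun i => by rw [hFρ 21 (by decide), h21]
    simp only [Expr.eval, Op.eval, hc.rest, e21, (hc.mem.holds _ (hX _ (hrX _))).lt_iff] at hz
    refine ⟨hFρ, L', O', y', hc, ?_, hy', hL', ?_⟩
    · simp only [Expr.cost]
      omega
    · by_contra h
      push Not at h
      obtain ⟨h1, h2⟩ := h
      have h1' : 0 < y' j := Nat.pos_of_ne_zero h1
      by_cases h3 : L' (r j) = []
      · have := h2 h3
        simp [h1', h3, this] at hz
      · simp [h1', h3] at hz

theorem run_cycleMerge (hm : Mem g n L₀ σ) (hs : Stage g n W w L₀) (hr : IsC5 g r)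
    (hrX : ∀ i, r i ∈ X) (hX : ∀ u ∈ X, u < n) (hrep : ∀ u ∈ X, L₀ u ≠ [] → ∃ i, u = r i)
    (h21 : ∀ i : Fin 5, σ 21 i = r i) (h22 : ∀ i : Fin 5, σ 22 i = wsum (L₀ (r i)))
    (hB : (σ 13 0 + pieces X L₀ + n + 10) * (n + 2) ≤ B)
    (hBW : 2 * ∑ i, wsum (L₀ (r i)) + 10 ≤ B) (hW : W ≤ B) :
    Run B cycleMerge σ fun t τ => Frame cycleFrame σ τ ∧
      t ≤ (pieces X L₀ + 10) * (1000 * (n + 1)) ∧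
      ∃ L O, Mem g n L τ ∧ Merging g W X L₀ L O ∧ (∀ u ∈ X, L u = []) ∧
        (∀ c : WeightedColoring g fun u => wsum (L₀ u), wsum O ≤ hits c X) ∧
        τ 40 0 = σ 13 0 ∧ Seg n τ (σ 13 0) O ∧ σ 13 0 + O.length = τ 13 0 ∧
        O.length ≤ pieces X L₀ + 5 := by
  simp only [cycleMerge, run_seq (p := set _ _), run_assign, Expr.Fits, Expr.eval, Expr.cost,
    Nat.zero_le, true_and]
  set ρ := (σ.store 40 0 (σ 13 0)).store 35 0 0 with hρ
  have hF₀ : Frame [35, 40] σ ρ := ((Frame.refl _ _).store (by simp)).store (by simp)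
  rw [run_seq]
  refine (run_cycleWeights (x := fun i => wsum (L₀ (r i))) ?_ hBW).mono ?_
  · intro i
    rw [hF₀ 22 (by decide), h22]
  rintro t₁ ρ₁ ⟨ht₁, hF₁, y, h23, hxy, hyB, hym⟩
  have hF₁' : Frame [22, 23, 35, 40, 44, 45, 46] σ ρ₁ :=
    (hF₀.weaken (by simp)).trans hF₁ (by simp)
  have hymin : ∑ i, min (y i) 1 ≤ 5 := by
    calc ∑ i, min (y i) 1 ≤ ∑ _i : Fin 5, 1 := Finset.sum_le_sum fun i _ => min_le_right _ _
      _ = 5 := by simp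
  have hc₁ : CycleState g n W X r (σ 13 0) (∑ i, y i) L₀ L₀ [] y ρ₁ := by
    refine ⟨hm.frame hF₁' (by decide), hs.merging X, h23, trivial, ?_, ?_, by simp, hxy, ?_⟩
    · rw [hF₁' 13 (by decide)]
      simp
    · rw [hF₁ 35 (by decide), hρ]
      simp
    · simp only [List.length_nil]
      omega
  refine (run_five (fun k s τ => Frame pairFrame ρ₁ τ ∧ ∃ L O y',
    CycleState g n W X r (σ 13 0) (∑ i, y i) L₀ L O y' τ ∧
    s + (pieces X L + ∑ i, min (y' i) 1) * (1000 * (n + 1)) ≤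
      (pieces X L₀ + ∑ i, min (y i) 1) * (1000 * (n + 1)) + 30 * k ∧
    ∀ i : Fin 5, i.val < k → y' i = 0 ∨ L (r i) = [] ∧ L (r (i + 2)) = []) ?_ ?_).mono ?_
  · exact ⟨Frame.refl _ _, L₀, [], y, hc₁, by simp, by simp⟩
  · rintro i s τ ⟨hF, L, O, y', hc, hsb, hdone⟩
    refine (run_pairMerge hc hs hr hrX hX ?_ hB (by omega) hW i).mono ?_
    · intro i
      rw [hF 21 (by decide), hF₁' 21 (by decide), h21]
    · rintro t τ' ⟨hF', L', O', y'', hc', hsb', hy, hL, hdone'⟩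
      refine ⟨hF.trans hF' (by simp), L', O', y'', hc', by omega, fun j hj => ?_⟩
      rcases Nat.lt_succ_iff_lt_or_eq.1 hj with h | h
      · rcases hdone j h with h' | ⟨h1, h2⟩
        · exact Or.inl (hy j h')
        · exact Or.inr ⟨hL _ h1, hL _ h2⟩
      · rwa [Fin.ext h]
  · rintro t τ ⟨hF, L, O, y', hc, hsb, hdone⟩
    refine ⟨(hF₁'.weaken (by simp)).trans hF (by simp), ?_, L, O, hc.mem, hc.merging, ?_, ?_, ?_,
      hc.seg, hc.length, ?_⟩
    · have := Nat.mul_le_mul_right (1000 * (n + 1)) (Nat.add_le_add_left hymin (pieces X L₀))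
      rw [show pieces X L₀ + 10 = pieces X L₀ + 5 + 5 by rfl, add_mul (pieces X L₀ + 5)]
      omega
    · intro u hu
      by_contra hne
      obtain ⟨i, rfl⟩ := hrep u hu (hc.merging.ne_nil hne)
      have hi3 : i + 3 + 2 = i := by clear * -; revert i; decide
      have h1 : y' i = 0 := (hdone i i.isLt).resolve_right fun h => hne h.1
      have h2 : y' (i + 3) = 0 := by
        refine (hdone (i + 3) (Fin.isLt _)).resolve_right fun h => hne ?_
        rw [← h.2, hi3]
      have h3 := hc.demand i
      have h4 := headWt_pos_of_forall (fun P hP => (hc.merging.old _ hu P hP).1.1) hne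
      have h5 := headWt_le_wsum (L (r i))
      omega
    · intro c
      have h1 := hc.total
      have h2 := hym _ (isC5_sum_le_hits c hr hrX) (isC5_edge_le_hits c hr hrX)
      omega
    · rw [hF 40 (by decide), hF₁ 40 (by decide), hρ]
      simp
    · have := hc.count
      omega

end WordRAM

/-! ### Classification of the vertices by a five-cycle -/

namespace WordRAM

open BuoyColoring

/-- Adjacency of the vertex in the variable `30` to the vertex in the entry `k` of array `20`. -/
def adjTo (k : Fin 5) : Expr := .read 1 (.op .add (.op .mul (entry 20 k) (var 0)) (var 30))

/-- Test whether the vertex in the variable `30` is a twin of the vertex in the entry `i` of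
array `20`. -/
def twinTest (i : Fin 5) : Expr :=
  .op .mul (.op .mul (adjTo (i + 1)) (adjTo (i + 4)))
    (.op .lt (.op .add (adjTo (i + 2)) (adjTo (i + 3))) (.const 1))

/-- If the vertex in the variable `30` belongs to the part `i` of the buoy, then label it and count
it. If it has pieces left, then it becomes the representative of this part and of the buoy. -/
def assignPart (i : Fin 5) : Prog :=
  .ite (twinTest i)
    (.seq (.assign 7 (var 30) (.const (i.val + 1))) (.seq (set 41 (.op .add (var 41) (.const 1)))
      (.ite (.op .lt (.read 8 (var 30)) (.read 9 (var 30)))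
        (.seq (set 42 (.op .add (var 42) (.const 1)))
          (.seq (.assign 21 (.const i.val) (var 30)) (.assign 21 (.const 5) (var 30)))) .skip))) .skip

/-- Determine the parts of the buoy of the five-cycle in array `20`. The vertices of the part `i`
get the label `i + 1`, all others the label `0`. The variable `41` counts the vertices of the buoy,
and the variable `42` those of them that have pieces left. -/
def classify : Prog :=
  .seq (five fun i => .assign 21 (.const i.val) (entry 20 i)) (.seq (.assign 21 (.const 5) (entry 20 0))
    (.seq (set 41 (.const 0)) (.seq (set 42 (.const 0))
      (forTo 30 0 (.seq (.assign 7 (var 30) (.const 0)) (five assignPart))))))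

variable {B n W : ℕ} {σ : State} {g : SimpleGraph ℕ} {L : ℕ → List Piece} {c : Fin 5 → ℕ}

theorem ite_le_one (p : Prop) [Decidable p] : (if p then 1 else 0) ≤ 1 := by
  split_ifs <;> omega

open scoped Classical in
theorem twinTest_spec (hm : Mem g n L σ) (hc : ∀ i : Fin 5, σ 20 i = c i) (hcn : ∀ i, c i < n)
    (hu : σ 30 0 < n) (hB : n * n + 10 ≤ B) (i : Fin 5) :
    (twinTest i).eval σ = (if Twin g c i (σ 30 0) then 1 else 0) ∧ (twinTest i).Fits B σ := by
  set u := σ 30 0 with hudef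
  have hval : ∀ k, σ 1 (c k * n + u) = if g.Adj u (c k) then 1 else 0 := fun k => by
    rw [hm.adj _ (hcn k) _ hu]
    exact if_congr (g.adj_comm _ _) rfl rfl
  have hlt : ∀ k, c k * n + u < n * n := fun k => mul_add_lt (hcn k) hu
  have hk : ∀ k : Fin 5, k.val ≤ B := fun k => by
    have := k.isLt
    omega
  have hfit : ∀ k, (adjTo k).Fits B σ ∧ (adjTo k).eval σ = if g.Adj u (c k) then 1 else 0 := by
    intro k
    have := hlt k
    simp only [adjTo, Expr.Fits, Expr.eval, Op.eval, hc, hm.size, ← hudef, hval, Nat.zero_le,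
      true_and, and_true, hk]
    omega
  have hval' : (twinTest i).eval σ = if Twin g c i u then 1 else 0 := by
    simp only [twinTest, Expr.eval, Op.eval, (hfit _).2, Twin]
    split_ifs <;> simp_all
  refine ⟨hval', ?_⟩
  have h1B : 2 ≤ B := by omega
  refine ⟨⟨(hfit _).1, (hfit _).1, ?_⟩, ⟨⟨(hfit _).1, (hfit _).1, ?_⟩, ?_, ?_⟩, ?_⟩
  · simp only [Expr.eval, Op.eval, (hfit _).2]
    split_ifs <;> omega
  · simp only [Expr.eval, Op.eval, (hfit _).2]
    split_ifs <;> omega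
  · simp only [Expr.Fits]
    omega
  · exact (ite_le_one _).trans (by omega)
  · change (twinTest i).eval σ ≤ B
    rw [hval']
    split_ifs <;> omega

theorem run_assignPart (hm : Mem g n L σ) (hc : ∀ i : Fin 5, σ 20 i = c i) (hcn : ∀ i, c i < n)
    {u : ℕ} (hσu : σ 30 0 = u) (hu : u < n) (hB : n * n + 10 ≤ B) (h41 : σ 41 0 + 1 ≤ B)
    (h42 : σ 42 0 + 1 ≤ B) (i : Fin 5) :
    Run B (assignPart i) σ fun t τ => t ≤ 100 ∧ ((¬ Twin g c i u ∧ τ = σ) ∨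
      Twin g c i u ∧ Frame [7, 21, 41, 42] σ τ ∧ (∀ x, τ 7 x = if x = u then i.val + 1 else σ 7 x) ∧
        τ 41 0 = σ 41 0 + 1 ∧ ((L u = [] ∧ τ 21 = σ 21 ∧ τ 42 0 = σ 42 0) ∨
          L u ≠ [] ∧ τ 42 0 = σ 42 0 + 1 ∧
            ∀ x, τ 21 x = if x = i.val ∨ x = 5 then u else σ 21 x)) := by
  classical
  obtain ⟨h1, h2⟩ := twinTest_spec hm hc hcn (hσu ▸ hu) hB i
  have hi := i.isLt
  rw [hσu] at h1
  have hlt := (hm.holds u hu).lt_iff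
  rw [assignPart, run_ite, h1]
  refine ⟨h2, fun h => ?_, fun h => ?_⟩
  · have ht : Twin g c i u := by
      by_contra h'
      simp [h'] at h
    have hcost : (twinTest i).cost ≤ 60 := by simp [twinTest, adjTo]
    have h5B : 5 ≤ B := by omega
    by_cases hL : L u = []
    · have hle : σ 9 u ≤ σ 8 u := not_lt.1 fun h => hlt.1 h hL
      simp [hσu, hlt, hL, hle]
      refine ⟨by omega, ⟨by omega, by omega⟩, by omega, Or.inr ⟨ht, ?_, ?_⟩⟩
      · exact (((Frame.refl _ _).store (by simp)).store (by simp))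
      · intro x
        rw [store_same]
    · have hle : ¬ σ 9 u ≤ σ 8 u := not_le.2 (hlt.2 hL)
      simp [hσu, hlt, hL, hle]
      refine ⟨by omega, ⟨by omega, by omega⟩, by omega, ⟨by omega, by omega⟩, by omega, by omega,
        by omega,
        Or.inr ⟨ht, ?_, ?_, ?_⟩⟩
      · exact (((((Frame.refl _ _).store (by simp)).store (by simp)).store (by simp)).store
          (by simp)).store (by simp)
      · intro x
        rw [store_same]
      · intro x
        rw [store_same, store_same]
        by_cases h5 : x = 5 <;> by_cases hx : x = i.val <;> simp [h5, hx]
  · have ht : ¬ Twin g c i u := by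
      intro h'
      simp [h'] at h
    rw [run_skip]
    exact ⟨by simp [twinTest, adjTo], Or.inl ⟨ht, rfl⟩⟩

theorem run_assignParts (hm : Mem g n L σ) (hc : ∀ i : Fin 5, σ 20 i = c i) (hcn : ∀ i, c i < n)
    {u : ℕ} (hσu : σ 30 0 = u) (hu : u < n) (hB : n * n + 10 ≤ B) (h41 : σ 41 0 + 1 ≤ B)
    (h42 : σ 42 0 + 1 ≤ B) :
    Run B (five assignPart) σ fun t τ => t ≤ 500 ∧ ((¬ Buoy g c u ∧ τ = σ) ∨
      ∃ i : Fin 5, Twin g c i u ∧ Frame [7, 21, 41, 42] σ τ ∧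
        (∀ x, τ 7 x = if x = u then i.val + 1 else σ 7 x) ∧
        τ 41 0 = σ 41 0 + 1 ∧ ((L u = [] ∧ τ 21 = σ 21 ∧ τ 42 0 = σ 42 0) ∨
          L u ≠ [] ∧ τ 42 0 = σ 42 0 + 1 ∧
            ∀ x, τ 21 x = if x = i.val ∨ x = 5 then u else σ 21 x)) := by
  let P : Fin 5 → State → Prop := fun i τ => Twin g c i u ∧ Frame [7, 21, 41, 42] σ τ ∧
    (∀ x, τ 7 x = if x = u then i.val + 1 else σ 7 x) ∧
    τ 41 0 = σ 41 0 + 1 ∧ ((L u = [] ∧ τ 21 = σ 21 ∧ τ 42 0 = σ 42 0) ∨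
      L u ≠ [] ∧ τ 42 0 = σ 42 0 + 1 ∧
        ∀ x, τ 21 x = if x = i.val ∨ x = 5 then u else σ 21 x)
  refine (run_five (fun k s τ => s ≤ 100 * k ∧ ((τ = σ ∧ ∀ i : Fin 5, i.val < k → ¬ Twin g c i u) ∨
    ∃ i : Fin 5, i.val < k ∧ P i τ)) ⟨by simp, Or.inl ⟨rfl, by simp⟩⟩ ?_).mono ?_
  · rintro i s ρ ⟨hs, h | ⟨j, hj, hP⟩⟩
    · obtain ⟨rfl, hn⟩ := h
      refine (run_assignPart hm hc hcn hσu hu hB h41 h42 i).mono ?_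
      rintro t τ ⟨ht, ⟨h1, rfl⟩ | h⟩
      · refine ⟨by omega, Or.inl ⟨rfl, fun j hj => ?_⟩⟩
        rcases Nat.lt_succ_iff_lt_or_eq.1 hj with h | h
        · exact hn j h
        · rwa [Fin.ext h]
      · exact ⟨by omega, Or.inr ⟨i, by omega, h⟩⟩
    · have hF := hP.2.1
      have hni : ¬ Twin g c i u := fun h => by
        have := twin_unique h hP.1
        subst this
        omega
      have h42' : ρ 42 0 ≤ n + B + 1 := by
        rcases hP.2.2.2.2 with h | h <;> omega
      -- a vertex that has been assigned is not tested successfully again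
      obtain ⟨h1, h2⟩ := twinTest_spec (hm.frame hF (by decide)) (c := c)
        (by simpa [hF 20 (by decide)] using hc) hcn
        (by rw [hF 30 (by decide), hσu]; exact hu) hB i
      rw [hF 30 (by decide), hσu, if_neg hni] at h1
      rw [assignPart, run_ite, h1, run_skip]
      refine ⟨h2, fun h => absurd rfl h, fun _ => ⟨?_, Or.inr ⟨j, by omega, hP⟩⟩⟩
      have : (twinTest i).cost + 1 + 1 ≤ 100 := by simp [twinTest, adjTo]
      omega
  · rintro t τ ⟨ht, ⟨rfl, h⟩ | ⟨i, -, h⟩⟩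
    · exact ⟨ht, Or.inl ⟨fun ⟨i, hi⟩ => h i i.isLt hi, rfl⟩⟩
    · exact ⟨ht, Or.inr ⟨i, h⟩⟩

theorem card_filter_range_succ (p : ℕ → Prop) [DecidablePred p] (k : ℕ) :
    ((Finset.range (k + 1)).filter p).card =
      ((Finset.range k).filter p).card + if p k then 1 else 0 := by
  rw [Finset.range_add_one, Finset.filter_insert]
  split_ifs
  · rw [Finset.card_insert_of_notMem (by simp)]
  · simp

theorem card_filter_range_le (p : ℕ → Prop) [DecidablePred p] (k : ℕ) :
    ((Finset.range k).filter p).card ≤ k :=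
  (Finset.card_filter_le _ _).trans (by simp)

open scoped Classical in
theorem run_classify (hm : Mem g n L σ) (hc5 : IsC5 g c) (hc : ∀ i : Fin 5, σ 20 i = c i)
    (hcn : ∀ i, c i < n) (hB : n * n + n + 10 ≤ B) :
    Run B classify σ fun t τ => t ≤ 1000 * (n + 1) ∧ Frame [7, 21, 30, 41, 42] σ τ ∧
      (∀ u < n, ∀ i : Fin 5, τ 7 u = i.val + 1 ↔ Twin g c i u) ∧
      τ 41 0 = ((Finset.range n).filter (Buoy g c)).card ∧
      τ 42 0 = ((Finset.range n).filter fun u => Buoy g c u ∧ L u ≠ []).card ∧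
      (∀ i : Fin 5, Twin g c i (τ 21 i) ∧ τ 21 i < n ∧
        (L (τ 21 i) ≠ [] ∨ ∀ u < n, Twin g c i u → L u = [])) ∧
      Buoy g c (τ 21 5) ∧ τ 21 5 < n ∧ (L (τ 21 5) ≠ [] ∨ ∀ u < n, Buoy g c u → L u = []) := by
  have hn : 0 < n := (Nat.zero_le _).trans_lt (hcn 0)
  rw [classify, run_seq]
  refine (run_five (fun k s ρ => s ≤ 10 * k ∧ Frame [21] σ ρ ∧
    ∀ i : Fin 5, i.val < k → ρ 21 i = c i) ⟨by simp, Frame.refl _ _, by simp⟩ ?_).mono ?_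
  · rintro i s ρ ⟨hs, hF, h21⟩
    have hi := i.isLt
    simp only [run_assign, Expr.Fits, Expr.eval, Expr.cost, hF 20 (by decide), hc]
    refine ⟨by omega, by omega, by omega, hF.store (by simp), fun j hj => ?_⟩
    rw [store_same]
    split_ifs with h
    · rw [Fin.ext h]
    · exact h21 j (by omega)
  rintro t₁ ρ₁ ⟨ht₁, hF₁, h21⟩
  simp only [run_seq (p := set _ _), run_seq (p := .assign 21 _ _), run_assign, Expr.Fits, Expr.eval,
    Expr.cost, Nat.zero_le, true_and, hF₁ 20 (by decide), hc]
  refine ⟨by omega, Nat.zero_le _, ?_⟩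
  set ρ₂ := ((ρ₁.store 21 5 (c 0)).store 41 0 0).store 42 0 0 with hρ₂
  have hF₂ : Frame [7, 21, 30, 41, 42] σ ρ₂ :=
    (((hF₁.weaken (by simp)).store (by simp)).store (by simp)).store (by simp)
  have h21' : ∀ i : Fin 5, ρ₂ 21 i = c i := by
    intro i
    have hi := i.isLt
    rw [hρ₂, store_ne (by decide), store_ne (by decide), store_same, if_neg (by omega), h21 i hi]
  refine (run_forTo' (N := n) (fun k ρ => Frame [7, 21, 30, 41, 42] σ ρ ∧
      (∀ u < k, ∀ i : Fin 5, ρ 7 u = i.val + 1 ↔ Twin g c i u) ∧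
      ρ 41 0 = ((Finset.range k).filter (Buoy g c)).card ∧
      ρ 42 0 = ((Finset.range k).filter fun u => Buoy g c u ∧ L u ≠ []).card ∧
      (∀ i : Fin 5, Twin g c i (ρ 21 i) ∧ ρ 21 i < n ∧
        (L (ρ 21 i) ≠ [] ∨ ∀ u < k, Twin g c i u → L u = [])) ∧
      Buoy g c (ρ 21 5) ∧ ρ 21 5 < n ∧ (L (ρ 21 5) ≠ [] ∨ ∀ u < k, Buoy g c u → L u = []))
      600 (by decide) (by omega) (by rw [hF₂ 0 (by decide), hm.size]) ?_ ?_).mono ?_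
  · refine ⟨hF₂.store (by simp), by simp, by simp [hρ₂], by simp [hρ₂], ?_, ?_⟩
    · intro i
      rw [store_ne (by decide), h21']
      exact ⟨hc5.twin_self i, hcn i, Or.inr (by simp)⟩
    · rw [store_ne (by decide), hρ₂, store_ne (by decide), store_ne (by decide), store_eq]
      exact ⟨⟨0, hc5.twin_self 0⟩, hcn 0, Or.inr (by simp)⟩
  · rintro k ρ hk hρk hρn ⟨hF, h7, h41, h42, hrep, hrep5⟩
    have hle1 := card_filter_range_le (Buoy g c) k
    have hle2 := card_filter_range_le (fun u => Buoy g c u ∧ L u ≠ []) k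
    simp only [run_seq (p := .assign 7 _ _), run_assign, Expr.Fits, Expr.eval, Expr.cost, Nat.zero_le,
      true_and, hρk]
    have hFρ : Frame [7, 21, 30, 41, 42] σ (ρ.store 7 k 0) := hF.store (by simp)
    refine (run_assignParts (hm.frame hFρ (by decide)) (c := c)
      (by rw [hFρ 20 (by decide)]; exact hc) hcn (u := k) (by simpa using hρk) hk (by omega)
      (by simp; omega) (by simp; omega)).mono ?_
    have hlt : ∀ {u}, u < k + 1 → u = k ∨ u < k := fun h => by omega
    have hsum1 := card_filter_range_succ (Buoy g c) k
    have hsum2 := card_filter_range_succ (fun u => Buoy g c u ∧ L u ≠ []) k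
    rintro t τ ⟨ht, ⟨hnb, rfl⟩ | ⟨i, hi, hFτ, h7', h41', hcase⟩⟩
    · refine ⟨by omega, by simpa using hρk, by simpa using hρn, (hFρ.store (by simp)), ?_, ?_, ?_, ?_, ?_⟩
      · intro u hu j
        rw [store_ne (by decide), store_same]
        rcases hlt hu with rfl | h
        · simp only [if_true]
          exact ⟨fun h => absurd h (by omega), fun h => absurd ⟨j, h⟩ hnb⟩
        · rw [if_neg h.ne]
          exact h7 u h j
      · rw [hsum1, if_neg hnb]
        simpa using h41
      · rw [hsum2, if_neg fun h => hnb h.1]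
        simpa using h42
      · intro j
        simp only [store_ne (show 21 ≠ 30 by decide), store_ne (show 21 ≠ 7 by decide)]
        obtain ⟨e1, e2, e3⟩ := hrep j
        refine ⟨e1, e2, e3.imp_right fun h u hu hju => ?_⟩
        rcases hlt hu with rfl | h'
        · exact absurd ⟨j, hju⟩ hnb
        · exact h u h' hju
      · simp only [store_ne (show 21 ≠ 30 by decide), store_ne (show 21 ≠ 7 by decide)]
        obtain ⟨e1, e2, e3⟩ := hrep5
        refine ⟨e1, e2, e3.imp_right fun h u hu hju => ?_⟩
        rcases hlt hu with rfl | h'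
        · exact absurd hju hnb
        · exact h u h' hju
    · have hb : Buoy g c k := ⟨i, hi⟩
      rw [store_ne (by decide)] at h41'
      simp only [store_ne (show 21 ≠ 7 by decide), store_ne (show 42 ≠ 7 by decide)] at hcase
      refine ⟨by omega, by rw [hFτ 30 (by decide)]; simpa using hρk,
        by rw [hFτ 0 (by decide)]; simpa using hρn, (hFρ.trans hFτ (by simp)).store (by simp),
        ?_, ?_, ?_, ?_, ?_⟩
      · intro u hu j
        rw [store_ne (by decide), h7' u]
        rcases hlt hu with rfl | h
        · rw [if_pos rfl]
          refine ⟨fun h => ?_, fun h => ?_⟩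
          · have : i = j := Fin.ext (by omega)
            rwa [← this]
          · rw [twin_unique hi h]
        · rw [if_neg h.ne, store_same, if_neg h.ne]
          exact h7 u h j
      · rw [store_ne (by decide), hsum1, if_pos hb, h41', h41]
      · rw [store_ne (by decide), hsum2]
        rcases hcase with ⟨hL, -, e⟩ | ⟨hL, e, -⟩
        · rw [if_neg fun h => h.2 hL, e, h42, add_zero]
        · rw [if_pos ⟨hb, hL⟩, e, h42]
      · intro j
        have hj := j.isLt
        rw [store_ne (by decide)]
        obtain ⟨e1, e2, e3⟩ := hrep j
        rcases hcase with ⟨hL, e, -⟩ | ⟨hL, -, e⟩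
        · rw [e]
          refine ⟨e1, e2, e3.imp_right fun h u hu hju => ?_⟩
          rcases hlt hu with rfl | h'
          · exact hL
          · exact h u h' hju
        · rw [e j]
          by_cases hij : i = j
          · subst hij
            rw [if_pos (Or.inl rfl)]
            exact ⟨hi, hk, Or.inl hL⟩
          · have hne : ¬ (j.val = i.val ∨ j.val = 5) := by
              rintro (h | h)
              · exact hij (Fin.ext h.symm)
              · omega
            rw [if_neg hne]
            refine ⟨e1, e2, e3.imp_right fun h u hu hju => ?_⟩
            rcases hlt hu with rfl | h'
            · exact absurd (twin_unique hi hju) hij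
            · exact h u h' hju
      · rw [store_ne (by decide)]
        obtain ⟨e1, e2, e3⟩ := hrep5
        rcases hcase with ⟨hL, e, -⟩ | ⟨hL, -, e⟩
        · rw [e]
          refine ⟨e1, e2, e3.imp_right fun h u hu hju => ?_⟩
          rcases hlt hu with rfl | h'
          · exact hL
          · exact h u h' hju
        · rw [e 5, if_pos (Or.inr rfl)]
          exact ⟨hb, hk, Or.inl hL⟩
  · rintro t τ ⟨ht, ⟨hF, h⟩, -⟩
    exact ⟨by omega, hF, h⟩

end WordRAM

/-! ### Contraction of a buoy -/

namespace WordRAM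

open BuoyColoring

/-- Merge the part `i` of the buoy, and let its representative take over the pieces. Their total
weight goes to the entry `i` of array `22`. -/
def mergePart (i : Fin 5) : Prog :=
  .seq (set 39 (.const (i.val + 1))) (.seq greedyMerge
    (.seq (.assign 22 (.const i.val) (var 35)) (handOver (entry 21 i))))

/-- Merge the buoy that has been found by `classify`: first each of its parts, then the
representatives of the parts. -/
def mergeBuoy : Prog :=
  .seq (five mergePart) (.seq cycleMerge (handOver (.read 21 (.const 5))))

/-- Merge the buoy of the five-cycle in array `20`, if two of its vertices have pieces left. -/
def contractBuoy : Prog := .seq classify (.ite (.op .lt (.const 1) (var 42)) mergeBuoy .skip)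

variable {B n W : ℕ} {σ : State} {g : SimpleGraph ℕ} {w : ℕ → ℕ} {L : ℕ → List Piece}
  {c : Fin 5 → ℕ} {X : Finset ℕ} {O : List Piece} {r₀ : ℕ}

theorem pieces_contract {Y : Finset ℕ} (hXY : X ⊆ Y) (hr₀ : r₀ ∈ X) :
    pieces Y (contract X r₀ O L) + pieces X L = pieces Y L + O.length := by
  have h1 : pieces Y (contract X r₀ O L) = ∑ r ∈ Y \ X, (L r).length + O.length := by
    rw [pieces, ← Finset.sum_sdiff hXY]
    congr 1
    · refine Finset.sum_congr rfl fun r hr => ?_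
      have hrX := (Finset.mem_sdiff.1 hr).2
      rw [contract, if_neg, if_neg hrX]
      rintro rfl
      exact hrX hr₀
    · rw [Finset.sum_eq_single_of_mem r₀ hr₀]
      · simp [contract]
      · intro r hr hne
        simp [contract, hne, hr]
  have h2 : pieces Y L = ∑ r ∈ Y \ X, (L r).length + pieces X L := by
    rw [pieces, pieces, ← Finset.sum_sdiff hXY]
  omega

theorem eq_of_contract_ne_nil {u : ℕ} (hu : u ∈ X) (h : contract X r₀ O L u ≠ []) : u = r₀ := by
  by_contra hne
  simp [contract, hne, hu] at h

theorem ne_nil_of_contract_ne_nil {u : ℕ} (hr₀ : L r₀ ≠ [] ∨ O = [])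
    (h : contract X r₀ O L u ≠ []) : L u ≠ [] := by
  rw [contract] at h
  split_ifs at h with h1 h2
  · rw [h1]
    exact hr₀.resolve_right h
  · exact absurd rfl h
  · exact h

theorem run_handOver {j : ℕ} (hj : j ≤ B) (hr : σ 21 j = r₀) {L' : ℕ → List Piece}
    (hm : Mem g n L' σ) (hL : ∀ r ∈ X, L' r = []) (hL₀ : ∀ r ∉ X, L' r = L r) {ns : ℕ}
    (h40 : σ 40 0 = ns) (hO : Seg n σ ns O) (hns : ns + O.length = σ 13 0) :
    Run B (handOver (.read 21 (.const j))) σ fun t τ => t ≤ 30 ∧ Frame [8, 9, 10] σ τ ∧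
      Mem g n (contract X r₀ O L) τ := by
  have := hm.handOver (r₀ := r₀) hL hL₀ hO hns
  simp [handOver, hr, hj, h40]
  exact ⟨(((Frame.refl _ _).store (by simp)).store (by simp)).store (by simp), this⟩

abbrev partFrame : List ℕ := [9, 22, 39] ++ mergeFrame

theorem run_mergePart (hm : Mem g n L σ) (hs : Stage g n W w L) {i : Fin 5}
    (hX : ∀ u, u ∈ X ↔ u < n ∧ σ 7 u = i.val + 1) (hmod : IsModule g X) (hr₀ : σ 21 i ∈ X)
    (hperf : IsPerfectOrder g (degIn g (Finset.range n)) {v | v ∈ X ∧ L v ≠ []})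
    (hB : (σ 13 0 + pieces X L + n + 2) * (n + 2) ≤ B) (hBW : (pieces X L + 2) * W ≤ B)
    (hB10 : 10 ≤ B) :
    Run B (mergePart i) σ fun t τ => Frame partFrame σ τ ∧
      t ≤ (pieces X L + 2) * (((X.filter fun r => L r ≠ []).card + 1) * (1000 * (n + 1))) + 100 ∧
      ∃ O, Mem g n (contract X (σ 21 i) O L) τ ∧ Stage g n W w (contract X (σ 21 i) O L) ∧
        O.length ≤ pieces X L ∧ τ 13 0 = σ 13 0 + O.length ∧
        ∀ j : Fin 5, τ 22 j = if j = i then wsum O else σ 22 j := by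
  have hi := i.isLt
  simp only [mergePart, run_seq (p := set _ _), run_assign, Expr.Fits, Expr.eval, Expr.cost,
    Nat.zero_le, true_and]
  refine ⟨by omega, ?_⟩
  set ρ := σ.store 39 0 (i.val + 1) with hρ
  have hF₀ : Frame [39] σ ρ := (Frame.refl _ _).store (by simp)
  have e13 : ρ 13 = σ 13 := hF₀ 13 (by decide)
  rw [run_seq]
  refine (run_greedyMerge (hm.frame hF₀ (by decide)) hs (X := X) ?_ hperf (by rwa [e13]) hBW).mono ?_
  · intro u
    rw [hX, hρ, store_ne (by decide), store_eq]
  rintro t₁ ρ₁ ⟨hF₁, ht₁, L', O, hm₁, hmer, hnil, hcb, h40, hseg, hlen, hOle, h35⟩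
  rw [e13] at h40 hseg hlen
  simp only [run_seq (p := .assign _ _ _), run_assign, Expr.Fits, Expr.eval, Expr.cost, Nat.zero_le,
    true_and, h35]
  refine ⟨by omega, ?_⟩
  have hF₂ : Frame [22] ρ₁ (ρ₁.store 22 i.val (wsum O)) := (Frame.refl _ _).store (by simp)
  have e21 : (ρ₁.store 22 i.val (wsum O)) 21 = σ 21 := by
    rw [hF₂ 21 (by decide), hF₁ 21 (by decide), hF₀ 21 (by decide)]
  refine (run_handOver (j := i.val) (r₀ := σ 21 i) (X := X) (L := L) (by omega) (by rw [e21])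
    (hm₁.frame hF₂ (by decide)) hnil hmer.outside (by rw [hF₂ 40 (by decide), h40])
    (hseg.frame hF₂ (by decide)) (by rw [hF₂ 13 (by decide), hlen])).mono ?_
  rintro t₂ τ ⟨ht₂, hF₃, hm₃⟩
  refine ⟨?_, by omega, O, hm₃, ?_, hOle, ?_, ?_⟩
  · exact (((hF₀.weaken (l' := partFrame) (by simp)).trans hF₁ (by simp)).trans hF₂
      (by simp)).trans hF₃ (by simp)
  · exact hmer.stage hs (fun r hr => ((hX r).1 hr).1) hmod hr₀ hnil fun c => hcb.wsum_le_hits c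
  · rw [hF₃ 13 (by decide), hF₂ 13 (by decide), hlen]
  · intro j
    rw [hF₃ 22 (by decide), store_same, hF₁ 22 (by decide), hF₀ 22 (by decide)]
    exact if_congr (by rw [Fin.ext_iff]) rfl rfl

abbrev buoyFrame : List ℕ := [9, 22, 23, 39, 44, 45, 46] ++ mergeFrame

open scoped Classical in
theorem sum_card_parts_le (c : Fin 5 → ℕ) (L : ℕ → List Piece) (n : ℕ) :
    ∑ i, ((Finset.range n).filter fun u => Twin g c i u ∧ L u ≠ []).card ≤
      ((Finset.range n).filter fun u => Buoy g c u ∧ L u ≠ []).card := by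
  rw [← Finset.card_biUnion]
  · refine Finset.card_le_card fun u hu => ?_
    simp only [Finset.mem_biUnion, Finset.mem_univ, true_and, Finset.mem_filter] at hu ⊢
    obtain ⟨i, h1, h2, h3⟩ := hu
    exact ⟨h1, ⟨i, h2⟩, h3⟩
  · intro i _ j _ hij
    rw [Function.onFun, Finset.disjoint_left]
    intro u hu hu'
    simp only [Finset.mem_filter] at hu hu'
    exact hij (twin_unique hu.2.1 hu'.2.1)

open scoped Classical in
/-- The invariant for the five parts: those that are done have at most one vertex with pieces left,
namely their representative, and the others are unchanged. -/
theorem run_mergeBuoy (hP : NoPath g) (hH : NoHouse g) (hg : ∀ u v, g.Adj u v → u < n)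
    (hm : Mem g n L σ) (hs : Stage g n W w L) (hc : IsC5 g c)
    (hlab : ∀ u < n, ∀ i : Fin 5, σ 7 u = i.val + 1 ↔ Twin g c i u)
    (hrep : ∀ i : Fin 5, Twin g c i (σ 21 i) ∧
      (L (σ 21 i) ≠ [] ∨ ∀ u < n, Twin g c i u → L u = []))
    (hrep5 : Buoy g c (σ 21 5) ∧ L (σ 21 5) ≠ [])
    (hperf : ∀ i, IsPerfectOrder g (degIn g (Finset.range n)) {v | Twin g c i v ∧ L v ≠ []})
    (hp : pieces (Finset.range n) L ≤ 6 * n) (hB : (σ 13 0 + 40 * n + 10) * (n + 2) ≤ B)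
    (hBW : (60 * n + 10) * (W + 1) ≤ B) :
    Run B mergeBuoy σ fun t τ => Frame buoyFrame σ τ ∧
      t ≤ (((Finset.range n).filter fun u => Buoy g c u ∧ L u ≠ []).card + 6) *
        ((6 * n + 10) * (1000 * (n + 1))) + 600 ∧
      ∃ L', Mem g n L' τ ∧ Stage g n W w L' ∧ (∀ u, L' u ≠ [] → L u ≠ []) ∧
        (∀ u, Buoy g c u → L' u ≠ [] → u = σ 21 5) ∧
        pieces (Finset.range n) L' ≤ pieces (Finset.range n) L + 5 ∧
        τ 13 0 ≤ σ 13 0 + 36 * n + 5 := by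
  have htn : ∀ {i u}, Twin g c i u → u < n := fun h => hg _ _ h.1
  have hB10 : 10 ≤ B := by nlinarith
  have hWB : W ≤ B := by nlinarith
  set X : Fin 5 → Finset ℕ := fun i => (Finset.range n).filter (Twin g c i) with hXdef
  have hX : ∀ i u, u ∈ X i ↔ Twin g c i u := fun i u => by
    rw [hXdef, Finset.mem_filter, Finset.mem_range]
    exact ⟨fun h => h.2, fun h => ⟨htn h, h⟩⟩
  have hXn : ∀ i, X i ⊆ Finset.range n := fun i => Finset.filter_subset _ _
  have hple : ∀ (Y : Finset ℕ) (L' : ℕ → List Piece), Y ⊆ Finset.range n →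
      pieces Y L' ≤ pieces (Finset.range n) L' := fun Y L' h => Finset.sum_le_sum_of_subset h
  set a : Fin 5 → ℕ := fun i =>
    ((Finset.range n).filter fun u => Twin g c i u ∧ L u ≠ []).card with ha
  set T : ℕ := (6 * n + 10) * (1000 * (n + 1)) with hT
  have hr : ∀ i : Fin 5, Twin g c i (σ 21 i) := fun i => (hrep i).1
  have hr5 : IsC5 g fun i : Fin 5 => σ 21 i := IsC5.of_twin hP hH hc hr
  rw [mergeBuoy, run_seq]
  refine (run_five (fun k s ρ => Frame partFrame σ ρ ∧ ∃ L', Mem g n L' ρ ∧ Stage g n W w L' ∧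
      (∀ u, L' u ≠ [] → L u ≠ []) ∧ (∀ i : Fin 5, i.val < k → ρ 22 i = wsum (L' (σ 21 i)) ∧
        ∀ u, Twin g c i u → L' u ≠ [] → u = σ 21 i) ∧
      (∀ i : Fin 5, k ≤ i.val → ∀ u, Twin g c i u → L' u = L u) ∧
      pieces (Finset.range n) L' ≤ pieces (Finset.range n) L ∧ ρ 13 0 ≤ σ 13 0 + 6 * n * k ∧
      s ≤ (∑ i : Fin 5 with i.val < k, a i) * T + k * (T + 100)) ?_ ?_).mono ?_
  · exact ⟨Frame.refl _ _, L, hm, hs, fun _ h => h, by simp, fun _ _ _ _ => rfl, le_rfl, by simp,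
      by simp⟩
  · rintro i s ρ ⟨hF, L', hm', hs', hsub, hpart, hrest, hple', h13, hst⟩
    have hi := i.isLt
    have e21 : ρ 21 = σ 21 := hF 21 (by decide)
    have hpi := hple _ L' (hXn i)
    have h13' : ρ 13 0 ≤ σ 13 0 + 30 * n := by
      have : 6 * n * i.val ≤ 6 * n * 5 := Nat.mul_le_mul_left _ hi.le
      omega
    refine (run_mergePart hm' hs' (X := X i) ?_ ?_ ?_ ?_ ?_ ?_ hB10).mono ?_
    · intro u
      rw [hX, hF 7 (by decide)]
      exact ⟨fun h => ⟨htn h, (hlab u (htn h) i).2 h⟩, fun h => (hlab u h.1 i).1 h.2⟩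
    · intro u hu x hx y hy
      rw [hX] at hu hx hy
      exact (adj_iff_of_not_twin hP hH hc hu hx hy).1
    · rw [e21, hX]
      exact hr i
    · intro a ha b hb c hc d hd
      exact hperf i a ⟨(hX i a).1 ha.1, hsub a ha.2⟩ b ⟨(hX i b).1 hb.1, hsub b hb.2⟩
        c ⟨(hX i c).1 hc.1, hsub c hc.2⟩ d ⟨(hX i d).1 hd.1, hsub d hd.2⟩
    · refine le_trans (Nat.mul_le_mul_right _ ?_) hB
      omega
    · refine le_trans (Nat.mul_le_mul ?_ (Nat.le_succ W)) hBW
      omega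
    · rintro t τ ⟨hFτ, ht, O, hmO, hsO, hO, h13τ, h22⟩
      rw [e21] at hmO hsO
      have hri : σ 21 i ∈ X i := (hX i _).2 (hr i)
      have hpc := pieces_contract (L := L') (O := O) (hXn i) hri
      have hO' : L' (σ 21 i) ≠ [] ∨ O = [] := by
        rw [hrest i le_rfl _ (hr i)]
        refine (hrep i).2.imp_right fun h => List.length_eq_zero_iff.1 (Nat.le_zero.1 (hO.trans ?_))
        refine le_of_eq (Finset.sum_eq_zero fun u hu => ?_)
        rw [hX] at hu
        rw [hrest i le_rfl u hu, h u (htn hu) hu, List.length_nil]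
      have hout : ∀ j ≠ i, ∀ u, Twin g c j u → contract (X i) (σ 21 i) O L' u = L' u := by
        intro j hji u hu
        have hui : u ∉ X i := fun h => hji (twin_unique hu ((hX i u).1 h))
        rw [contract, if_neg, if_neg hui]
        rintro rfl
        exact hui hri
      refine ⟨hF.trans hFτ (by simp), _, hmO, hsO, fun u hu => hsub u (ne_nil_of_contract_ne_nil hO' hu),
        ?_, ?_, by omega, by rw [mul_add, mul_one]; omega, ?_⟩
      · intro j hj
        rw [h22]
        by_cases hji : j = i
        · subst hji
          rw [if_pos rfl]
          exact ⟨by simp [contract], fun u hu h => eq_of_contract_ne_nil ((hX j u).2 hu) h⟩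
        · have hji' : j.val ≠ i.val := fun h => hji (Fin.ext h)
          obtain ⟨h1, h2⟩ := hpart j (by omega)
          rw [if_neg hji, hout j hji _ (hr j)]
          exact ⟨h1, fun u hu h => h2 u hu (by rwa [← hout j hji u hu])⟩
      · intro j hj u hu
        have hji : j ≠ i := fun h => by
          rw [h] at hj
          omega
        rw [hout j hji u hu]
        exact hrest j (by omega) u hu
      · have hai : ((X i).filter fun r => L' r ≠ []).card ≤ a i := by
          refine Finset.card_le_card fun u hu => ?_
          simp only [Finset.mem_filter, hX, Finset.mem_range] at hu ⊢
          exact ⟨htn hu.1, hu.1, hsub u hu.2⟩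
        have ht' : t ≤ (a i + 1) * T + 100 := by
          refine ht.trans (Nat.add_le_add_right ?_ _)
          calc _ ≤ (6 * n + 10) * ((a i + 1) * (1000 * (n + 1))) :=
                Nat.mul_le_mul (by omega) (Nat.mul_le_mul_right _ (by omega))
            _ = (a i + 1) * T := by
                rw [hT]
                ring
        rw [sum_filter_lt_succ]
        calc s + t ≤ _ + ((a i + 1) * T + 100) := Nat.add_le_add hst ht'
          _ = _ := by ring
  rintro t₁ ρ ⟨hF, L', hm', hs', hsub, hpart, -, hple', h13, ht₁⟩
  have e21 : ρ 21 = σ 21 := hF 21 (by decide)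
  set M := (Finset.range n).filter (Buoy g c) with hMdef
  have hM : ∀ u, u ∈ M ↔ Buoy g c u := fun u => by
    rw [hMdef, Finset.mem_filter, Finset.mem_range]
    exact ⟨fun h => h.2, fun h => ⟨htn h.choose_spec, h⟩⟩
  have hMn : M ⊆ Finset.range n := Finset.filter_subset _ _
  have hpM := hple _ L' hMn
  have hmod : IsModule g M := by
    intro u hu x hx y hy
    rw [hM] at hu hx hy
    exact (adj_iff_of_not_buoy hP hH hc hu hx hy).1
  have hws : ∀ i : Fin 5, wsum (L' (σ 21 i)) ≤ 6 * n * W := by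
    intro i
    refine (wsum_le_length_mul fun P hP => (hs'.pos _ P hP).2).trans (Nat.mul_le_mul_right _ ?_)
    refine le_trans ?_ (hple'.trans hp)
    exact Finset.single_le_sum (f := fun r => (L' r).length) (fun _ _ => Nat.zero_le _)
      (Finset.mem_range.2 (htn (hr i)))
  rw [run_seq]
  refine (run_cycleMerge (X := M) (r := fun i : Fin 5 => σ 21 i) hm' hs' hr5 ?_ ?_ ?_ ?_ ?_ ?_ ?_
    hWB).mono ?_
  · exact fun i => (hM _).2 ⟨i, hr i⟩
  · exact fun u hu => Finset.mem_range.1 (hMn hu)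
  · intro u hu hu'
    obtain ⟨i, hi⟩ := (hM u).1 hu
    exact ⟨i, (hpart i i.isLt).2 u hi hu'⟩
  · exact fun i => by rw [e21]
  · exact fun i => (hpart i i.isLt).1
  · refine le_trans (Nat.mul_le_mul_right _ ?_) hB
    omega
  · have h1 : ∑ i : Fin 5, wsum (L' (σ 21 i)) ≤ 5 * (6 * n * W) :=
      (Finset.sum_le_sum fun i _ => hws i).trans (by simp)
    nlinarith
  rintro t₂ ρ₂ ⟨hF₂, ht₂, L'', O, hm₂, hmer, hnil, hhits, h40, hseg, hlen, hOle⟩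
  have f21 : ρ₂ 21 = σ 21 := by rw [hF₂ 21 (by decide), e21]
  refine (run_handOver (j := 5) (r₀ := σ 21 5) (X := M) (L := L') (by omega) (by rw [f21]) hm₂ hnil
    hmer.outside h40 hseg hlen).mono ?_
  rintro t₃ τ ⟨ht₃, hF₃, hm₃⟩
  have h5M : σ 21 5 ∈ M := (hM _).2 hrep5.1
  have hpc := pieces_contract (L := L') (O := O) hMn h5M
  refine ⟨?_, ?_, _, hm₃, ?_, ?_, ?_, by omega, ?_⟩
  · exact ((hF.weaken (l' := buoyFrame) (by simp)).trans hF₂ (by simp)).trans hF₃ (by simp)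
  · have h1 : ∑ i : Fin 5 with i.val < 5, a i ≤
        ((Finset.range n).filter fun u => Buoy g c u ∧ L u ≠ []).card := by
      rw [Finset.filter_true_of_mem fun i _ => i.isLt]
      exact sum_card_parts_le c L n
    have h2 := Nat.mul_le_mul_right T h1
    have h3 : t₂ ≤ T := ht₂.trans (Nat.mul_le_mul_right _ (by omega))
    rw [add_mul]
    omega
  · exact hmer.stage hs' (fun r hr => Finset.mem_range.1 (hMn hr)) hmod h5M hnil hhits
  · intro u hu
    by_cases h5 : u = σ 21 5
    · rw [h5]
      exact hrep5.2
    · refine hsub u ?_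
      rw [contract, if_neg h5] at hu
      split_ifs at hu with h
      · exact absurd rfl hu
      · exact hu
  · exact fun u hu h => eq_of_contract_ne_nil ((hM u).2 hu) h
  · rw [hF₃ 13 (by decide), ← hlen]
    omega

/-- The number of vertices below `n` that have pieces left. -/
def numAlive (n : ℕ) (L : ℕ → List Piece) : ℕ := ((Finset.range n).filter fun u => L u ≠ []).card

abbrev contractFrame : List ℕ := [7, 21, 41, 42] ++ buoyFrame

open scoped Classical in
/-- The number of vertices with pieces is a potential for the time, for the number of rows and for
the number of pieces: if the buoy has `m ≥ 2` such vertices, then the contraction takes time `O(m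
n²)`, writes `O(n)` rows, adds at most five pieces, and lowers the potential by `m - 1`. -/
theorem run_contractBuoy (hP : NoPath g) (hH : NoHouse g) (hg : ∀ u v, g.Adj u v → u < n)
    (hm : Mem g n L σ) (hs : Stage g n W w L) (hc : IsC5 g c) (h20 : ∀ i : Fin 5, σ 20 i = c i)
    (hperf : ∀ i, IsPerfectOrder g (degIn g (Finset.range n)) {v | Twin g c i v ∧ L v ≠ []})
    (hp : pieces (Finset.range n) L + 5 * numAlive n L ≤ 6 * n)
    (hB : (σ 13 0 + 40 * n + 10) * (n + 2) ≤ B) (hBW : (60 * n + 10) * (W + 1) ≤ B) :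
    Run B contractBuoy σ fun t τ => Frame contractFrame σ τ ∧
      ∃ L', Mem g n L' τ ∧ Stage g n W w L' ∧ (∀ u, L' u ≠ [] → L u ≠ []) ∧
        (∀ u v, Buoy g c u → Buoy g c v → L' u ≠ [] → L' v ≠ [] → u = v) ∧
        pieces (Finset.range n) L' + 5 * numAlive n L' ≤ 6 * n ∧
        τ 13 0 + 41 * (n + 1) * numAlive n L' ≤ σ 13 0 + 41 * (n + 1) * numAlive n L ∧
        t + numAlive n L' * (100000 * ((n + 1) * (n + 1))) ≤
          numAlive n L * (100000 * ((n + 1) * (n + 1))) + 2000 * (n + 1) := by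
  have hcn : ∀ i, c i < n := fun i => hg _ _ (hc i).1
  rw [contractBuoy, run_seq]
  refine (run_classify hm hc h20 hcn (by nlinarith)).mono ?_
  rintro t₁ ρ ⟨ht₁, hF, hlab, -, h42, hrep, hrep5⟩
  set m := ((Finset.range n).filter fun u => Buoy g c u ∧ L u ≠ []).card with hmdef
  have hmn : m ≤ n := card_filter_range_le _ _
  have hnB : n + 10 ≤ B := by nlinarith
  rw [run_ite, run_skip]
  simp only [Expr.Fits, Expr.eval, Op.eval, Expr.cost, h42]
  refine ⟨⟨by omega, Nat.zero_le _, (ite_le_one _).trans (by omega)⟩, fun h => ?_, fun h => ?_⟩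
  · have h1m : 1 < m := by
      by_contra h'
      simp [h'] at h
    have hrep5' : L (ρ 21 5) ≠ [] := by
      refine hrep5.2.2.resolve_right fun h => ?_
      have : m = 0 := by
        rw [hmdef, Finset.card_eq_zero, Finset.filter_eq_empty_iff]
        rintro u hu ⟨h1, h2⟩
        exact h2 (h u (Finset.mem_range.1 hu) h1)
      omega
    refine (run_mergeBuoy hP hH hg (hm.frame hF (by decide)) hs hc hlab
      (fun i => ⟨(hrep i).1, (hrep i).2.2⟩) ⟨hrep5.1, hrep5'⟩ hperf (by omega)
      (by rwa [hF 13 (by decide)]) hBW).mono ?_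
    rintro t₂ τ ⟨hF₂, ht₂, L', hm', hs', hsub, huniq, hp', h13⟩
    rw [hF 13 (by decide)] at h13
    rw [← hmdef] at ht₂
    -- of the `m` vertices of the buoy with pieces at most one has pieces afterwards
    have hal : numAlive n L' + m ≤ numAlive n L + 1 := by
      have h1 : (Finset.range n).filter (fun u => L' u ≠ []) ⊆ insert (ρ 21 5)
          (((Finset.range n).filter fun u => L u ≠ []).filter fun u => ¬ Buoy g c u) := by
        intro u hu
        simp only [Finset.mem_filter, Finset.mem_insert] at hu ⊢
        by_cases hb : Buoy g c u
        · exact Or.inl (huniq u hb hu.2)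
        · exact Or.inr ⟨⟨hu.1, hsub u hu.2⟩, hb⟩
      have h2 := (Finset.card_le_card h1).trans (Finset.card_insert_le _ _)
      have h3 := Finset.card_filter_add_card_filter_not
        (s := (Finset.range n).filter fun u => L u ≠ []) (Buoy g c)
      have h4 : (((Finset.range n).filter fun u => L u ≠ []).filter (Buoy g c)).card = m := by
        rw [hmdef, Finset.filter_filter]
        simp only [and_comm]
      rw [numAlive, numAlive]
      omega
    refine ⟨(hF.weaken (by simp)).trans hF₂ (by simp), L', hm', hs', hsub, ?_, by omega, ?_, ?_⟩
    · exact fun u v hu hv h1 h2 => (huniq u hu h1).trans (huniq v hv h2).symm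
    · have h1 := Nat.mul_le_mul_left (41 * (n + 1)) (show numAlive n L' + 1 ≤ numAlive n L by omega)
      rw [mul_add _ _ 1, mul_one] at h1
      omega
    · have h2 : (m + 6) * ((6 * n + 10) * (1000 * (n + 1))) ≤
          (m + 6) * (10000 * ((n + 1) * (n + 1))) := by
        refine Nat.mul_le_mul_left _ ?_
        nlinarith
      generalize (n + 1) * (n + 1) = Q at h2 ⊢
      have h1 := Nat.mul_le_mul_right (100000 * Q) hal
      have h3 := Nat.mul_le_mul_right Q (show 2 ≤ m by omega)
      rw [add_mul, add_mul, one_mul] at h1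
      have h4 : (m + 6) * (10000 * Q) = 10000 * (m * Q) + 60000 * Q := by ring
      have h5 : m * (100000 * Q) = 100000 * (m * Q) := by ring
      omega
  · have h1m : m ≤ 1 := by
      by_contra h'
      simp [not_le.1 h'] at h
    refine ⟨hF.weaken (by simp), L, hm.frame hF (by decide), hs, fun _ h => h, ?_, hp,
      by rw [hF 13 (by decide)], by omega⟩
    intro u v hu hv h1 h2
    refine Finset.card_le_one.1 h1m u ?_ v ?_
    · exact Finset.mem_filter.2 ⟨Finset.mem_range.2 (hg _ _ hu.choose_spec.1), hu, h1⟩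
    · exact Finset.mem_filter.2 ⟨Finset.mem_range.2 (hg _ _ hv.choose_spec.1), hv, h2⟩

end WordRAM

/-! ### Degrees and initial pieces -/

namespace WordRAM

open BuoyColoring

/-- Compute the degree of the vertex in the variable `30`. -/
def degree : Prog :=
  .seq (.assign 6 (var 30) (.const 0)) (forTo 31 0 (.assign 6 (var 30)
    (.op .add (.read 6 (var 30)) (.read 1 (.op .add (.op .mul (var 30) (var 0)) (var 31))))))

/-- Compute all degrees, and give each vertex of positive weight a single piece, which contains only
this vertex. -/
def setup : Prog :=
  .seq (forTo 30 0 (.seq degree (.seq (.assign 8 (var 30) (var 30))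
    (.seq (.assign 9 (var 30) (.op .add (var 30) (.op .lt (.const 0) (.read 2 (var 30)))))
    (.seq (.assign 10 (var 30) (.read 2 (var 30))) (.seq (.assign 11 (var 30) (.read 2 (var 30)))
      (.assign 12 (.op .add (.op .mul (var 30) (var 0)) (var 30)) (.const 1)))))))) (set 13 (var 0))

variable {B n W : ℕ} {σ : State} {g : SimpleGraph ℕ} {w : ℕ → ℕ}

open scoped Classical in
theorem run_degree {u : ℕ} (hn : σ 0 0 = n)
    (hadj : ∀ i < n, ∀ j < n, σ 1 (i * n + j) = if g.Adj i j then 1 else 0) (hu : u < n)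
    (h30 : σ 30 0 = u) (hB : n * n + n + 10 ≤ B) :
    Run B degree σ fun t τ => t ≤ 50 * (n + 1) ∧ Frame [6, 31] σ τ ∧
      ∀ x, τ 6 x = if x = u then degIn g (Finset.range n) u else σ 6 x := by
  simp only [degree, run_seq, run_assign, Expr.Fits, Expr.eval, Expr.cost, Nat.zero_le, true_and, h30]
  refine (run_forTo' (N := n) (fun k ρ => Frame [6, 31] σ ρ ∧
    ∀ x, ρ 6 x = if x = u then ((Finset.range k).filter (g.Adj u)).card else σ 6 x) 30 (by decide)
    (by omega) (by rw [store_ne (by decide), hn]) ?_ ?_).mono ?_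
  · refine ⟨((Frame.refl _ _).store (by simp)).store (by simp), fun x => ?_⟩
    rw [store_ne (by decide), store_same]
    simp
  · rintro k ρ hk hρk hρn ⟨hF, h6⟩
    have e30 : ρ 30 0 = u := by rw [hF 30 (by decide), h30]
    have e1 : ρ 1 = σ 1 := hF 1 (by decide)
    have hlt := mul_add_lt hu hk
    have hle := card_filter_range_le (g.Adj u) k
    have h1 := ite_le_one (g.Adj u k)
    simp only [run_assign, Expr.Fits, Expr.eval, Op.eval, Expr.cost, e30, hρk, hρn, e1, h6 u, if_true,
      hadj u hu k hk, Nat.zero_le, true_and]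
    refine ⟨⟨⟨by omega, by omega⟩, by omega⟩, by omega, by rwa [store_ne (by decide)],
      by rwa [store_ne (by decide)], (hF.store (by simp)).store (by simp), fun x => ?_⟩
    rw [store_ne (by decide), store_same, card_filter_range_succ, h6 x]
    by_cases hx : x = u <;> simp [hx]
  · rintro t τ ⟨ht, ⟨hF, h6⟩, -⟩
    exact ⟨by omega, hF, h6⟩

/-- The pieces at the beginning. -/
def singletons (n : ℕ) (w : ℕ → ℕ) (r : ℕ) : List Piece :=
  if r < n ∧ 0 < w r then [({r}, w r)] else []

theorem stage_singletons (hw : ∀ v < n, w v ≤ W) (hw0 : ∀ v, n ≤ v → w v = 0) :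
    Stage g n W w (singletons n w) := by
  have hmem : ∀ {r P}, P ∈ singletons n w r → r < n ∧ 0 < w r ∧ P = ({r}, w r) := by
    intro r P hP
    rw [singletons] at hP
    split_ifs at hP with h
    · exact ⟨h.1, h.2, List.mem_singleton.1 hP⟩
    · simp at hP
  constructor
  · intro r hr
    rw [singletons, if_neg]
    omega
  · intro r P hP
    obtain ⟨h1, h2, rfl⟩ := hmem hP
    exact ⟨h2, hw r h1⟩
  · intro r P hP
    obtain ⟨-, -, rfl⟩ := hmem hP
    simp
  · intro r r' hrr P hP P' hP' x hx y hy
    obtain ⟨-, -, rfl⟩ := hmem hP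
    obtain ⟨-, -, rfl⟩ := hmem hP'
    rw [Finset.mem_singleton] at hx hy
    subst hx
    subst hy
    exact ⟨hrr, id⟩
  · intro x
    by_cases hx : x < n ∧ 0 < w x
    · refine le_trans ?_ (Finset.single_le_sum (f := fun r => cov x (singletons n w r))
        (fun _ _ => Nat.zero_le _) (Finset.mem_range.2 hx.1))
      simp [singletons, hx]
    · have : w x = 0 := by
        by_contra h
        by_cases hxn : x < n
        · exact hx ⟨hxn, Nat.pos_of_ne_zero h⟩
        · exact h (hw0 x (not_lt.1 hxn))
      omega
  · refine Dominates.of_le fun v => ?_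
    rw [singletons]
    split_ifs <;> simp

theorem pieces_singletons_le : pieces (Finset.range n) (singletons n w) ≤ n := by
  calc pieces (Finset.range n) (singletons n w) ≤ ∑ _r ∈ Finset.range n, 1 := by
        refine Finset.sum_le_sum fun r _ => ?_
        rw [singletons]
        split_ifs <;> simp
    _ = n := by simp

open scoped Classical in
theorem run_setup (hn : σ 0 0 = n)
    (hadj : ∀ i < n, ∀ j < n, σ 1 (i * n + j) = if g.Adj i j then 1 else 0)
    (hw : ∀ v < n, σ 2 v = w v) (h0 : ∀ k, σ 12 k = 0) (hB : n * n + n + 10 ≤ B) :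
    Run B setup σ fun t τ => t ≤ 200 * ((n + 1) * (n + 1)) ∧
      Frame [6, 8, 9, 10, 11, 12, 13, 30, 31] σ τ ∧ Mem g n (singletons n w) τ ∧ τ 13 0 = n := by
  rw [setup, run_seq]
  refine (run_forTo' (N := n) (fun k ρ => Frame [6, 8, 9, 10, 11, 12, 30, 31] σ ρ ∧
    (∀ u < k, ρ 6 u = degIn g (Finset.range n) u) ∧ (∀ u < k, ρ 8 u = u) ∧
    (∀ u < k, ρ 9 u = u + if 0 < w u then 1 else 0) ∧ (∀ u < k, ρ 10 u = w u) ∧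
    (∀ u < k, ρ 11 u = w u) ∧ ∀ i, ∀ x < n, ρ 12 (i * n + x) = if i < k ∧ x = i then 1 else 0)
    (50 * (n + 1) + 50) (by decide) (by omega) hn ?_ ?_).mono ?_
  · refine ⟨(Frame.refl _ _).store (by simp), ?_⟩
    simp [h0]
  · rintro k ρ hk hρk hρn ⟨hF, h6, h8, h9, h10, h11, h12⟩
    have e1 : ρ 1 = σ 1 := hF 1 (by decide)
    rw [run_seq]
    refine (run_degree (g := g) hρn (by rwa [e1]) hk hρk hB).mono ?_
    rintro t ρ₁ ⟨ht, hF₁, h6₁⟩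
    have f30 : ρ₁ 30 0 = k := by rw [hF₁ 30 (by decide), hρk]
    have f0 : ρ₁ 0 0 = n := by rw [hF₁ 0 (by decide), hρn]
    have f2 : ρ₁ 2 = σ 2 := by rw [hF₁ 2 (by decide), hF 2 (by decide)]
    have f8 : ρ₁ 8 = ρ 8 := hF₁ 8 (by decide)
    have f9 : ρ₁ 9 = ρ 9 := hF₁ 9 (by decide)
    have f10 : ρ₁ 10 = ρ 10 := hF₁ 10 (by decide)
    have f11 : ρ₁ 11 = ρ 11 := hF₁ 11 (by decide)
    have f12 : ρ₁ 12 = ρ 12 := hF₁ 12 (by decide)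
    have hkk := mul_add_lt hk hk
    have h1 := ite_le_one (0 < w k)
    simp only [run_seq, run_assign, Expr.Fits, Expr.eval, Op.eval, Expr.cost, Nat.zero_le, true_and,
      f30, f0, f2, hw k hk, store_ne (show 30 ≠ 8 by decide), store_ne (show 30 ≠ 9 by decide),
      store_ne (show 30 ≠ 10 by decide), store_ne (show 30 ≠ 11 by decide),
      store_ne (show 0 ≠ 8 by decide), store_ne (show 0 ≠ 9 by decide),
      store_ne (show 0 ≠ 10 by decide), store_ne (show 0 ≠ 11 by decide),
      store_ne (show 2 ≠ 8 by decide), store_ne (show 2 ≠ 9 by decide),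
      store_ne (show 2 ≠ 10 by decide), store_ne (show 30 ≠ 12 by decide),
      store_ne (show 0 ≠ 12 by decide)]
    have hlt : ∀ {u}, u < k + 1 → u ≠ k → u < k := fun h h' => by omega
    refine ⟨⟨by omega, by omega⟩, ⟨by omega, by omega⟩, by omega, by omega, ?_, ?_, ?_, ?_, ?_, ?_, ?_⟩
    · exact (((((((hF.trans hF₁ (by simp)).store (by simp)).store (by simp)).store (by simp)).store
        (by simp)).store (by simp)).store (by simp))
    · intro u hu
      simp only [store_ne (show 6 ≠ 8 by decide), store_ne (show 6 ≠ 9 by decide),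
        store_ne (show 6 ≠ 10 by decide), store_ne (show 6 ≠ 11 by decide),
        store_ne (show 6 ≠ 12 by decide), store_ne (show 6 ≠ 30 by decide), h6₁]
      split_ifs with h
      · rw [h]
      · exact h6 u (hlt hu h)
    · intro u hu
      simp only [store_ne (show 8 ≠ 9 by decide),
        store_ne (show 8 ≠ 10 by decide), store_ne (show 8 ≠ 11 by decide),
        store_ne (show 8 ≠ 12 by decide), store_ne (show 8 ≠ 30 by decide), f8, store_same]
      split_ifs with h
      · rw [h]
      · exact h8 u (hlt hu h)
    · intro u hu
      simp only [store_ne (show 9 ≠ 10 by decide), store_ne (show 9 ≠ 11 by decide),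
        store_ne (show 9 ≠ 12 by decide), store_ne (show 9 ≠ 30 by decide), store_same,
        store_ne (show 9 ≠ 8 by decide), f9]
      by_cases h : u = k
      · rw [if_pos h, h]
      · rw [if_neg h]
        exact h9 u (hlt hu h)
    · intro u hu
      simp only [store_ne (show 10 ≠ 11 by decide),
        store_ne (show 10 ≠ 12 by decide), store_ne (show 10 ≠ 30 by decide), store_same,
        store_ne (show 10 ≠ 8 by decide), store_ne (show 10 ≠ 9 by decide), f10]
      split_ifs with h
      · rw [h]
      · exact h10 u (hlt hu h)
    · intro u hu
      simp only [store_ne (show 11 ≠ 10 by decide),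
        store_ne (show 11 ≠ 12 by decide), store_ne (show 11 ≠ 30 by decide), store_same,
        store_ne (show 11 ≠ 8 by decide), store_ne (show 11 ≠ 9 by decide), f11]
      split_ifs with h
      · rw [h]
      · exact h11 u (hlt hu h)
    · intro i x hx
      simp only [store_ne (show 12 ≠ 10 by decide), store_ne (show 12 ≠ 11 by decide),
        store_ne (show 12 ≠ 30 by decide), store_same, store_ne (show 12 ≠ 8 by decide),
        store_ne (show 12 ≠ 9 by decide), f12, mul_add_eq_iff hx hk, h12 i x hx]
      by_cases hik : i = k
      · subst hik
        simp
      · rw [if_neg fun h => hik h.1]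
        exact if_congr (by rw [show i < k + 1 ↔ i < k by omega]) rfl rfl
  · rintro t ρ ⟨ht, ⟨hF, h6, h8, h9, h10, h11, h12⟩, -, hρn⟩
    simp only [run_assign, Expr.Fits, Expr.eval, Expr.cost, Nat.zero_le, true_and, hρn]
    refine ⟨by nlinarith, (hF.weaken (by simp)).store (by simp), ⟨?_, ?_, ?_, ?_, ?_⟩, by simp⟩
    · rwa [store_ne (by decide)]
    · rwa [store_ne (by decide), hF 1 (by decide)]
    · simpa using h6
    · intro r hr
      rw [singletons]
      by_cases hwr : 0 < w r
      · rw [if_pos ⟨hr, hwr⟩]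
        simp only [Holds, store_ne (show 10 ≠ 13 by decide), store_ne (show 8 ≠ 13 by decide),
          store_ne (show 9 ≠ 13 by decide), h10 r hr, h8 r hr, h9 r hr, if_pos hwr, store_eq]
        refine ⟨trivial, fun x hx => ?_, trivial, by simp, by omega⟩
        rw [store_ne (by decide), h12 r x hx]
        simp [hr]
      · rw [if_neg fun h => hwr h.2]
        simp [Holds, h8 r hr, h9 r hr, hwr]
    · intro k hk x hx
      rw [store_eq] at hk
      rw [store_ne (by decide), h12 k x hx, if_neg]
      omega

end WordRAM

/-! ### Detection of five-cycles -/

namespace WordRAM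

open BuoyColoring

section Decides

variable {B n : ℕ} {σ : State} {g : SimpleGraph ℕ} {L : ℕ → List Piece} {e e' : Expr} {p q : Prop}

open scoped Classical in
/-- The expression `e` evaluates without overflow to the truth value of `p`. -/
def Decides (B : ℕ) (σ : State) (e : Expr) (p : Prop) : Prop :=
  e.Fits B σ ∧ e.eval σ = if p then 1 else 0

theorem Decides.ne_zero_iff (h : Decides B σ e p) : e.eval σ ≠ 0 ↔ p := by
  rw [h.2]
  by_cases hp : p <;> simp [hp]

open scoped Classical in
theorem Decides.and (hB : 1 ≤ B) (h : Decides B σ e p) (h' : Decides B σ e' q) :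
    Decides B σ (.op .mul e e') (p ∧ q) := by
  have hval : (Expr.op .mul e e').eval σ = if p ∧ q then 1 else 0 := by
    rw [Expr.eval, h.2, h'.2]
    by_cases hp : p <;> by_cases hq : q <;> simp [hp, hq]
  refine ⟨⟨h.1, h'.1, ?_⟩, by convert hval⟩
  rw [hval]
  exact (ite_le_one _).trans hB

open scoped Classical in
theorem Decides.not (hB : 1 ≤ B) (h : Decides B σ e p) :
    Decides B σ (.op .eq e (.const 0)) (¬ p) := by
  have hval : (Expr.op .eq e (.const 0)).eval σ = if ¬ p then 1 else 0 := by
    rw [Expr.eval, h.2]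
    by_cases hp : p <;> simp [hp]
  refine ⟨⟨h.1, Nat.zero_le _, ?_⟩, by convert hval⟩
  rw [hval]
  exact (ite_le_one _).trans hB

open scoped Classical in
theorem Decides.nor (hB : 2 ≤ B) (h : Decides B σ e p) (h' : Decides B σ e' q) :
    Decides B σ (.op .eq (.op .add e e') (.const 0)) (¬ p ∧ ¬ q) := by
  have hval : (Expr.op .eq (.op .add e e') (.const 0)).eval σ = if ¬ p ∧ ¬ q then 1 else 0 := by
    simp only [Expr.eval, Op.eval, h.2, h'.2]
    by_cases hp : p <;> by_cases hq : q <;> simp [hp, hq]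
  refine ⟨⟨⟨h.1, h'.1, ?_⟩, Nat.zero_le _, ?_⟩, by convert hval⟩
  · simp only [Expr.eval, Op.eval, h.2, h'.2]
    exact (Nat.add_le_add (ite_le_one _) (ite_le_one _)).trans hB
  · rw [hval]
    exact (ite_le_one _).trans (by omega)

theorem decides_lt (hB : 1 ≤ B) (a b : ℕ) :
    Decides B σ (.op .lt (var a) (var b)) (σ a 0 < σ b 0) := by
  have hval : (Expr.op .lt (var a) (var b)).eval σ = if σ a 0 < σ b 0 then 1 else 0 := by
    simp only [Expr.eval, Op.eval]
    exact if_congr Iff.rfl rfl rfl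
  refine ⟨⟨Nat.zero_le _, Nat.zero_le _, ?_⟩, by convert hval⟩
  rw [hval]
  exact (ite_le_one _).trans hB

theorem decides_eq (hB : 1 ≤ B) (a b : ℕ) :
    Decides B σ (.op .eq (var a) (var b)) (σ a 0 = σ b 0) := by
  have hval : (Expr.op .eq (var a) (var b)).eval σ = if σ a 0 = σ b 0 then 1 else 0 := by
    simp only [Expr.eval, Op.eval]
    exact if_congr Iff.rfl rfl rfl
  refine ⟨⟨Nat.zero_le _, Nat.zero_le _, ?_⟩, by convert hval⟩
  rw [hval]
  exact (ite_le_one _).trans hB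

/-- Adjacency of the vertices in the variables `a` and `b`. -/
def adjVar (a b : ℕ) : Expr := .read 1 (.op .add (.op .mul (var a) (var 0)) (var b))

theorem decides_adjVar (hm : Mem g n L σ) (hB : n * n ≤ B) {a b : ℕ} (ha : σ a 0 < n)
    (hb : σ b 0 < n) : Decides B σ (adjVar a b) (g.Adj (σ a 0) (σ b 0)) := by
  have hlt := mul_add_lt ha hb
  simp only [Decides, adjVar, Expr.Fits, Expr.eval, Op.eval, hm.size, hm.adj _ ha _ hb, Nat.zero_le,
    true_and]
  exact ⟨⟨by omega, by omega⟩, trivial⟩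

/-- Put a vertex with the property `e`, which is a test of the vertex in the variable `30`, plus
one, in the variable `x`, or `0` if there is none. -/
def find (x : ℕ) (e : Expr) : Prog :=
  .seq (set x (.const 0)) (forTo 30 0 (.ite e (set x (.op .add (var 30) (.const 1))) .skip))

theorem run_find {x : ℕ} {p : ℕ → Prop} (hn : σ 0 0 = n) (hx : x ≠ 30 ∧ x ≠ 0) (hB : n + 1 ≤ B)
    (he : ∀ ρ, Frame [30, x] σ ρ → ∀ u < n, ρ 30 0 = u → Decides B ρ e (p u))
    (hcost : e.cost ≤ 60) :
    Run B (find x e) σ fun t τ => t ≤ 100 * (n + 1) ∧ Frame [30, x] σ τ ∧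
      ((τ x 0 = 0 ∧ ∀ u < n, ¬ p u) ∨ ∃ u < n, p u ∧ τ x 0 = u + 1) := by
  simp only [find, run_seq, run_assign, Expr.Fits, Expr.eval, Expr.cost, Nat.zero_le, true_and]
  refine (run_forTo' (N := n) (fun k ρ => Frame [30, x] σ ρ ∧
    ((ρ x 0 = 0 ∧ ∀ u < k, ¬ p u) ∨ ∃ u < n, p u ∧ ρ x 0 = u + 1)) 70 (by decide)
    (by omega) (by rw [store_ne hx.2.symm, hn]) ?_ ?_).mono ?_
  · refine ⟨((Frame.refl _ _).store (by simp)).store (by simp), Or.inl ⟨?_, by simp⟩⟩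
    rw [store_ne hx.1, store_eq]
  · rintro k ρ hk hρk hρn ⟨hF, h⟩
    have hd := he ρ hF k hk hρk
    simp only [run_ite, run_assign, run_skip, Expr.Fits, Expr.eval, Op.eval, Expr.cost, Nat.zero_le,
      true_and, hρk]
    refine ⟨hd.1, fun h1 => ⟨⟨by omega, by omega⟩, by omega, ?_, ?_, (hF.store (by simp)).store
      (by simp), Or.inr ⟨k, hk, hd.ne_zero_iff.1 h1, ?_⟩⟩, fun h1 => ⟨by omega, hρn,
      hF.store (by simp), ?_⟩⟩
    · rw [store_ne hx.1.symm, hρk]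
    · rw [store_ne hx.2.symm, hρn]
    · rw [store_ne hx.1, store_eq]
    · rw [store_ne hx.1]
      refine h.imp_left fun h => ⟨h.1, fun u hu => ?_⟩
      rcases Nat.lt_succ_iff_lt_or_eq.1 hu with h' | rfl
      · exact h.2 u h'
      · exact fun h' => hd.ne_zero_iff.2 h' h1
  · rintro t τ ⟨ht, ⟨hF, h⟩, -⟩
    exact ⟨by omega, hF, h⟩

end Decides

/-- The five-cycle `v`, `a`, `p`, `q`, `b` is one of those that are looked for. -/
structure Detects (g : SimpleGraph ℕ) (v q p a b : ℕ) : Prop where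
  vq : ¬ g.Adj v q
  pq : g.Adj p q
  vp : ¬ g.Adj v p
  va : g.Adj v a
  pa : g.Adj p a
  qa : ¬ g.Adj q a
  vb : g.Adj v b
  qb : g.Adj q b
  pb : ¬ g.Adj p b
  lt : p < q

theorem Detects.isC5 {g : SimpleGraph ℕ} {v q p a b : ℕ} (hH : NoHouse g) (h : Detects g v q p a b) :
    IsC5 g ![v, a, p, q, b] :=
  isC5_of_adj hH h.va h.vb h.pa h.qb h.pq h.vp h.vq h.qa h.pb

/-- Look for a vertex with the property `e` as in `find`, and run `p` if there is one. -/
def findThen (x : ℕ) (e : Expr) (p : Prog) : Prog :=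
  .seq (find x e) (.ite (var x) (.seq (set x (.op .sub (var x) (.const 1))) p) .skip)

variable {B n : ℕ} {σ : State} {g : SimpleGraph ℕ} {L : ℕ → List Piece}

theorem run_findThen {x : ℕ} {e : Expr} {prog : Prog} {p : ℕ → Prop} {Q : ℕ → State → Prop}
    (hn : σ 0 0 = n) (hx : x ≠ 30 ∧ x ≠ 0) (hB : n + 1 ≤ B)
    (he : ∀ ρ, Frame [30, x] σ ρ → ∀ u < n, ρ 30 0 = u → Decides B ρ e (p u)) (hcost : e.cost ≤ 60)
    (h0 : ∀ t τ, t ≤ 120 * (n + 1) → Frame [30, x] σ τ → (∀ u < n, ¬ p u) → Q t τ)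
    (h1 : ∀ s ρ, s ≤ 120 * (n + 1) → Frame [30, x] σ ρ → ρ x 0 < n → p (ρ x 0) →
      Run B prog ρ fun t τ => Q (s + t) τ) : Run B (findThen x e prog) σ Q := by
  rw [findThen, run_seq]
  refine (run_find hn hx hB he hcost).mono ?_
  rintro t ρ ⟨ht, hF, h⟩
  simp only [run_ite, run_seq, run_assign, run_skip, Expr.Fits, Expr.eval, Op.eval, Expr.cost,
    Nat.zero_le, true_and]
  refine ⟨fun hne => ?_, fun hz => ?_⟩
  · obtain ⟨u, hu, hpu, hρ⟩ : ∃ u < n, p u ∧ ρ x 0 = u + 1 := h.resolve_left fun h => hne h.1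
    have hstore : ρ x 0 - 1 = u := by omega
    rw [hstore]
    refine ⟨⟨by omega, by omega⟩, ?_⟩
    have := h1 (t + 9) (ρ.store x 0 u) (by omega) (hF.store (by simp)) (by simpa using hu)
      (by simpa using hpu)
    refine this.mono fun t' τ hQ => ?_
    convert hQ using 1
    ring
  · refine h0 _ _ (by omega) hF ?_
    rcases h with h | ⟨u, -, -, h⟩
    · exact h.2
    · omega

/-- Store the five-cycle that has been found, and determine the size of its buoy. -/
def record : Prog :=
  .seq (.assign 17 (var 33) (var 50)) (.seq (.assign 18 (var 33) (var 51))
    (.seq (.assign 19 (var 33) (var 52)) (.seq (.assign 20 (.const 0) (var 48))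
    (.seq (.assign 20 (.const 1) (var 51)) (.seq (.assign 20 (.const 2) (var 50))
    (.seq (.assign 20 (.const 3) (var 49)) (.seq (.assign 20 (.const 4) (var 52)) classify)))))))

/-- Look for a five-cycle `v`, `a`, `p`, `q`, `b` with `p < q`, where `v` and `q` are the vertices
in the variables `48` and `49`. -/
def search : Prog :=
  .ite (.op .eq (.op .add (adjVar 48 49) (.op .eq (var 48) (var 49))) (.const 0))
    (findThen 50 (.op .mul (.op .mul (adjVar 30 49) (.op .lt (var 30) (var 49)))
        (.op .eq (.op .add (adjVar 48 30) (.op .eq (var 30) (var 48))) (.const 0)))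
      (findThen 51 (.op .mul (.op .mul (adjVar 48 30) (adjVar 50 30)) (.op .eq (adjVar 49 30) (.const 0)))
        (findThen 52 (.op .mul (.op .mul (adjVar 48 30) (adjVar 49 30))
          (.op .eq (adjVar 50 30) (.const 0))) record))) .skip

/-- A five-cycle `v`, `a`, `p`, `q`, `b` with `p < q` is found, whichever candidates `p`, `a` and
`b` are used. -/
def Detectable (g : SimpleGraph ℕ) (v q : ℕ) : Prop :=
  ¬ g.Adj v q ∧ q ≠ v ∧ (∃ p < q, g.Adj p q ∧ ¬ g.Adj v p ∧ p ≠ v) ∧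
    ∀ p < q, g.Adj p q → ¬ g.Adj v p → p ≠ v → (∃ a, g.Adj v a ∧ g.Adj p a ∧ ¬ g.Adj q a) ∧
      ∃ b, g.Adj v b ∧ g.Adj q b ∧ ¬ g.Adj p b

open scoped Classical in
/-- The size of the buoy of a five-cycle. -/
noncomputable def buoySize (g : SimpleGraph ℕ) (n : ℕ) (c : Fin 5 → ℕ) : ℕ :=
  ((Finset.range n).filter (Buoy g c)).card

theorem run_record (hm : Mem g n L σ) {v q p a b : ℕ} (hc : IsC5 g ![v, a, p, q, b])
    (hcn : ∀ i, ![v, a, p, q, b] i < n) (h48 : σ 48 0 = v) (h49 : σ 49 0 = q) (h50 : σ 50 0 = p)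
    (h51 : σ 51 0 = a) (h52 : σ 52 0 = b) (hB : n * n + n + 10 ≤ B) :
    Run B record σ fun t τ => t ≤ 1100 * (n + 1) ∧
      Frame [7, 17, 18, 19, 20, 21, 30, 41, 42] σ τ ∧
      (∀ x, τ 17 x = if x = σ 33 0 then p else σ 17 x) ∧
      (∀ x, τ 18 x = if x = σ 33 0 then a else σ 18 x) ∧
      (∀ x, τ 19 x = if x = σ 33 0 then b else σ 19 x) ∧ τ 41 0 = buoySize g n ![v, a, p, q, b] := by
  have h4B : 4 ≤ B := by omega
  have h1 : (1 : ℕ) ≤ B := by omega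
  have h2 : (2 : ℕ) ≤ B := by omega
  have h3 : (3 : ℕ) ≤ B := by omega
  simp [record, h4B, h1, h2, h3, h48, h49, h50, h51, h52]
  set ρ := (((((((σ.store 17 (σ 33 0) p).store 18 (σ 33 0) a).store 19 (σ 33 0) b).store 20 0 v).store
    20 1 a).store 20 2 p).store 20 3 q).store 20 4 b with hρ
  have hF : Frame [17, 18, 19, 20] σ ρ :=
    ((((((((Frame.refl _ _).store (by simp)).store (by simp)).store (by simp)).store
    (by simp)).store (by simp)).store (by simp)).store (by simp)).store (by simp)
  refine (run_classify (hm.frame hF (by decide)) hc ?_ hcn hB).mono ?_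
  · intro i
    fin_cases i <;> simp [hρ, store_same]
  · rintro t τ ⟨ht, hFτ, -, h41, -⟩
    refine ⟨by omega, (hF.weaken (by simp)).trans hFτ (by simp), ?_, ?_, ?_, h41⟩
    · intro x
      rw [hFτ 17 (by decide)]
      simp [hρ, store_same]
    · intro x
      rw [hFτ 18 (by decide)]
      simp [hρ, store_same]
    · intro x
      rw [hFτ 19 (by decide)]
      simp [hρ, store_same]

/-- If nothing is found, then the variable `41` remains `0`; otherwise it is the size of the buoy.
-/
theorem run_search (hH : NoHouse g) (hg : ∀ u v, g.Adj u v → u < n) (hm : Mem g n L σ) {v q : ℕ}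
    (hv : v < n) (hq : q < n) (h48 : σ 48 0 = v) (h49 : σ 49 0 = q) (h41 : σ 41 0 = 0)
    (hB : n * n + n + 10 ≤ B) :
    Run B search σ fun t τ => t ≤ 1700 * (n + 1) ∧
      Frame [7, 17, 18, 19, 20, 21, 30, 41, 42, 50, 51, 52] σ τ ∧
      (∀ x ≠ σ 33 0, τ 17 x = σ 17 x ∧ τ 18 x = σ 18 x ∧ τ 19 x = σ 19 x) ∧
      (τ 41 0 ≠ 0 → Detects g v q (τ 17 (σ 33 0)) (τ 18 (σ 33 0)) (τ 19 (σ 33 0)) ∧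
        τ 41 0 = buoySize g n ![v, τ 18 (σ 33 0), τ 17 (σ 33 0), q, τ 19 (σ 33 0)]) ∧
      (τ 41 0 = 0 → ¬ Detectable g v q) := by
  classical
  have hnB : n * n ≤ B := by omega
  have h1B : 1 ≤ B := by omega
  have h2B : 2 ≤ B := by omega
  -- the searches for `p`, `a` and `b` end without success
  have fail : ∀ s ρ, s ≤ 500 * (n + 1) → Frame [30, 50, 51, 52] σ ρ → ¬ Detectable g v q →
      s ≤ 1700 * (n + 1) ∧ Frame [7, 17, 18, 19, 20, 21, 30, 41, 42, 50, 51, 52] σ ρ ∧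
      (∀ x ≠ σ 33 0, ρ 17 x = σ 17 x ∧ ρ 18 x = σ 18 x ∧ ρ 19 x = σ 19 x) ∧
      (ρ 41 0 ≠ 0 → Detects g v q (ρ 17 (σ 33 0)) (ρ 18 (σ 33 0)) (ρ 19 (σ 33 0)) ∧
        ρ 41 0 = buoySize g n ![v, ρ 18 (σ 33 0), ρ 17 (σ 33 0), q, ρ 19 (σ 33 0)]) ∧
      (ρ 41 0 = 0 → ¬ Detectable g v q) := by
    intro s ρ hs hF hd
    refine ⟨by omega, hF.weaken (by simp), fun x _ => ?_, fun h => absurd ?_ h, fun _ => hd⟩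
    · rw [hF 17 (by decide), hF 18 (by decide), hF 19 (by decide)]
      exact ⟨rfl, rfl, rfl⟩
    · rw [hF 41 (by decide), h41]
  have hvq := (decides_adjVar hm hnB (a := 48) (b := 49) (by rwa [h48]) (by rwa [h49])).nor h2B
    (decides_eq h1B 48 49)
  rw [h48, h49] at hvq
  rw [search, run_ite, run_skip]
  refine ⟨hvq.1, fun h => ?_, fun h => ?_⟩
  · obtain ⟨nvq, hne⟩ := hvq.ne_zero_iff.1 h
    refine run_findThen (n := n) (p := fun p => (g.Adj p q ∧ p < q) ∧ ¬ g.Adj v p ∧ p ≠ v) hm.size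
      (by decide) (by omega) ?_ (by simp [adjVar]) ?_ ?_
    · intro ρ hF u hu hρu
      have hm' := hm.frame hF (by decide)
      have e48 : ρ 48 0 = v := by rw [hF 48 (by decide), h48]
      have e49 : ρ 49 0 = q := by rw [hF 49 (by decide), h49]
      have := ((decides_adjVar hm' hnB (a := 30) (b := 49) (by rwa [hρu]) (by rwa [e49])).and h1B
        (decides_lt h1B 30 49)).and h1B ((decides_adjVar hm' hnB (a := 48) (b := 30) (by rwa [e48])
        (by rwa [hρu])).nor h2B (decides_eq h1B 30 48))
      rwa [hρu, e48, e49] at this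
    · intro t τ ht hF hno
      refine fail _ _ ?_ (hF.weaken (by simp)) fun hd => ?_
      · simp [adjVar]
        omega
      obtain ⟨-, -, ⟨p, h1, h2, h3, h4⟩, -⟩ := hd
      exact hno p (hg _ _ h2) ⟨⟨h2, h1⟩, h3, h4⟩
    intro s₁ ρ₁ hs₁ hF₁ hpn hp
    set p := ρ₁ 50 0 with hpdef
    obtain ⟨⟨pq, hpq⟩, vp, hpv⟩ := hp
    have hm₁ := hm.frame hF₁ (by decide)
    refine run_findThen (n := n) (p := fun a => (g.Adj v a ∧ g.Adj p a) ∧ ¬ g.Adj q a) hm₁.size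
      (by decide) (by omega) ?_ (by simp [adjVar]) ?_ ?_
    · intro ρ hF u hu hρu
      have hm' := hm₁.frame hF (by decide)
      have e48 : ρ 48 0 = v := by rw [hF 48 (by decide), hF₁ 48 (by decide), h48]
      have e49 : ρ 49 0 = q := by rw [hF 49 (by decide), hF₁ 49 (by decide), h49]
      have e50 : ρ 50 0 = p := by rw [hF 50 (by decide)]
      have := ((decides_adjVar hm' hnB (a := 48) (b := 30) (by rwa [e48]) (by rwa [hρu])).and h1B
        (decides_adjVar hm' hnB (a := 50) (b := 30) (by rwa [e50]) (by rwa [hρu]))).and h1B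
        ((decides_adjVar hm' hnB (a := 49) (b := 30) (by rwa [e49]) (by rwa [hρu])).not h1B)
      rwa [hρu, e48, e49, e50] at this
    · intro t τ ht hF hno
      refine fail _ _ ?_ ((hF₁.weaken (l' := [30, 50, 51, 52]) (by simp)).trans hF (by simp)) fun hd => ?_
      · simp [adjVar]
        omega
      obtain ⟨-, -, -, h⟩ := hd
      obtain ⟨⟨a, h1, h2, h3⟩, -⟩ := h p hpq pq vp hpv
      exact hno a (hg _ _ h1.symm) ⟨⟨h1, h2⟩, h3⟩
    intro s₂ ρ₂ hs₂ hF₂ han ha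
    set a := ρ₂ 51 0 with hadef
    obtain ⟨⟨va, pa⟩, qa⟩ := ha
    have hm₂ := hm₁.frame hF₂ (by decide)
    have hF₂' : Frame [30, 50, 51] σ ρ₂ := (hF₁.weaken (by simp)).trans hF₂ (by simp)
    have f50 : ρ₂ 50 0 = p := by rw [hF₂ 50 (by decide)]
    refine run_findThen (n := n) (p := fun b => (g.Adj v b ∧ g.Adj q b) ∧ ¬ g.Adj p b) hm₂.size
      (by decide) (by omega) ?_ (by simp [adjVar]) ?_ ?_
    · intro ρ hF u hu hρu
      have hm' := hm₂.frame hF (by decide)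
      have e48 : ρ 48 0 = v := by rw [hF 48 (by decide), hF₂' 48 (by decide), h48]
      have e49 : ρ 49 0 = q := by rw [hF 49 (by decide), hF₂' 49 (by decide), h49]
      have e50 : ρ 50 0 = p := by rw [hF 50 (by decide), f50]
      have := ((decides_adjVar hm' hnB (a := 48) (b := 30) (by rwa [e48]) (by rwa [hρu])).and h1B
        (decides_adjVar hm' hnB (a := 49) (b := 30) (by rwa [e49]) (by rwa [hρu]))).and h1B
        ((decides_adjVar hm' hnB (a := 50) (b := 30) (by rwa [e50]) (by rwa [hρu])).not h1B)
      rwa [hρu, e48, e49, e50] at this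
    · intro t τ ht hF hno
      refine fail _ _ ?_ ((hF₂'.weaken (l' := [30, 50, 51, 52]) (by simp)).trans hF (by simp)) fun hd => ?_
      · simp [adjVar]
        omega
      obtain ⟨-, -, -, h⟩ := hd
      obtain ⟨-, b, h1, h2, h3⟩ := h p hpq pq vp hpv
      exact hno b (hg _ _ h1.symm) ⟨⟨h1, h2⟩, h3⟩
    intro s₃ ρ₃ hs₃ hF₃ hbn hb
    set b := ρ₃ 52 0 with hbdef
    obtain ⟨⟨vb, qb⟩, pb⟩ := hb
    have hm₃ := hm₂.frame hF₃ (by decide)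
    have hF₃' : Frame [30, 50, 51, 52] σ ρ₃ := (hF₂'.weaken (by simp)).trans hF₃ (by simp)
    have hdet : Detects g v q p a b := ⟨nvq, pq, vp, va, pa, qa, vb, qb, pb, hpq⟩
    have e33 : ρ₃ 33 = σ 33 := hF₃' 33 (by decide)
    refine (run_record hm₃ (hdet.isC5 hH) ?_ (by rw [hF₃' 48 (by decide), h48])
      (by rw [hF₃' 49 (by decide), h49]) (by rw [hF₃ 50 (by decide), f50])
      (by rw [hF₃ 51 (by decide)]) rfl hB).mono ?_
    · intro i
      fin_cases i <;> assumption
    rintro t τ ⟨ht, hF, h17, h18, h19, hsz⟩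
    rw [e33] at h17 h18 h19
    rw [hF₃' 17 (by decide)] at h17
    rw [hF₃' 18 (by decide)] at h18
    rw [hF₃' 19 (by decide)] at h19
    refine ⟨?_, (hF₃'.weaken (by simp)).trans hF (by simp), fun x hx => ?_, fun _ => ?_, fun h0 => ?_⟩
    · simp [adjVar]
      omega
    · rw [h17, h18, h19, if_neg hx, if_neg hx, if_neg hx]
      exact ⟨rfl, rfl, rfl⟩
    · rw [h17, h18, h19, if_pos rfl, if_pos rfl, if_pos rfl]
      exact ⟨hdet, hsz⟩
    · -- a buoy is not empty
      exfalso
      rw [hsz, buoySize, Finset.card_eq_zero, Finset.filter_eq_empty_iff] at h0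
      exact h0 (Finset.mem_range.2 hv) ⟨0, (hdet.isC5 hH).twin_self 0⟩
  · refine fail _ _ ?_ (Frame.refl _ _) fun hd => ?_
    · simp [adjVar]
      omega
    · exact hvq.ne_zero_iff.2 ⟨hd.1, hd.2.1.symm⟩ h

/-- Look for a five-cycle `v`, `a`, `p`, `q`, `b`, where `v` and `q` are encoded by the number
`v * n + q` in the variable `33`. At this position, array `16` gets the size of the buoy, or `0` if
nothing has been found, and the arrays `17`, `18` and `19` get the vertices `p`, `a` and `b`. -/
def detect : Prog :=
  .seq (set 48 (.op .div (var 33) (var 0)))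
    (.seq (set 49 (.op .sub (var 33) (.op .mul (var 48) (var 0)))) (.seq (set 41 (.const 0))
      (.seq search (.assign 16 (var 33) (var 41)))))

/-- The result of `detect` for the vertices `v` and `q` is stored in the memory. -/
def Detected (g : SimpleGraph ℕ) (n : ℕ) (σ : State) (v q : ℕ) : Prop :=
  (σ 16 (v * n + q) ≠ 0 →
    Detects g v q (σ 17 (v * n + q)) (σ 18 (v * n + q)) (σ 19 (v * n + q)) ∧
    σ 16 (v * n + q) =
      buoySize g n ![v, σ 18 (v * n + q), σ 17 (v * n + q), q, σ 19 (v * n + q)]) ∧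
  (σ 16 (v * n + q) = 0 → ¬ Detectable g v q)

/-- Carry out `detect` for all pairs of vertices. -/
def detectAll : Prog := .seq (set 43 (.op .mul (var 0) (var 0))) (forTo 33 43 detect)

abbrev detectFrame : List ℕ := [7, 16, 17, 18, 19, 20, 21, 30, 33, 41, 42, 43, 48, 49, 50, 51, 52]

theorem run_detectAll (hH : NoHouse g) (hg : ∀ u v, g.Adj u v → u < n) (hm : Mem g n L σ)
    (hB : n * n + n + 10 ≤ B) :
    Run B detectAll σ fun t τ => t ≤ 2000 * ((n + 1) * (n + 1) * (n + 1)) ∧ Frame detectFrame σ τ ∧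
      τ 43 0 = n * n ∧ ∀ v < n, ∀ q < n, Detected g n τ v q := by
  rw [detectAll, run_seq, run_assign]
  simp only [Expr.Fits, Expr.eval, Op.eval, Expr.cost, Nat.zero_le, true_and, hm.size]
  refine ⟨by omega, ?_⟩
  refine (run_forTo' (N := n * n) (fun k ρ => Frame detectFrame σ ρ ∧
    ∀ v < n, ∀ q < n, v * n + q < k → Detected g n ρ v q) (1750 * (n + 1)) (by decide) (by omega)
    (by simp) ?_ ?_).mono ?_
  · exact ⟨((Frame.refl _ _).store (by simp)).store (by simp), by simp⟩
  · rintro k ρ hk hρk hρn ⟨hF, hdet⟩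
    have hn : 0 < n := by
      by_contra h
      rw [not_lt, Nat.le_zero] at h
      rw [h] at hk
      simp at hk
    have hm' := hm.frame hF (by decide)
    obtain ⟨v, q, hv, hq, rfl⟩ : ∃ v q, v < n ∧ q < n ∧ k = v * n + q :=
      ⟨k / n, k % n, (Nat.div_lt_iff_lt_mul hn).2 hk, Nat.mod_lt _ hn, (Nat.div_add_mod' k n).symm⟩
    have hdiv : (v * n + q) / n = v := by
      rw [mul_comm, Nat.mul_add_div hn, Nat.div_eq_of_lt hq, add_zero]
    simp only [detect, run_seq (p := set _ _), run_assign, Expr.Fits, Expr.eval, Op.eval, Expr.cost,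
      Nat.zero_le, true_and, hρk, hm'.size, hdiv, store_ne (show 33 ≠ 48 by decide),
      store_ne (show 0 ≠ 48 by decide), store_eq, Nat.add_sub_cancel_left]
    refine ⟨by nlinarith, ⟨by nlinarith, by omega⟩, ?_⟩
    set ρ₁ := ((ρ.store 48 0 v).store 49 0 q).store 41 0 0 with hρ₁
    have hF₁ : Frame [41, 48, 49] ρ ρ₁ :=
      (((Frame.refl _ _).store (by simp)).store (by simp)).store (by simp)
    have e33 : ρ₁ 33 0 = v * n + q := by rw [hF₁ 33 (by decide), hρk]
    rw [run_seq]
    refine (run_search hH hg (hm'.frame hF₁ (by decide)) hv hq (by simp [hρ₁]) (by simp [hρ₁])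
      (by simp [hρ₁]) hB).mono ?_
    rintro t τ ⟨ht, hFτ, hold, hnew⟩
    rw [e33] at hold hnew
    have f33 : τ 33 0 = v * n + q := by rw [hFτ 33 (by decide), e33]
    have f16 : τ 16 = ρ 16 := (hFτ 16 (by decide)).trans (hF₁ 16 (by decide))
    simp only [run_assign, Expr.Fits, Expr.eval, Expr.cost, Nat.zero_le, true_and, f33]
    refine ⟨by omega, ?_, ?_, ?_, ?_⟩
    · rw [store_ne (by decide)]
      exact f33
    · rw [store_ne (by decide), hFτ 43 (by decide), hF₁ 43 (by decide), hρn]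
    · exact (((hF.trans hF₁ (by simp)).trans hFτ (by simp)).store (by simp)).store (by simp)
    · intro v' hv' q' hq' hlt
      simp only [Detected, store_ne (show 16 ≠ 33 by decide), store_ne (show 17 ≠ 33 by decide),
        store_ne (show 18 ≠ 33 by decide), store_ne (show 19 ≠ 33 by decide),
        store_ne (show 17 ≠ 16 by decide), store_ne (show 18 ≠ 16 by decide),
        store_ne (show 19 ≠ 16 by decide), store_same, f16]
      by_cases heq : v' * n + q' = v * n + q
      · obtain ⟨rfl, rfl⟩ := (mul_add_eq_iff hq' hq).1 heq
        simp only [if_true]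
        exact hnew
      · obtain ⟨o1, o2, o3⟩ := hold _ heq
        simp only [heq, if_false, o1, o2, o3, hF₁ 17 (by decide), hF₁ 18 (by decide),
          hF₁ 19 (by decide)]
        exact hdet v' hv' q' hq' (by omega)
  · rintro t τ ⟨ht, ⟨hF, hdet⟩, -, h43⟩
    refine ⟨?_, hF, h43, fun v hv q hq => hdet v hv q hq (mul_add_lt hv hq)⟩
    nlinarith

end WordRAM

/-! ### Contraction of all buoys -/

namespace BuoyColoring

variable {g : SimpleGraph ℕ} {n : ℕ} {L L' : ℕ → List Piece} {c d : Fin 5 → ℕ}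

/-- At most one vertex of the buoy of `c` has pieces left. -/
def Contracted (g : SimpleGraph ℕ) (L : ℕ → List Piece) (c : Fin 5 → ℕ) : Prop :=
  ∀ u v, Buoy g c u → Buoy g c v → L u ≠ [] → L v ≠ [] → u = v

theorem Contracted.mono (h : Contracted g L c) (hL : ∀ u, L' u ≠ [] → L u ≠ []) :
    Contracted g L' c := fun u v hu hv h1 h2 => h u v hu hv (hL u h1) (hL v h2)

theorem Contracted.congr (h : Contracted g L c) (hd : ∀ u, Buoy g c u ↔ Buoy g d u) :
    Contracted g L d := fun u v hu hv => h u v ((hd u).2 hu) ((hd v).2 hv)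

/-- An obstruction to the perfectness of the degree order lies in a five-cycle, and has two vertices
of its buoy with pieces left. -/
theorem isPerfectOrder_of_contracted (hP : NoPath g) (hH : NoHouse g)
    (hg : ∀ u v, g.Adj u v → u < n) {Y : Set ℕ}
    (h : ∀ x a b c d, IsC5 g ![x, a, b, c, d] → a ∈ Y → b ∈ Y → c ∈ Y → d ∈ Y →
      Contracted g L ![x, a, b, c, d]) :
    IsPerfectOrder g (degIn g (Finset.range n)) {v | v ∈ Y ∧ L v ≠ []} := by
  rintro a ⟨ha, ha'⟩ b ⟨hb, hb'⟩ c ⟨hc, hc'⟩ d ⟨hd, hd'⟩ ab bc cd ac bd ad hfab hfdc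
  obtain ⟨x, hx⟩ := exists_isC5_of_degIn_le hP hH
    (fun u v h => Finset.mem_range.2 (hg v u h.symm)) ab bc cd ac bd ad hfab hfdc
  exact ab.ne (h x a b c d hx ha hb hc hd a b ⟨1, hx.twin_self 1⟩ ⟨2, hx.twin_self 2⟩ ha' hb')

end BuoyColoring

namespace WordRAM

open BuoyColoring

variable {B n W : ℕ} {σ : State} {g : SimpleGraph ℕ} {w : ℕ → ℕ} {L : ℕ → List Piece}
  {c d : Fin 5 → ℕ}

theorem buoySize_congr (h : ∀ u, Buoy g c u ↔ Buoy g d u) : buoySize g n c = buoySize g n d := by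
  rw [buoySize, buoySize]
  congr 1
  ext u
  simp only [Finset.mem_filter, h]

theorem buoySize_le : buoySize g n c ≤ n := by
  classical exact card_filter_range_le _ _

theorem buoySize_pos (hg : ∀ u v, g.Adj u v → u < n) (hc : IsC5 g c) : 0 < buoySize g n c := by
  classical
  exact Finset.card_pos.2 ⟨c 0, Finset.mem_filter.2
    ⟨Finset.mem_range.2 (hg _ _ (hc 0).1), 0, hc.twin_self 0⟩⟩

/-- The buoy of a five-cycle in a part of a buoy is smaller than this buoy. -/
theorem buoySize_lt (hP : NoPath g) (hH : NoHouse g) (hg : ∀ u v, g.Adj u v → u < n)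
    (hc : IsC5 g c) {i : Fin 5} (h : ∀ k, Twin g c i (d k)) : buoySize g n d < buoySize g n c := by
  classical
  refine Finset.card_lt_card ⟨fun u hu => ?_, fun hsub => ?_⟩
  · simp only [Finset.mem_filter] at hu ⊢
    exact ⟨hu.1, i, hu.2.twin_of_subset hP hH hc h⟩
  · have hi := hc.twin_self (i + 1)
    have hmem := hsub (Finset.mem_filter.2 ⟨Finset.mem_range.2 (hg _ _ (hc (i + 1)).1), _, hi⟩)
    have hi' := (Finset.mem_filter.1 hmem).2.twin_of_subset hP hH hc h
    have := twin_unique hi hi'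
    revert this
    clear * -
    revert i
    decide

/-- If all smaller buoys are contracted, then the degree order is perfect on the parts of a buoy. -/
theorem isPerfectOrder_twin (hP : NoPath g) (hH : NoHouse g) (hg : ∀ u v, g.Adj u v → u < n)
    (hc : IsC5 g c) (h : ∀ d, IsC5 g d → buoySize g n d < buoySize g n c → Contracted g L d)
    (i : Fin 5) :
    IsPerfectOrder g (degIn g (Finset.range n)) {v | Twin g c i v ∧ L v ≠ []} := by
  refine isPerfectOrder_of_contracted hP hH hg (Y := {v | Twin g c i v})
    fun x p q r s hx hp hq hr hs => h _ hx (buoySize_lt hP hH hg hc (i := i) ?_)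
  have hxi : Twin g c i x := by
    by_contra hn
    exact (hx 0).2 ((adj_iff_of_not_twin hP hH hc hn hp hq).1 (hx 0).1)
  intro k
  fin_cases k <;> assumption

/-- The five-cycle that is stored for the vertices `v` and `q`. -/
def stored (n : ℕ) (σ : State) (v q : ℕ) : Fin 5 → ℕ :=
  ![v, σ 18 (v * n + q), σ 17 (v * n + q), q, σ 19 (v * n + q)]

/-- For every buoy, some stored five-cycle has this buoy. -/
theorem exists_stored (hP : NoPath g) (hH : NoHouse g) (hg : ∀ u v, g.Adj u v → u < n)
    (hdet : ∀ v < n, ∀ q < n, Detected g n σ v q) (hc : IsC5 g c) :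
    ∃ v < n, ∃ q < n, σ 16 (v * n + q) = buoySize g n c ∧
      ∀ u, Buoy g (stored n σ v q) u ↔ Buoy g c u := by
  obtain ⟨q, hq, h1, h2, h3, h4⟩ := exists_detection hP hH hc
  have hqn : q < n := hg _ _ hq.choose_spec.1
  have hvn : c 0 < n := hg _ _ (hc 0).1
  obtain ⟨d1, d2⟩ := hdet _ hvn q hqn
  have hne : σ 16 (c 0 * n + q) ≠ 0 := fun h0 =>
    d2 h0 ⟨h1, h2, h3, fun p hp hpq hvp hpv => ⟨(h4 p hp hpq hvp hpv).1, (h4 p hp hpq hvp hpv).2.1⟩⟩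
  obtain ⟨hD, hsz⟩ := d1 hne
  have hpv : σ 17 (c 0 * n + q) ≠ c 0 := fun h => h1 (h ▸ hD.pq)
  have hb := (h4 _ hD.lt hD.pq hD.vp hpv).2.2 _ _ hD.va hD.pa hD.qa hD.vb hD.qb hD.pb
  exact ⟨c 0, hvn, q, hqn, hsz.trans (buoySize_congr hb), hb⟩

/-- Store the five-cycle at the position in the variable `33` in array `20`. -/
def load : Prog :=
  .seq (set 48 (.op .div (var 33) (var 0)))
    (.seq (set 49 (.op .sub (var 33) (.op .mul (var 48) (var 0))))
    (.seq (.assign 20 (.const 0) (var 48)) (.seq (.assign 20 (.const 1) (.read 18 (var 33)))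
    (.seq (.assign 20 (.const 2) (.read 17 (var 33))) (.seq (.assign 20 (.const 3) (var 49))
      (.assign 20 (.const 4) (.read 19 (var 33))))))))

/-- Contract all buoys whose size exceeds the variable `32` by one. -/
def contractSize : Prog :=
  forTo 33 43 (.ite (.op .eq (.read 16 (var 33)) (.op .add (var 32) (.const 1)))
    (.seq load contractBuoy) .skip)

/-- Contract all buoys in the order of their sizes. -/
def contractAll : Prog := forTo 32 0 contractSize

theorem run_load {v q : ℕ} (hn : σ 0 0 = n) (hv : v < n) (hq : q < n) (h33 : σ 33 0 = v * n + q)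
    (hB : n * n + 10 ≤ B) :
    Run B load σ fun t τ => t ≤ 60 ∧ Frame [20, 48, 49] σ τ ∧ ∀ i : Fin 5, τ 20 i = stored n σ v q i := by
  have hlt := mul_add_lt hv hq
  have hdiv : (v * n + q) / n = v := by
    rw [mul_comm, Nat.mul_add_div (by omega), Nat.div_eq_of_lt hq, add_zero]
  have h1 : (1 : ℕ) ≤ B := by omega
  have h2 : (2 : ℕ) ≤ B := by omega
  have h3 : (3 : ℕ) ≤ B := by omega
  have h4 : (4 : ℕ) ≤ B := by omega
  have hqB : q ≤ B := by omega
  have hvB : v ≤ B := by nlinarith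
  have hvnB : v * n ≤ B := by omega
  simp [load, hn, h33, hdiv, h1, h2, h3, h4, hvB, hvnB]
  refine ⟨?_, ?_, ?_⟩
  · omega
  · exact (((((((Frame.refl _ _).store (by simp)).store (by simp)).store (by simp)).store
      (by simp)).store (by simp)).store (by simp)).store (by simp)
  · intro i
    fin_cases i <;> simp [store_same, stored]

/-- The pieces that are left after a number of contractions, and bounds on the memory and on the
number of pieces. -/
structure Compact (g : SimpleGraph ℕ) (n W : ℕ) (w : ℕ → ℕ) (L : ℕ → List Piece) (σ : State) :
    Prop where
  mem : Mem g n L σ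
  stage : Stage g n W w L
  pieces_le : pieces (Finset.range n) L + 5 * numAlive n L ≤ 6 * n
  rows_le : σ 13 0 + 41 * (n + 1) * numAlive n L ≤ n + 41 * (n + 1) * n

theorem Compact.frame {τ : State} (h : Compact g n W w L σ) {l : List ℕ} (hF : Frame l σ τ)
    (hl : ∀ a ∈ [0, 1, 6, 8, 9, 10, 11, 12, 13], a ∉ l) : Compact g n W w L τ :=
  ⟨h.mem.frame hF hl, h.stage, h.pieces_le, by rw [hF 13 (hl 13 (by simp))]; exact h.rows_le⟩

abbrev sizeFrame : List ℕ := [20, 33, 48, 49] ++ contractFrame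

/-- Since there are at most `n²` stored five-cycles, going through all of them for each size is
cheap enough. A contraction is charged to the entries of array `16` with the present size and to the
potential. -/
theorem run_contractSize (hP : NoPath g) (hH : NoHouse g) (hg : ∀ u v, g.Adj u v → u < n) {k : ℕ}
    (hk : k < n) (hdet : ∀ v < n, ∀ q < n, Detected g n σ v q) (h32 : σ 32 0 = k)
    (h43 : σ 43 0 = n * n) (hL : Compact g n W w L σ)
    (hsmall : ∀ c, IsC5 g c → buoySize g n c ≤ k → Contracted g L c)
    (hB : 100 * ((n + 1) * (n + 1) * (n + 2)) ≤ B) (hBW : (60 * n + 10) * (W + 1) ≤ B) :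
    Run B contractSize σ fun t τ => Frame sizeFrame σ τ ∧ ∃ L', Compact g n W w L' τ ∧
      (∀ c, IsC5 g c → buoySize g n c ≤ k + 1 → Contracted g L' c) ∧
      t + numAlive n L' * (100000 * ((n + 1) * (n + 1))) ≤
        numAlive n L * (100000 * ((n + 1) * (n + 1))) + 100 * (n * n + 1) +
        2100 * (n + 1) * ((Finset.range (n * n)).filter fun j => σ 16 j = k + 1).card := by
  set A := 100000 * ((n + 1) * (n + 1)) with hA
  have hnB : n * n + n + 10 ≤ B := by nlinarith
  refine (run_forTo (N := n * n) (fun j s ρ => Frame sizeFrame σ ρ ∧ ∃ L', Compact g n W w L' ρ ∧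
    (∀ u, L' u ≠ [] → L u ≠ []) ∧
    (∀ v < n, ∀ q < n, v * n + q < j → σ 16 (v * n + q) = k + 1 → Contracted g L' (stored n σ v q)) ∧
    s + numAlive n L' * A ≤ numAlive n L * A + 50 * j +
      2100 * (n + 1) * ((Finset.range j).filter fun j => σ 16 j = k + 1).card)
    (numAlive n L * A + 50 * (n * n) + 2100 * (n + 1) * (n * n)) (by decide) (by omega) h43 ?_ ?_
    ?_).mono ?_
  · refine ⟨(Frame.refl _ _).store (by simp), L, hL.frame (l := [33])
      ((Frame.refl _ _).store (by simp)) (by decide), fun _ h => h, by simp, by simp⟩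
  · rintro j s ρ hj ⟨-, L', -, -, -, hs⟩
    have h1 := Nat.mul_le_mul_left (2100 * (n + 1))
      ((card_filter_range_le (fun j => σ 16 j = k + 1) j).trans hj)
    omega
  · rintro j s ρ hj hρj hρN ⟨hF, L', hL', hsub, hdone, hs⟩
    have hn : 0 < n := by omega
    obtain ⟨v, q, hv, hq, rfl⟩ : ∃ v q, v < n ∧ q < n ∧ j = v * n + q :=
      ⟨j / n, j % n, (Nat.div_lt_iff_lt_mul hn).2 hj, Nat.mod_lt _ hn, (Nat.div_add_mod' j n).symm⟩
    have e16 : ρ 16 = σ 16 := hF 16 (by decide)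
    have e32 : ρ 32 0 = k := by rw [hF 32 (by decide), h32]
    simp only [run_ite, run_skip, Expr.Fits, Expr.eval, Op.eval, Expr.cost, hρj, e16, e32,
      Nat.zero_le, true_and]
    refine ⟨⟨⟨by omega, by omega⟩, (ite_le_one _).trans (by omega)⟩, fun h => ?_, fun h => ?_⟩
    · have hsz : σ 16 (v * n + q) = k + 1 := by
        by_contra h'
        simp [h'] at h
      obtain ⟨hD, hbs⟩ := (hdet v hv q hq).1 (by omega)
      have hc : IsC5 g (stored n σ v q) := hD.isC5 hH
      have hst : stored n ρ v q = stored n σ v q := by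
        rw [stored, stored, hF 17 (by decide), hF 18 (by decide), hF 19 (by decide)]
      rw [run_seq]
      refine (run_load hL'.mem.size hv hq hρj (by omega)).mono ?_
      rintro t₁ ρ₁ ⟨ht₁, hF₁, h20⟩
      rw [hst] at h20
      have hL₁ := hL'.frame hF₁ (by decide)
      have hrows := hL₁.rows_le
      refine (run_contractBuoy hP hH hg hL₁.mem hL₁.stage hc h20 ?_ hL₁.pieces_le ?_ hBW).mono ?_
      · refine isPerfectOrder_twin hP hH hg hc fun d hd hlt => (hsmall d hd ?_).mono hsub
        have : buoySize g n (stored n σ v q) = k + 1 := hbs.symm.trans hsz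
        omega
      · refine le_trans ?_ hB
        rw [← mul_assoc]
        refine Nat.mul_le_mul_right _ ?_
        nlinarith
      rintro t₂ τ ⟨hF₂, L'', hm'', hs'', hsub'', hcon, hp'', hr'', ht₂⟩
      rw [← hA] at ht₂
      refine ⟨?_, ?_, ((hF.trans hF₁ (by simp)).trans hF₂ (by simp)).store (by simp), L'',
        Compact.frame (l := [33]) (σ := τ) ⟨hm'', hs'', hp'', hr''.trans hrows⟩
          ((Frame.refl _ _).store (by simp)) (by decide), fun u hu => hsub u (hsub'' u hu), ?_, ?_⟩
      · rw [hF₂ 33 (by decide), hF₁ 33 (by decide), hρj]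
      · rw [hF₂ 43 (by decide), hF₁ 43 (by decide), hρN]
      · intro v' hv' q' hq' hlt hsz'
        rcases Nat.lt_succ_iff_lt_or_eq.1 hlt with hlt | heq
        · exact (hdone v' hv' q' hq' hlt hsz').mono hsub''
        · obtain ⟨rfl, rfl⟩ := (mul_add_eq_iff hq' hq).1 heq
          exact hcon
      · rw [card_filter_range_succ, if_pos hsz, mul_add (2100 * (n + 1)) _ 1, mul_one]
        omega
    · have hsz : σ 16 (v * n + q) ≠ k + 1 := by
        intro h'
        simp [h'] at h
      refine ⟨hρN, hF.store (by simp), L', hL'.frame (l := [33])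
        ((Frame.refl _ _).store (by simp)) (by decide), hsub, ?_, ?_⟩
      · intro v' hv' q' hq' hlt hsz'
        refine hdone v' hv' q' hq' (lt_of_le_of_ne (Nat.lt_succ_iff.1 hlt) fun heq => hsz ?_) hsz'
        rw [← heq, hsz']
      · rw [card_filter_range_succ, if_neg hsz, add_zero]
        omega
  · rintro t τ ⟨s, rfl, ⟨hF, L', hL', hsub, hdone, hs⟩, -⟩
    refine ⟨hF, L', hL', fun c hc hsz => ?_, by omega⟩
    rcases Nat.lt_or_ge k (buoySize g n c) with hlt | hle
    · obtain ⟨v, hv, q, hq, h1, h2⟩ := exists_stored hP hH hg hdet hc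
      exact (hdone v hv q hq (mul_add_lt hv hq) (by omega)).congr h2
    · exact (hsmall c hc hle).mono hsub

theorem Detected.frame {τ : State} {v q : ℕ} (h : Detected g n σ v q) {l : List ℕ}
    (hF : Frame l σ τ) (hl : ∀ a ∈ [16, 17, 18, 19], a ∉ l) : Detected g n τ v q := by
  rw [Detected, hF 16 (hl 16 (by simp)), hF 17 (hl 17 (by simp)), hF 18 (hl 18 (by simp)),
    hF 19 (hl 19 (by simp))]
  exact h

abbrev contractAllFrame : List ℕ := 32 :: sizeFrame

theorem run_contractAll (hP : NoPath g) (hH : NoHouse g) (hg : ∀ u v, g.Adj u v → u < n)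
    (hdet : ∀ v < n, ∀ q < n, Detected g n σ v q) (h43 : σ 43 0 = n * n)
    (hL : Compact g n W w L σ)
    (hB : 100 * ((n + 1) * (n + 1) * (n + 2)) ≤ B) (hBW : (60 * n + 10) * (W + 1) ≤ B) :
    Run B contractAll σ fun t τ => Frame contractAllFrame σ τ ∧ ∃ L', Compact g n W w L' τ ∧
      (∀ c, IsC5 g c → Contracted g L' c) ∧ t ≤ 103000 * ((n + 1) * (n + 1) * (n + 1)) := by
  set A := 100000 * ((n + 1) * (n + 1)) with hA
  have hal : numAlive n L ≤ n := card_filter_range_le _ _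
  set D := 2100 * (n + 1) with hD
  refine (run_forTo (N := n) (fun k s ρ => Frame contractAllFrame σ ρ ∧ ∃ L', Compact g n W w L' ρ ∧
    (∀ c, IsC5 g c → buoySize g n c ≤ k → Contracted g L' c) ∧
    s + numAlive n L' * A ≤ numAlive n L * A + k * (100 * (n * n + 2)) +
      D * ((Finset.range (n * n)).filter fun j => σ 16 j ≤ k).card)
    (numAlive n L * A + n * (100 * (n * n + 2)) + D * (n * n)) (by decide) (by nlinarith) hL.mem.size ?_ ?_
    ?_).mono ?_
  · refine ⟨(Frame.refl _ _).store (by simp), L, hL.frame (l := [32])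
      ((Frame.refl _ _).store (by simp)) (by decide), fun c hc h0 => ?_, by omega⟩
    have := buoySize_pos hg hc
    omega
  · rintro k s ρ hk ⟨-, L', -, -, hs⟩
    have h1 := Nat.mul_le_mul_left D (card_filter_range_le (fun j => σ 16 j ≤ k) (n * n))
    have h2 := Nat.mul_le_mul_right (100 * (n * n + 2)) hk
    omega
  · rintro k s ρ hk hρk hρn ⟨hF, L', hL', hsm, hs⟩
    have e16 : ρ 16 = σ 16 := hF 16 (by decide)
    refine (run_contractSize hP hH hg hk (fun v hv q hq => (hdet v hv q hq).frame hF (by decide)) hρk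
      (by rw [hF 43 (by decide), h43]) hL' hsm hB hBW).mono ?_
    rintro t τ ⟨hFτ, L'', hL'', hsm', ht⟩
    rw [← hA, ← hD, e16] at ht
    refine ⟨by rw [hFτ 32 (by decide), hρk], by rw [hFτ 0 (by decide), hρn],
      (hF.trans hFτ (by simp)).store (by simp), L'', hL''.frame (l := [32])
      ((Frame.refl _ _).store (by simp)) (by decide), hsm', ?_⟩
    have hcard : ((Finset.range (n * n)).filter fun j => σ 16 j ≤ k + 1).card =
        ((Finset.range (n * n)).filter fun j => σ 16 j ≤ k).card +
          ((Finset.range (n * n)).filter fun j => σ 16 j = k + 1).card := by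
      rw [← Finset.card_union_of_disjoint]
      · congr 1
        ext j
        simp only [Finset.mem_filter, Finset.mem_union, Finset.mem_range]
        omega
      · rw [Finset.disjoint_left]
        intro j hj hj'
        have h1 := (Finset.mem_filter.1 hj).2
        have h2 := (Finset.mem_filter.1 hj').2
        omega
    rw [hcard, mul_add D, add_mul k 1, one_mul]
    omega
  · rintro t τ ⟨s, rfl, ⟨hF, L', hL', hsm, hs⟩, -⟩
    refine ⟨hF, L', hL', fun c hc => hsm c hc buoySize_le, ?_⟩
    have h1 := Nat.mul_le_mul_left D (card_filter_range_le (fun j => σ 16 j ≤ n) (n * n))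
    have h2 := Nat.mul_le_mul_right A hal
    have h3 : s + 9 ≤ n * A + n * (100 * (n * n + 2)) + D * (n * n) + 9 := by omega
    refine h3.trans ?_
    rw [hA, hD]
    nlinarith

end WordRAM

/-! ### The last merging and the output -/

namespace WordRAM

open BuoyColoring

variable {B n W : ℕ} {σ : State} {g : SimpleGraph ℕ} {w : ℕ → ℕ} {L : ℕ → List Piece}
  {O : List Piece}

theorem Seg.getElem {m : ℕ} (h : Seg n σ m O) {k : ℕ} (hk : k < O.length) :
    σ 11 (m + k) = O[k].2 ∧ RowIs n σ (m + k) O[k].1 := by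
  induction O generalizing m k with
  | nil => simp at hk
  | cons P l ih =>
    obtain ⟨h1, h2, h3⟩ := h
    cases k with
    | zero => exact ⟨h1, h2⟩
    | succ k =>
      rw [show m + (k + 1) = m + 1 + k by omega]
      exact ih h3 (by simpa using hk)

/-- Copy the pieces from the one in the variable `40` on to the output arrays. -/
def output : Prog :=
  .seq (set 3 (.op .sub (var 13) (var 40)))
    (forTo 32 3 (.seq (.assign 5 (var 32) (.read 11 (.op .add (var 40) (var 32))))
      (forTo 30 0 (.assign 4 (.op .add (.op .mul (var 32) (var 0)) (var 30))
        (.read 12 (.op .add (.op .mul (.op .add (var 40) (var 32)) (var 0)) (var 30)))))))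

/-- The output arrays hold the pieces in the list `O`. -/
def HoldsOutput (n : ℕ) (O : List Piece) (σ : State) : Prop :=
  σ 3 0 = O.length ∧ ∀ k (hk : k < O.length),
    (∀ x < n, σ 4 (k * n + x) = if x ∈ O[k].1 then 1 else 0) ∧ σ 5 k = O[k].2

theorem run_output {m : ℕ} (hn : σ 0 0 = n) (h40 : σ 40 0 = m) (hO : Seg n σ m O)
    (h13 : m + O.length = σ 13 0) (hB : (σ 13 0 + 2) * (n + 2) ≤ B) :
    Run B output σ fun t τ => t ≤ (O.length + 1) * (100 * (n + 1)) ∧ HoldsOutput n O τ := by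
  have hB' : σ 13 0 * n + 2 * n + 2 * σ 13 0 + 4 ≤ B := by nlinarith
  have hsub : σ 13 0 - σ 40 0 = O.length := by omega
  simp only [output, run_seq (p := set _ _), run_assign, Expr.Fits, Expr.eval, Op.eval, Expr.cost,
    Nat.zero_le, true_and, hsub]
  refine ⟨by omega, ?_⟩
  refine (run_forTo' (N := O.length) (fun k ρ => Frame [3, 4, 5, 30, 32] σ ρ ∧
    ∀ i (hi : i < O.length), i < k → (∀ x < n, ρ 4 (i * n + x) = if x ∈ O[i].1 then 1 else 0) ∧
      ρ 5 i = O[i].2) (42 * n + 60) (by decide) (by omega) (by simp) ?_ ?_).mono ?_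
  · exact ⟨((Frame.refl _ _).store (by simp)).store (by simp), by simp⟩
  · rintro k ρ hk hρk hρN ⟨hF, hold⟩
    have e0 : ρ 0 0 = n := by rw [hF 0 (by decide), hn]
    have e40 : ρ 40 0 = m := by rw [hF 40 (by decide), h40]
    have e11 : ρ 11 = σ 11 := hF 11 (by decide)
    obtain ⟨hw, hrow⟩ := hO.getElem hk
    simp only [run_seq (p := .assign _ _ _), run_assign, Expr.Fits, Expr.eval, Op.eval, Expr.cost,
      Nat.zero_le, true_and, hρk, e40, e11, hw]
    refine ⟨by omega, ?_⟩
    set ρ₁ := ρ.store 5 k O[k].2 with hρ₁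
    have hF₁ : Frame [5] ρ ρ₁ := (Frame.refl _ _).store (by simp)
    refine (run_forTo' (N := n) (fun j τ => Frame [4, 30] ρ₁ τ ∧
      (∀ i x, x < n → τ 4 (i * n + x) =
        if i = k ∧ x < j then if x ∈ O[k].1 then 1 else 0 else ρ 4 (i * n + x))) 30 (by decide) (by omega)
      (by rw [hF₁ 0 (by decide), e0]) ?_ ?_).mono ?_
    · refine ⟨(Frame.refl _ _).store (by simp), fun i x hx => ?_⟩
      rw [store_ne (by decide), hF₁ 4 (by decide), if_neg fun h => by omega]
    · rintro j τ hj hτj hτn ⟨hFτ, h4⟩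
      have f32 : τ 32 0 = k := by rw [hFτ 32 (by decide), hF₁ 32 (by decide), hρk]
      have f40 : τ 40 0 = m := by rw [hFτ 40 (by decide), hF₁ 40 (by decide), e40]
      have f12 : τ 12 = σ 12 := by rw [hFτ 12 (by decide), hF₁ 12 (by decide), hF 12 (by decide)]
      have hlt := mul_add_lt (show m + k < σ 13 0 by omega) hj
      have hlt' := mul_add_lt (show k < σ 13 0 by omega) hj
      simp only [run_assign, Expr.Fits, Expr.eval, Op.eval, Expr.cost, Nat.zero_le, true_and, hτj, hτn,
        f32, f40, f12, hrow j hj]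
      refine ⟨⟨by omega, by omega⟩, ⟨⟨by omega, by omega⟩, by omega⟩, by omega, ?_, ?_,
        (hFτ.store (by simp)).store (by simp), fun i x hx => ?_⟩
      · rwa [store_ne (by decide)]
      · rwa [store_ne (by decide)]
      · rw [store_ne (by decide), store_same, h4 i x hx]
        simp only [mul_add_eq_iff hx hj]
        by_cases hik : i = k
        · by_cases hxj : x = j
          · simp [hik, hxj]
          · have : x < j + 1 ↔ x < j := by omega
            simp [hik, hxj, this]
        · simp [hik]
    · rintro t τ ⟨ht, ⟨hFτ, h4⟩, -⟩
      refine ⟨by omega, ?_, ?_, ?_, ?_⟩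
      · rw [hFτ 32 (by decide), hF₁ 32 (by decide), hρk]
      · rw [hFτ 3 (by decide), hF₁ 3 (by decide), hρN]
      · exact ((hF.trans hF₁ (by simp)).trans hFτ (by simp)).store (by simp)
      · intro i hi hik
        simp only [store_ne (show 4 ≠ 32 by decide), store_ne (show 5 ≠ 32 by decide),
          hFτ 5 (by decide), hρ₁, store_same]
        by_cases h : i = k
        · subst h
          simp only [if_true, and_true]
          intro x hx
          rw [h4 i x hx, if_pos ⟨rfl, hx⟩]
        · rw [if_neg h]
          refine ⟨fun x hx => ?_, (hold i hi (by omega)).2⟩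
          rw [h4 i x hx, if_neg fun h' => h h'.1]
          exact (hold i hi (by omega)).1 x hx
  · rintro t τ ⟨ht, ⟨hF, h⟩, -, h3⟩
    refine ⟨?_, h3, fun k hk => h k hk hk⟩
    nlinarith

/-- Give the label `1` to all vertices. -/
def labelAll : Prog := forTo 30 0 (.assign 7 (var 30) (.const 1))

theorem run_labelAll (hn : σ 0 0 = n) (hB : n + 1 ≤ B) :
    Run B labelAll σ fun t τ => t ≤ 30 * (n + 1) ∧ Frame [7, 30] σ τ ∧ ∀ u < n, τ 7 u = 1 := by
  refine (run_forTo' (N := n) (fun k ρ => Frame [7, 30] σ ρ ∧ ∀ u < k, ρ 7 u = 1) 10 (by decide) hB hn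
    ?_ ?_).mono ?_
  · exact ⟨(Frame.refl _ _).store (by simp), by simp⟩
  · rintro k ρ hk hρk hρn ⟨hF, h7⟩
    simp only [run_assign, Expr.Fits, Expr.eval, Expr.cost, Nat.zero_le, true_and, hρk]
    refine ⟨by omega, by omega, by rwa [store_ne (by decide)], by rwa [store_ne (by decide)],
      (hF.store (by simp)).store (by simp), fun u hu => ?_⟩
    rw [store_ne (by decide), store_same]
    by_cases huk : u = k
    · rw [if_pos huk]
    · rw [if_neg huk]
      exact h7 u (by omega)
  · rintro t τ ⟨ht, ⟨hF, h7⟩, -⟩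
    exact ⟨by omega, hF, h7⟩

/-- Merge all pieces that are left, and write the result to the output arrays. -/
def finish : Prog := .seq labelAll (.seq (set 39 (.const 1)) (.seq greedyMerge output))

/-- The pieces in `O` are a minimum weighted coloring of the graph `g` with the weights `w`. -/
structure IsOptimal (g : SimpleGraph ℕ) (w : ℕ → ℕ) (O : List Piece) : Prop where
  indep : ∀ P ∈ O, g.IsIndepSet (P.1 : Set ℕ)
  cover : ∀ x, w x ≤ cov x O
  le_total : ∀ c : WeightedColoring g w, wsum O ≤ c.total

theorem Merging.isOptimal (hs : Stage g n W w L) {L' : ℕ → List Piece}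
    (hm : Merging g W (Finset.range n) L L' O) (hL' : ∀ r ∈ Finset.range n, L' r = [])
    (hO : CliqueBound g (Finset.range n) L L' O) : IsOptimal g w O where
  indep := hm.indep
  cover x := by
    have h1 := hs.cover x
    have h2 := hm.cover x
    have h0 : ∑ r ∈ Finset.range n, cov x (L' r) = 0 :=
      Finset.sum_eq_zero fun r hr => by rw [hL' r hr, cov_nil]
    omega
  le_total c := by
    obtain ⟨c', hc'⟩ := hs.dominates c
    exact (hO.wsum_le_hits c').trans ((hits_le_total c' _).trans hc')

theorem run_finish (hP : NoPath g) (hH : NoHouse g) (hg : ∀ u v, g.Adj u v → u < n)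
    (hL : Compact g n W w L σ) (hcon : ∀ c, IsC5 g c → Contracted g L c)
    (hB : 100 * ((n + 1) * (n + 1) * (n + 2)) ≤ B) (hBW : (60 * n + 10) * (W + 1) ≤ B) :
    Run B finish σ fun t τ => t ≤ 10000 * ((n + 1) * (n + 1) * (n + 1)) ∧
      ∃ O, IsOptimal g w O ∧ HoldsOutput n O τ := by
  have hpl := hL.pieces_le
  have hp : pieces (Finset.range n) L ≤ 6 * n := by omega
  have hr : σ 13 0 ≤ n + 41 * (n + 1) * n := (Nat.le_add_right _ _).trans hL.rows_le
  have hNP : (n + 41 * (n + 1) * n + 20 * n + 10) * (n + 2) ≤ B := by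
    refine le_trans ?_ hB
    rw [← mul_assoc]
    refine Nat.mul_le_mul_right _ ?_
    nlinarith
  rw [finish, run_seq]
  refine (run_labelAll hL.mem.size (by nlinarith)).mono ?_
  rintro t₁ ρ₁ ⟨ht₁, hF₁, h7⟩
  simp only [run_seq (p := set _ _), run_assign, Expr.Fits, Expr.eval, Expr.cost, Nat.zero_le, true_and]
  refine ⟨by nlinarith, ?_⟩
  set ρ₂ := ρ₁.store 39 0 1 with hρ₂
  have hF₂ : Frame [7, 30, 39] σ ρ₂ := (hF₁.weaken (by simp)).store (by simp)
  have e13 : ρ₂ 13 = σ 13 := hF₂ 13 (by decide)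
  rw [run_seq]
  refine (run_greedyMerge (hL.mem.frame hF₂ (by decide)) hL.stage (X := Finset.range n) ?_ ?_ ?_ ?_).mono
    ?_
  · intro u
    rw [Finset.mem_range, hρ₂, store_ne (by decide), store_eq]
    exact ⟨fun h => ⟨h, h7 u h⟩, fun h => h.1⟩
  · exact isPerfectOrder_of_contracted hP hH hg fun x a b c d h _ _ _ _ => hcon _ h
  · rw [e13]
    exact (Nat.mul_le_mul_right _ (by omega)).trans hNP
  · exact (Nat.mul_le_mul (by omega) (Nat.le_succ W)).trans hBW
  rintro t₃ ρ₃ ⟨hF₃, ht₃, L', O, hm, hmer, hnil, hcb, h40, hseg, hlen, hOle, -⟩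
  rw [e13] at h40 hseg hlen
  refine (run_output hm.size h40 hseg hlen ?_).mono ?_
  · exact (Nat.mul_le_mul_right _ (by omega)).trans hNP
  rintro t₄ τ ⟨ht₄, hout⟩
  refine ⟨?_, O, Merging.isOptimal hL.stage hmer hnil hcb, hout⟩
  have hal : ((Finset.range n).filter fun r => L r ≠ []).card ≤ n := card_filter_range_le _ _
  have h3 : t₃ ≤ (6 * n + 2) * ((n + 1) * (1000 * (n + 1))) :=
    ht₃.trans (Nat.mul_le_mul (by omega) (Nat.mul_le_mul_right _ (by omega)))
  have h4 : t₄ ≤ (6 * n + 1) * (100 * (n + 1)) :=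
    ht₄.trans (Nat.mul_le_mul_right _ (by omega))
  nlinarith

/-- The algorithm. -/
def minColoring : Prog := .seq setup (.seq detectAll (.seq contractAll finish))

open scoped Classical in
theorem run_minColoring (hP : NoPath g) (hH : NoHouse g) (hg : ∀ u v, g.Adj u v → u < n)
    (hw : ∀ v < n, w v ≤ W) (hw0 : ∀ v, n ≤ v → w v = 0) (hn : σ 0 0 = n)
    (hadj : ∀ i < n, ∀ j < n, σ 1 (i * n + j) = if g.Adj i j then 1 else 0)
    (hσw : ∀ v < n, σ 2 v = w v) (h0 : ∀ k, σ 12 k = 0)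
    (hB : 100 * ((n + 1) * (n + 1) * (n + 2)) ≤ B) (hBW : (60 * n + 10) * (W + 1) ≤ B) :
    Run B minColoring σ fun t τ => t ≤ 200000 * ((n + 1) * (n + 1) * (n + 1)) ∧
      ∃ O, IsOptimal g w O ∧ HoldsOutput n O τ := by
  have hnB : n * n + n + 10 ≤ B := by nlinarith
  rw [minColoring, run_seq]
  refine (run_setup hn hadj hσw h0 hnB).mono ?_
  rintro t₁ ρ₁ ⟨ht₁, -, hm₁, h13⟩
  rw [run_seq]
  refine (run_detectAll hH hg hm₁ hnB).mono ?_
  rintro t₂ ρ₂ ⟨ht₂, hF₂, h43, hdet⟩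
  have hL : Compact g n W w (singletons n w) ρ₂ := by
    have hal : numAlive n (singletons n w) ≤ n := card_filter_range_le _ _
    have hp := pieces_singletons_le (n := n) (w := w)
    refine ⟨hm₁.frame hF₂ (by decide), stage_singletons hw hw0, by omega, ?_⟩
    rw [hF₂ 13 (by decide), h13]
    exact Nat.add_le_add_left (Nat.mul_le_mul_left _ hal) _
  rw [run_seq]
  refine (run_contractAll hP hH hg hdet h43 hL hB hBW).mono ?_
  rintro t₃ ρ₃ ⟨-, L, hL', hcon, ht₃⟩
  refine (run_finish hP hH hg hL' hcon hB hBW).mono ?_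
  rintro t₄ τ ⟨ht₄, h⟩
  refine ⟨?_, h⟩
  nlinarith

end WordRAM

/-! ### Transfer to graphs on `Fin n` -/

namespace BuoyColoring

section Transfer

variable {V V' : Type*} {G : SimpleGraph V} (f : V ↪ V')

theorem exists_of_map_adj {u v : V'} (h : (G.map f).Adj u v) : ∃ a, f a = u := by
  obtain ⟨a, b, -, rfl, -⟩ := (SimpleGraph.map_adj _ _ _ _).1 h
  exact ⟨a, rfl⟩

theorem NoPath.map (h : NoPath G) : NoPath (G.map f) := by
  intro a b c d e h1 h2 h3 h4
  obtain ⟨a, rfl⟩ := exists_of_map_adj f h1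
  obtain ⟨b, rfl⟩ := exists_of_map_adj f h2
  obtain ⟨c, rfl⟩ := exists_of_map_adj f h3
  obtain ⟨d, rfl⟩ := exists_of_map_adj f h4
  obtain ⟨e, rfl⟩ := exists_of_map_adj f h4.symm
  simp only [SimpleGraph.map_adj_apply] at *
  exact h a b c d e h1 h2 h3 h4

theorem NoHouse.map (h : NoHouse G) : NoHouse (G.map f) := by
  intro a b c d e h1 h2 h3 h4 h5 h6 h7
  obtain ⟨a, rfl⟩ := exists_of_map_adj f h1
  obtain ⟨b, rfl⟩ := exists_of_map_adj f h2
  obtain ⟨c, rfl⟩ := exists_of_map_adj f h3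
  obtain ⟨d, rfl⟩ := exists_of_map_adj f h4
  obtain ⟨e, rfl⟩ := exists_of_map_adj f h7
  simp only [SimpleGraph.map_adj_apply] at *
  exact h a b c d e h1 h2 h3 h4 h5 h6 h7

end Transfer

/-- The weights on `Fin n`, extended by `0`. -/
def extend {n : ℕ} (w : Fin n → ℕ) (v : ℕ) : ℕ := if h : v < n then w ⟨v, h⟩ else 0

theorem extend_val {n : ℕ} (w : Fin n → ℕ) (v : Fin n) : extend w v = w v := by
  simp [extend]

variable {n : ℕ} {G : SimpleGraph (Fin n)} {w : Fin n → ℕ} {O : List Piece}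

/-- A weighted coloring of a graph on `Fin n` as one of the same graph on the natural numbers. -/
def _root_.WeightedColoring.extend (c : WeightedColoring G w) :
    WeightedColoring (G.map Fin.valEmbedding) (BuoyColoring.extend w) where
  size := c.size
  S k := Fin.val '' c.S k
  I := c.I
  stable k := by
    rintro _ ⟨a, ha, rfl⟩ _ ⟨b, hb, rfl⟩ hab h
    exact c.stable k ha hb (fun h => hab (congrArg _ h))
      ((SimpleGraph.map_adj_apply (f := Fin.valEmbedding)).1 h)
  covers v := by
    by_cases hv : v < n
    · refine le_trans (le_of_eq ?_) ((c.covers ⟨v, hv⟩).trans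
        (Finset.sum_le_sum_of_subset fun k hk => ?_))
      · simp [BuoyColoring.extend, hv]
      · simp only [Finset.mem_filter, Finset.mem_univ, true_and] at hk ⊢
        exact ⟨_, hk, rfl⟩
    · simp [BuoyColoring.extend, hv]

theorem cov_eq_sum (x : ℕ) (O : List Piece) :
    cov x O = ∑ k : Fin O.length, if x ∈ O[k].1 then O[k].2 else 0 :=
  (Fin.sum_univ_fun_getElem O fun P => if x ∈ P.1 then P.2 else 0).symm

theorem wsum_eq_sum (O : List Piece) : wsum O = ∑ k : Fin O.length, O[k].2 :=
  (Fin.sum_univ_fun_getElem O Prod.snd).symm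

/-- The weighted coloring of a graph on `Fin n` that consists of the pieces in `O`. -/
def coloring (hO : WordRAM.IsOptimal (G.map Fin.valEmbedding) (extend w) O) :
    WeightedColoring G w where
  size := O.length
  S k := {v | v.val ∈ O[k].1}
  I k := O[k].2
  stable k u hu v hv huv h := by
    refine hO.indep _ (List.getElem_mem k.isLt) hu hv (fun h => huv (Fin.ext h)) ?_
    exact (SimpleGraph.map_adj_apply (f := Fin.valEmbedding)).2 h
  covers v := by
    have h := hO.cover v
    rw [extend_val, cov_eq_sum, ← Finset.sum_filter] at h
    convert h using 2
    ext k
    simp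

theorem coloring_isMinimum (hO : WordRAM.IsOptimal (G.map Fin.valEmbedding) (extend w) O) :
    (coloring hO).IsMinimum := fun c => by
  have h := hO.le_total c.extend
  rw [wsum_eq_sum] at h
  exact h

end BuoyColoring

open BuoyColoring in
theorem theorem3p3 :
    ∃ (p : WordRAM.Prog) (d : ℕ) (T : ℕ → ℕ),
      ((fun n : ℕ => (T n : ℝ)) =O[Filter.atTop] fun n : ℕ => (n : ℝ) ^ 3) ∧
      ∀ (n : ℕ) (G : SimpleGraph (Fin n)) (w : Fin n → ℕ), IsP5CoP5Free G →
        ∃ (t : ℕ) (τ : WordRAM.State) (c : WeightedColoring G w),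
          WordRAM.Exec ((n + Finset.univ.sup w + 2) ^ d) p (WordRAM.input G w) t τ ∧
          t ≤ T n ∧ WordRAM.Outputs τ c ∧ c.IsMinimum := by
  classical
  refine ⟨WordRAM.minColoring, 10, fun n => 200000 * ((n + 1) * (n + 1) * (n + 1)), ?_, ?_⟩
  · refine Asymptotics.IsBigO.of_bound 1600000 ?_
    filter_upwards [Filter.eventually_ge_atTop 1] with n hn
    have h1 : (1 : ℝ) ≤ n := by exact_mod_cast hn
    have h2 : ((n : ℝ) + 1) ^ 3 ≤ (2 * n) ^ 3 := by gcongr; linarith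
    rw [Real.norm_of_nonneg (by positivity), Real.norm_of_nonneg (by positivity)]
    push_cast
    nlinarith
  · intro n G w hG
    set W := Finset.univ.sup w with hW
    set g := G.map Fin.valEmbedding with hgdef
    have hP : NoPath g := (noPath_of_not_isIndContained hG.1).map _
    have hH : NoHouse g := (noHouse_of_not_isIndContained hG.2).map _
    have hg : ∀ u v, g.Adj u v → u < n := by
      intro u v h
      obtain ⟨a, rfl⟩ := exists_of_map_adj _ h
      exact a.isLt
    have hN : 2 ≤ n + W + 2 := by omega
    have hw : ∀ v < n, extend w v ≤ W := by
      intro v hv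
      rw [extend, dif_pos hv]
      exact Finset.le_sup (f := w) (Finset.mem_univ _)
    have hw0 : ∀ v, n ≤ v → extend w v = 0 := by
      intro v hv
      rw [extend, dif_neg (by omega)]
    have hadj : ∀ i < n, ∀ j < n, WordRAM.input G w 1 (i * n + j) = if g.Adj i j then 1 else 0 := by
      intro i hi j hj
      refine if_congr ⟨?_, fun h => ?_⟩ rfl rfl
      · rintro ⟨i', j', h, hadj⟩
        obtain ⟨rfl, rfl⟩ := (WordRAM.mul_add_eq_iff hj j'.isLt).1 h
        exact (SimpleGraph.map_adj_apply (f := Fin.valEmbedding)).2 hadj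
      · exact ⟨⟨i, hi⟩, ⟨j, hj⟩, rfl,
          (SimpleGraph.map_adj_apply (f := Fin.valEmbedding) (a := ⟨i, hi⟩) (b := ⟨j, hj⟩)).1 h⟩
    -- the numbers that occur are polynomial in `n` and `W`
    have hB : 100 * ((n + 1) * (n + 1) * (n + 2)) ≤ (n + W + 2) ^ 10 :=
      calc 100 * ((n + 1) * (n + 1) * (n + 2))
          ≤ (n + W + 2) ^ 7 * ((n + W + 2) * (n + W + 2) * (n + W + 2)) := by
            refine Nat.mul_le_mul (le_trans (by norm_num) (Nat.pow_le_pow_left hN 7)) ?_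
            gcongr <;> omega
        _ = (n + W + 2) ^ 10 := by ring
    have hBW : (60 * n + 10) * (W + 1) ≤ (n + W + 2) ^ 10 :=
      calc (60 * n + 10) * (W + 1) ≤ ((n + W + 2) ^ 6 * (n + W + 2)) * (n + W + 2) ^ 3 := by
            refine Nat.mul_le_mul ?_ ?_
            · have h := Nat.mul_le_mul_right (n + W + 2)
                (le_trans (by norm_num) (Nat.pow_le_pow_left hN 6) : 64 ≤ (n + W + 2) ^ 6)
              omega
            · exact (show W + 1 ≤ n + W + 2 by omega).trans (Nat.le_self_pow (by decide) _)
        _ = (n + W + 2) ^ 10 := by ring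
    obtain ⟨t, τ, hexec, ht, O, hO, hlen, hout⟩ := WordRAM.run_minColoring hP hH hg hw hw0
      (σ := WordRAM.input G w) rfl
      (by convert hadj) (fun _ _ => rfl) (fun _ => rfl) hB hBW
    refine ⟨t, τ, coloring hO, hexec, ht, ⟨hlen, fun k v => ?_, fun k => ?_⟩, coloring_isMinimum hO⟩
    · exact ((hout k.val k.isLt).1 v v.isLt).trans (if_congr Iff.rfl rfl rfl)
    · exact (hout k.val k.isLt).2
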